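/- All graphs are finite and undirected; they may have parallel edges but no self-loops. A feedback vertex set of a graph $G$ is a set $S\subseteq V(G)$ such that $G-S$ is acyclic (two parallel edges form a cycle), and it is minimum if no feedback vertex set of $G$ has fewer vertices. For a graph $G$ and an integer $k\ge 0$ let $\#\mathrm{minFVS}(G,k)$ be the number of minimum feedback vertex sets of $G$ that have size at most $k$; so it is $0$ if every feedback vertex set of $G$ has more than $k$ vertices, and otherwise it is the number of all minimum feedback vertex sets of $G$. Lemma. There is an algorithm that, given a graph $G$ on $n$ vertices (as its adjacency matrix of edge multiplicities) and an integer $k\ge 0$, computes $\#\mathrm{minFVS}(G,k)$ (in binary) in time $26^k\cdot \mathrm{poly}(n)$, and hence in time $2^{\mathcal{O}(k)}\cdot\mathrm{poly}(n)$. Here an algorithm is a finite system of first-order recursive functions over binary trees (Lisp-style lists), numbers are lists of bits, and the running time is the number of evaluation steps, where reading a variable, forming a pair, a projection of a pair, a test for the empty tree and a function call each count as one step. -/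

import Mathlib

namespace CountFVS

/-! ### Multigraphs and minimum feedback vertex sets -/

/-- An undirected graph on the vertex set `V`, possibly with parallel edges, without self-loops.
The multiset of edges is given by the multiplicity of every unordered pair of vertices. -/
structure Multigraph (V : Type*) where
  mult : Sym2 V → ℕ
  loopless : ∀ v : V, mult s(v, v) = 0

namespace Multigraph

variable {V : Type*}

/-- The graph `G - S`, that is, the subgraph induced by the vertices outside `S`. -/
def deleteVerts (G : Multigraph V) (S : Finset V) : Multigraph {v : V // v ∉ S} where
  mult e := G.mult (e.map Subtype.val)
  loopless v := G.loopless v.val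

/-- The edges `v₀v₁, v₁v₂, …, vₗv₀` run through by the cyclic sequence `v₀, v₁, …, vₗ`. -/
def cyclicEdges (c : List V) : List (Sym2 V) :=
  List.zipWith (fun u v => s(u, v)) c (c.rotate 1)

/-- A cycle of `G`: at least two distinct vertices in cyclic order such that the edges
run through, counted with multiplicity, are available in `G`. In particular two vertices
form a cycle exactly if at least two parallel edges join them. -/
def IsCycle [DecidableEq V] (G : Multigraph V) (c : List V) : Prop :=
  c.Nodup ∧ 2 ≤ c.length ∧ ∀ e : Sym2 V, (cyclicEdges c).count e ≤ G.mult e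

/-- `G` is a forest. -/
def IsAcyclic [DecidableEq V] (G : Multigraph V) : Prop :=
  ∀ c : List V, ¬ G.IsCycle c

/-- `S` is a feedback vertex set of `G`. -/
def IsFVS [DecidableEq V] (G : Multigraph V) (S : Finset V) : Prop :=
  (G.deleteVerts S).IsAcyclic

/-- `S` is a feedback vertex set of `G` of minimum size. -/
def IsMinimumFVS [DecidableEq V] (G : Multigraph V) (S : Finset V) : Prop :=
  G.IsFVS S ∧ ∀ T : Finset V, G.IsFVS T → S.card ≤ T.card

/-- `#minFVS(G, k)`: the number of minimum feedback vertex sets of `G` that have size at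
most `k`. It is `0` if the feedback vertex number of `G` exceeds `k`. -/
noncomputable def numMinFVS [DecidableEq V] (G : Multigraph V) (k : ℕ) : ℕ :=
  Set.ncard {S : Finset V | G.IsMinimumFVS S ∧ S.card ≤ k}

end Multigraph

/-! ### The model of computation

Programs are finite systems of (mutually) recursive first-order functions over binary trees
(pure first-order Lisp whose only atom is `nil`). The primitive operations are reading a
variable, `nil`, pairing, the two projections and the test for `nil`; every one of them,
and every function call, is one step (constant time on a pointer machine). -/

/-- Values: binary trees. -/
inductive Data where
  | nil : Data
  | cons : Data → Data → Data

namespace Data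

/-- First component of a pair; `nil` for `nil`. -/
def head : Data → Data
  | nil => nil
  | cons a _ => a

/-- Second component of a pair; `nil` for `nil`. -/
def tail : Data → Data
  | nil => nil
  | cons _ b => b

/-- A list, as a chain of pairs that ends in `nil`. -/
def ofList : List Data → Data
  | [] => nil
  | x :: xs => cons x (ofList xs)

/-- A bit. -/
def ofBool : Bool → Data
  | false => nil
  | true => cons nil nil

/-- A natural number in binary: the list of its bits, least significant bit first, without
leading zeros. -/
def ofNat (m : ℕ) : Data :=
  ofList (m.bits.map ofBool)

end Data

/-- Program expressions. Variables are numbered by the innermost binding first. -/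
inductive Code where
  | var (i : ℕ) : Code
  | nil : Code
  | cons (a b : Code) : Code
  | head (a : Code) : Code
  | tail (a : Code) : Code
  /-- `ite c a b`: if the value of `c` is not `nil` then `a` else `b`. -/
  | ite (c a b : Code) : Code
  /-- `bind a b`: evaluate `b` with the value of `a` as the new variable `0`. -/
  | bind (a b : Code) : Code
  /-- `call f a`: apply the function number `f` to the value of `a`. -/
  | call (f : ℕ) (a : Code) : Code

/-- A program: the bodies of its functions. Each function has one argument, which is
variable `0` of its body; function number `0` is the main function. -/
abbrev Program := List Code

/-- `Eval P env e v t`: in the program `P`, with `env` as the list of the values of the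
variables, the expression `e` evaluates to `v` in exactly `t` steps. -/
inductive Eval (P : Program) : List Data → Code → Data → ℕ → Prop where
  | var (env : List Data) (i : ℕ) : Eval P env (Code.var i) (env.getD i Data.nil) 1
  | nil (env : List Data) : Eval P env Code.nil Data.nil 1
  | cons {env : List Data} {a b : Code} {v w : Data} {s t : ℕ} :
      Eval P env a v s → Eval P env b w t →
        Eval P env (Code.cons a b) (Data.cons v w) (s + t + 1)
  | head {env : List Data} {a : Code} {v : Data} {s : ℕ} :
      Eval P env a v s → Eval P env (Code.head a) v.head (s + 1)
  | tail {env : List Data} {a : Code} {v : Data} {s : ℕ} :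
      Eval P env a v s → Eval P env (Code.tail a) v.tail (s + 1)
  | ite_cons {env : List Data} {c a b : Code} {x y w : Data} {s t : ℕ} :
      Eval P env c (Data.cons x y) s → Eval P env a w t →
        Eval P env (Code.ite c a b) w (s + t + 1)
  | ite_nil {env : List Data} {c a b : Code} {w : Data} {s t : ℕ} :
      Eval P env c Data.nil s → Eval P env b w t →
        Eval P env (Code.ite c a b) w (s + t + 1)
  | bind {env : List Data} {a b : Code} {v w : Data} {s t : ℕ} :
      Eval P env a v s → Eval P (v :: env) b w t →
        Eval P env (Code.bind a b) w (s + t + 1)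
  | call {env : List Data} {f : ℕ} {a b : Code} {v w : Data} {s t : ℕ} :
      P[f]? = some b → Eval P env a v s → Eval P [v] b w t →
        Eval P env (Code.call f a) w (s + t + 1)

/-- Evaluation is deterministic: the value and the number of steps are determined. -/
theorem Eval.det {P : Program} {env : List Data} {e : Code} {v w : Data} {s t : ℕ}
    (h : Eval P env e v s) (h' : Eval P env e w t) : v = w ∧ s = t := by
  induction h generalizing w t with
  | var => cases h'; exact ⟨rfl, rfl⟩
  | nil => cases h'; exact ⟨rfl, rfl⟩
  | cons _ _ iha ihb =>
    cases h' with
    | cons ha hb =>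
      obtain ⟨rfl, rfl⟩ := iha ha
      obtain ⟨rfl, rfl⟩ := ihb hb
      exact ⟨rfl, rfl⟩
  | head _ iha =>
    cases h' with
    | head ha =>
      obtain ⟨rfl, rfl⟩ := iha ha
      exact ⟨rfl, rfl⟩
  | tail _ iha =>
    cases h' with
    | tail ha =>
      obtain ⟨rfl, rfl⟩ := iha ha
      exact ⟨rfl, rfl⟩
  | ite_cons _ _ iha ihb =>
    cases h' with
    | ite_cons ha hb =>
      obtain ⟨_, rfl⟩ := iha ha
      obtain ⟨rfl, rfl⟩ := ihb hb
      exact ⟨rfl, rfl⟩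
    | ite_nil ha hb => exact absurd (iha ha).1 (by simp)
  | ite_nil _ _ iha ihb =>
    cases h' with
    | ite_cons ha hb => exact absurd (iha ha).1 (by simp)
    | ite_nil ha hb =>
      obtain ⟨_, rfl⟩ := iha ha
      obtain ⟨rfl, rfl⟩ := ihb hb
      exact ⟨rfl, rfl⟩
  | bind _ _ iha ihb =>
    cases h' with
    | bind ha hb =>
      obtain ⟨rfl, rfl⟩ := iha ha
      obtain ⟨rfl, rfl⟩ := ihb hb
      exact ⟨rfl, rfl⟩
  | call hf _ _ iha ihb =>
    cases h' with
    | call hf' ha hb =>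
      obtain rfl := Option.some.inj (hf.symm.trans hf')
      obtain ⟨rfl, rfl⟩ := iha ha
      obtain ⟨rfl, rfl⟩ := ihb hb
      exact ⟨rfl, rfl⟩

/-- Started on the input `x`, the program `P` halts with output `y` after `t` steps. -/
def Program.Computes (P : Program) (x y : Data) (t : ℕ) : Prop :=
  Eval P [x] (Code.call 0 (Code.var 0)) y t

/-- The instance `(G, k)` as an input: the number `k` in binary, paired with the adjacency
matrix of `G`, whose entries are the multiplicities of the edges in binary. -/
def encodeInstance {n : ℕ} (G : Multigraph (Fin n)) (k : ℕ) : Data :=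
  Data.cons (Data.ofNat k)
    (Data.ofList (List.ofFn fun u : Fin n =>
      Data.ofList (List.ofFn fun v : Fin n => Data.ofNat (G.mult s(u, v)))))

end CountFVS

namespace CountFVS

set_option linter.unusedSectionVars false

/-! ### Cycles, induced forests and the effect of adding a vertex. -/

section Graph

variable {V : Type*}

/-! The algorithm is iterative compression with a branching that counts. Vertices are added one at a
time. If `w` is a smallest feedback vertex set, of size at most `k`, of the graph seen so far and
`v` is the next vertex, then deleting `v` and `w` leaves a forest, and this structure is used to
find one smallest solution for the larger graph together with the number of all of them. If the
graph seen so far needs more than `k` deletions, so does every larger one (`isRes_solve`).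

For one compression step, `v` and the members of `w` are marked, at most `k + 1` vertices, and the
forest is ordered by repeated removal of leaves, so that each forest vertex sends at most one edge
to later ones. The vertices are inserted in this order. By `acyclicOn_insert`, a kept vertex closes
no cycle exactly if it sends at most one edge into each component, so only the components seen by
later vertices have to be remembered. An unmarked vertex without an edge to the current state is
irrelevant (`feasible_isolated`). With one such edge it lies on a path whose interior vertices are
interchangeable: deleting any of them cuts the path. The path is stored as one entry with the class
`cl` of these vertices, and nothing is decided yet. With two or more edges, or if the vertex is
marked, the algorithm branches: delete the vertex, or keep it and treat its edges one by one
(`linkFeasible_nbrs`, `isRes_link`). For such an edge either the class behind it is cut, or two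
components merge; the latter is impossible if they coincide already.

Counting survives this because of minimality. Classes of entries with pending edges are disjoint,
and once the edge is settled the remaining problem no longer depends on the class. Hence a smallest
solution that cuts a class uses exactly one of its vertices, in `cl.length` ways (`IsRes.brk`), and
a smallest solution of the remaining problem avoids the class by itself (`IsRes.avoid`). The
branches are disjoint families, so `comb` adds their counts. This gives `isRes_proc` and
`countOf_solve`.

The number of leaves of the search tree is bounded by `7 ^ k * 2 ^ c * 3 ^ j` with budget `k`, `c`
components and `j` marked vertices. Treating an edge costs a factor `1/7 + 1/2 = 9/14` of the bound.
An unmarked vertex on which the algorithm branches has at least two edges, and `1/7 + 2 * (9/14) ^ 2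
< 1`; a marked one is paid for by `1/7 + 2 < 3`. A compression step starts with no components and at
most `k + 1` marked vertices, hence has at most `3 * 21 ^ k` leaves, which is within `3 * 26 ^ k`.
The depth and the work per node are polynomial (`fn_proc`, `fn_solve`).

The recursion is carried out by a concrete program. Its correctness and its cost are proved together
by symbolic evaluation (`wp_sound`), where each function call is replaced by a proved value and a
time bound. -/

/-- The edges run through by a walk given by the list of its vertices. -/
def pathEdges : List V → List (Sym2 V)
  | [] => []
  | [_] => []
  | a :: b :: l => s(a, b) :: pathEdges (b :: l)

/-- Cutting a cycle open at `p` turns the cyclic condition into one about an ordinary list, to which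
induction and the lemmas on `List.IsChain` apply. -/
theorem cyclicEdges_cons (p : V) (t : List V) :
    Multigraph.cyclicEdges (p :: t) = pathEdges (p :: (t ++ [p])) := by
  have key : ∀ (t : List V) (x : V),
      List.zipWith (fun u v => s(u, v)) (x :: t) (t ++ [p]) = pathEdges (x :: (t ++ [p])) := by
    intro t
    induction t with
    | nil => intro x; simp [pathEdges]
    | cons a t ih => intro x; simp only [List.cons_append, List.zipWith_cons_cons, pathEdges, ← ih]
  simp only [Multigraph.cyclicEdges, List.rotate_cons_succ, List.rotate_zero]
  exact key t p

theorem mem_of_mem_pathEdges {x y : V} : ∀ {l : List V}, s(x, y) ∈ pathEdges l → x ∈ l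
  | [], h => by simp [pathEdges] at h
  | [_], h => by simp [pathEdges] at h
  | a :: b :: l, h => by
    simp only [pathEdges, List.mem_cons] at h
    rcases h with h | h
    · rw [Sym2.eq_iff] at h
      rcases h with ⟨rfl, rfl⟩ | ⟨rfl, rfl⟩ <;> simp
    · exact List.mem_cons_of_mem _ (mem_of_mem_pathEdges h)

/-- A repetition of the first edge would revisit the first vertex. -/
theorem nodup_pathEdges : ∀ {l : List V}, l.Nodup → (pathEdges l).Nodup
  | [], _ => by simp [pathEdges]
  | [_], _ => by simp [pathEdges]
  | a :: b :: l, h => by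
    simp only [pathEdges, List.nodup_cons]
    rw [List.nodup_cons] at h
    exact ⟨fun h' => h.1 (mem_of_mem_pathEdges h'), nodup_pathEdges h.2⟩

theorem isChain_iff_pathEdges (P : Sym2 V → Prop) : ∀ {l : List V},
    l.IsChain (fun u v => P s(u, v)) ↔ ∀ e ∈ pathEdges l, P e
  | [] => by simp [pathEdges]
  | [_] => by simp [pathEdges]
  | a :: b :: l => by
    simp only [pathEdges, List.isChain_cons_cons, List.mem_cons, forall_eq_or_imp,
      isChain_iff_pathEdges P (l := b :: l)]

variable [DecidableEq V]

namespace Multigraph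

variable (G : Multigraph V)

theorem IsCycle.rotate {G : Multigraph V} {c : List V} (h : G.IsCycle c) (j : ℕ) :
    G.IsCycle (c.rotate j) := by
  refine ⟨List.nodup_rotate.2 h.1, by simpa using h.2.1, fun e => ?_⟩
  have : cyclicEdges (c.rotate j) = (cyclicEdges c).rotate j := by
    rw [cyclicEdges, cyclicEdges, List.zipWith_rotate_distrib _ _ _ _ (by simp),
      List.rotate_rotate, List.rotate_rotate, add_comm]
  rw [this, (List.rotate_perm _ j).count_eq]
  exact h.2.2 e

theorem IsCycle.isChain {G : Multigraph V} {p : V} {t : List V} (h : G.IsCycle (p :: t)) :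
    List.IsChain (fun u v => 0 < G.mult s(u, v)) (p :: (t ++ [p])) := by
  rw [isChain_iff_pathEdges (fun e => 0 < G.mult e)]
  intro e he
  rw [← cyclicEdges_cons] at he
  exact lt_of_lt_of_le (List.count_pos_iff.2 he) (h.2.2 e)

theorem isCycle_pair_iff {p y : V} : G.IsCycle [p, y] ↔ 2 ≤ G.mult s(p, y) := by
  constructor
  · intro h
    have := h.2.2 s(p, y)
    rw [cyclicEdges_cons] at this
    simpa [pathEdges, Sym2.eq_swap] using this
  · intro h
    refine ⟨?_, by simp, fun e => ?_⟩
    · have : p ≠ y := by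
        rintro rfl
        rw [G.loopless] at h
        omega
      simpa using this
    · rw [cyclicEdges_cons]
      by_cases he : s(p, y) = e
      · subst he
        simpa [pathEdges, Sym2.eq_swap] using h
      · have he' : s(y, p) ≠ e := by rwa [Sym2.eq_swap]
        simp [pathEdges, he, he']

/-- On at least three distinct vertices a closed walk uses no edge twice, so the condition on
multiplicities reduces to adjacency. Parallel edges matter only for cycles on two vertices. -/
theorem isCycle_cons_cons {p a b : V} {t : List V} (hn : (p :: a :: b :: t).Nodup)
    (h : List.IsChain (fun u v => 0 < G.mult s(u, v)) (p :: a :: b :: (t ++ [p]))) :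
    G.IsCycle (p :: a :: b :: t) := by
  refine ⟨hn, by simp, fun e => ?_⟩
  rw [cyclicEdges_cons]
  rw [isChain_iff_pathEdges (fun e => 0 < G.mult e)] at h
  have hnd : (pathEdges (p :: (a :: b :: t ++ [p]))).Nodup := by
    have hn' : (a :: b :: (t ++ [p])).Nodup := by
      have : (p :: a :: b :: t).Perm (a :: b :: (t ++ [p])) :=
        (List.perm_append_singleton p (a :: b :: t)).symm
      exact this.nodup_iff.1 hn
    have h1 := nodup_pathEdges hn'
    simp only [List.cons_append, pathEdges, List.nodup_cons] at h1 ⊢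
    refine ⟨?_, h1⟩
    -- The first edge `p a` differs from `a b` because `p ≠ b`, and it is none of the later edges
    -- because these do not contain `a`.
    rw [List.mem_cons, not_or]
    constructor
    · intro h2
      rw [Sym2.eq_iff] at h2
      simp only [List.nodup_cons, List.mem_cons] at hn
      tauto
    · intro h2
      rw [Sym2.eq_swap] at h2
      exact (List.nodup_cons.1 hn').1 (mem_of_mem_pathEdges h2)
  by_cases he : e ∈ pathEdges (p :: (a :: b :: t ++ [p]))
  · rw [List.count_eq_one_of_mem hnd he]
    exact h e he
  · rw [List.count_eq_zero_of_not_mem he]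
    omega

/-- The subgraph induced by `A` is a forest. -/
def AcyclicOn (A : Finset V) : Prop :=
  ∀ c : List V, G.IsCycle c → ¬ ∀ x ∈ c, x ∈ A

variable {G}

theorem AcyclicOn.mono {A B : Finset V} (h : G.AcyclicOn B) (hAB : A ⊆ B) : G.AcyclicOn A :=
  fun c hc hA => h c hc fun x hx => hAB (hA x hx)

/-- `Subtype.val` is injective on vertices, hence on unordered pairs, so cycles and edge counts
carry over. From here on induced subgraphs are sets of vertices of a fixed type. -/
theorem isFVS_iff [Fintype V] {S : Finset V} : G.IsFVS S ↔ G.AcyclicOn (Finset.univ \ S) := by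
  have key : ∀ c : List {v : V // v ∉ S},
      (G.deleteVerts S).IsCycle c ↔ G.IsCycle (c.map Subtype.val) := by
    intro c
    have hce : cyclicEdges (c.map Subtype.val) = (cyclicEdges c).map (Sym2.map Subtype.val) := by
      simp only [cyclicEdges, ← List.map_rotate, List.zipWith_map, List.map_zipWith, Sym2.map_mk]
    have hinj : Function.Injective (Sym2.map (Subtype.val : {v : V // v ∉ S} → V)) :=
      Sym2.map.injective Subtype.val_injective
    unfold IsCycle
    rw [List.nodup_map_iff Subtype.val_injective, List.length_map, hce]
    refine and_congr_right fun _ => and_congr_right fun _ => ⟨fun h e => ?_, fun h e => ?_⟩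
    · by_cases he : e ∈ (cyclicEdges c).map (Sym2.map Subtype.val)
      · obtain ⟨e', _, rfl⟩ := List.mem_map.1 he
        rw [List.count_map_of_injective _ _ hinj]
        exact h e'
      · rw [List.count_eq_zero_of_not_mem he]
        omega
    · have := h (e.map Subtype.val)
      rwa [List.count_map_of_injective _ _ hinj] at this
  constructor
  · intro h c hc hA
    have hA' : ∀ x ∈ c, x ∉ S := fun x hx => (Finset.mem_sdiff.1 (hA x hx)).2
    apply h (c.attach.map fun x => ⟨x.1, hA' x.1 x.2⟩)
    rw [key]
    simpa using hc
  · intro h c hc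
    refine h _ ((key c).1 hc) ?_
    intro x hx
    obtain ⟨y, _, rfl⟩ := List.mem_map.1 hx
    simpa using y.2

variable (G)

/-- Adjacency in the subgraph induced by `A`, as a simple graph. -/
def simpleOn (A : Finset V) : SimpleGraph V where
  Adj u v := u ∈ A ∧ v ∈ A ∧ 0 < G.mult s(u, v)
  symm := ⟨fun u v h => ⟨h.2.1, h.1, by rw [Sym2.eq_swap]; exact h.2.2⟩⟩
  loopless := ⟨fun u h => by have := h.2.2; rw [G.loopless] at this; omega⟩

/-- `x` and `y` lie in the same component of the subgraph induced by `A`. -/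
def Conn (A : Finset V) (x y : V) : Prop :=
  x ∈ A ∧ y ∈ A ∧ (G.simpleOn A).Reachable x y

variable {G}

theorem conn_of_isChain {A : Finset V} : ∀ {x : V} {l : List V} {y : V},
    (x :: l).IsChain (fun u v => 0 < G.mult s(u, v)) → (∀ z ∈ x :: l, z ∈ A) →
      (x :: l).getLast? = some y → G.Conn A x y := by
  intro x l
  induction l generalizing x with
  | nil =>
    intro y _ h hl
    simp at hl
    subst hl
    exact ⟨h x (by simp), h x (by simp), .refl _⟩
  | cons a l ih =>
    intro y hc h hl
    rw [List.isChain_cons_cons] at hc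
    obtain ⟨h1, h2, h3⟩ := ih hc.2 (fun z hz => h z (List.mem_cons_of_mem _ hz)) (by simpa using hl)
    refine ⟨h x (by simp), h2, SimpleGraph.Reachable.trans (SimpleGraph.Adj.reachable ?_) h3⟩
    exact ⟨h x (by simp), h1, hc.1⟩

theorem Conn.exists_path {A : Finset V} {x y : V} (h : G.Conn A x y) :
    ∃ l : List V, (x :: l).Nodup ∧ (x :: l).IsChain (fun u v => 0 < G.mult s(u, v)) ∧
      (∀ z ∈ x :: l, z ∈ A) ∧ (x :: l).getLast? = some y := by
  obtain ⟨p, hp⟩ := h.2.2.exists_isPath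
  have hc := p.isChain_adj_support
  have hs : p.support = x :: p.support.tail := by simp
  refine ⟨p.support.tail, ?_, ?_, ?_, ?_⟩
  · rw [← hs]; exact hp.support_nodup
  · rw [← hs]; exact hc.imp fun _ _ h => h.2.2
  · rw [← hs]
    have : ∀ {x y : V} (p : (G.simpleOn A).Walk x y), x ∈ A → ∀ z ∈ p.support, z ∈ A := by
      intro x y p
      induction p with
      | nil => intro hx; simpa using hx
      | cons h p ih =>
        intro hx z hz
        rw [SimpleGraph.Walk.support_cons, List.mem_cons] at hz
        rcases hz with rfl | hz
        · exact hx
        · exact ih h.2.1 z hz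
    exact this p h.1
  · rw [← hs, List.getLast?_eq_getLast_of_ne_nil (by simp), SimpleGraph.Walk.getLast_support]

theorem Conn.symm {A : Finset V} {x y : V} (h : G.Conn A x y) : G.Conn A y x :=
  ⟨h.2.1, h.1, h.2.2.symm⟩

theorem Conn.trans {A : Finset V} {x y z : V} (h : G.Conn A x y) (h' : G.Conn A y z) :
    G.Conn A x z :=
  ⟨h.1, h'.2.1, h.2.2.trans h'.2.2⟩

theorem Conn.mono {A B : Finset V} (hAB : A ⊆ B) {x y : V} (h : G.Conn A x y) : G.Conn B x y := by
  refine ⟨hAB h.1, hAB h.2.1, h.2.2.mono ?_⟩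
  intro u v huv
  exact ⟨hAB huv.1, hAB huv.2.1, huv.2.2⟩

variable (G)

/-- The new vertex `p` sends at most one edge to every class of `r`. -/
def Linkable (p : V) (r : V → V → Prop) : Prop :=
  ∀ y z, r y z → 0 < G.mult s(p, y) → 0 < G.mult s(p, z) → y = z ∧ G.mult s(p, y) = 1

/-- `x` is the new vertex `p` or lies in a class of `r` that `p` is adjacent to. -/
def Touch (p : V) (r : V → V → Prop) (x : V) : Prop :=
  x = p ∨ ∃ z, r x z ∧ 0 < G.mult s(p, z)

/-- The partial equivalence relation `r`, after adding `p` and all its edges. -/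
def Extend (p : V) (r : V → V → Prop) (x y : V) : Prop :=
  r x y ∨ G.Touch p r x ∧ G.Touch p r y

variable {G}

/-- By induction along a walk: either the walk avoids `p` and stays in one old component, or both
its ends are joined to `p`. -/
theorem conn_insert {A : Finset V} {p x y : V} (hpA : p ∉ A) :
    G.Conn (insert p A) x y ↔ G.Extend p (G.Conn A) x y := by
  have hsub : A ⊆ insert p A := Finset.subset_insert p A
  have hp : ∀ x, G.Touch p (G.Conn A) x → G.Conn (insert p A) x p := by
    rintro x (rfl | ⟨z, hz, hpz⟩)
    · exact ⟨by simp, by simp, .refl _⟩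
    · refine (hz.mono hsub).trans ⟨hsub hz.2.1, by simp, SimpleGraph.Adj.reachable ?_⟩
      exact ⟨hsub hz.2.1, by simp, by rwa [Sym2.eq_swap]⟩
  constructor
  · rintro ⟨hx, hy, ⟨w⟩⟩
    induction w with
    | @nil u =>
      rcases Finset.mem_insert.1 hx with rfl | hx
      · exact Or.inr ⟨Or.inl rfl, Or.inl rfl⟩
      · exact Or.inl ⟨hx, hx, .refl _⟩
    | @cons u v y h w ih =>
      have ih := ih h.2.1 hy
      obtain ⟨hu, hv, huv⟩ := h
      by_cases hup : u = p
      · subst hup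
        right
        refine ⟨Or.inl rfl, ?_⟩
        rcases ih with ih | ih
        · exact Or.inr ⟨v, ih.symm, huv⟩
        · exact ih.2
      · have huA : u ∈ A := (Finset.mem_insert.1 hu).resolve_left hup
        by_cases hvp : v = p
        · subst hvp
          have hu' : G.Touch v (G.Conn A) u :=
            Or.inr ⟨u, ⟨huA, huA, .refl _⟩, by rwa [Sym2.eq_swap]⟩
          rcases ih with ih | ih
          · exact absurd ih.1 hpA
          · exact Or.inr ⟨hu', ih.2⟩
        · have hvA : v ∈ A := (Finset.mem_insert.1 hv).resolve_left hvp
          have huv' : G.Conn A u v := ⟨huA, hvA, SimpleGraph.Adj.reachable ⟨huA, hvA, huv⟩⟩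
          rcases ih with ih | ⟨ih | ⟨z, hz, hz'⟩, ih'⟩
          · exact Or.inl (huv'.trans ih)
          · exact absurd ih hvp
          · exact Or.inr ⟨Or.inr ⟨z, huv'.trans hz, hz'⟩, ih'⟩
  · rintro (h | ⟨h1, h2⟩)
    · exact h.mono hsub
    · exact (hp x h1).trans (hp y h2).symm

/-- A cycle through `p` is `p` together with a path in `A` between two of its neighbours, or a pair
of parallel edges at `p`. So a new cycle arises exactly if `p` sends two edges into the same
component. -/
theorem acyclicOn_insert {A : Finset V} {p : V} (hpA : p ∉ A) :
    G.AcyclicOn (insert p A) ↔ G.AcyclicOn A ∧ G.Linkable p (G.Conn A) := by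
  constructor
  · intro h
    refine ⟨h.mono (Finset.subset_insert p A), fun y z hyz hy hz => ?_⟩
    have hyA : y ∈ A := hyz.1
    by_cases e : y = z
    · subst e
      refine ⟨rfl, ?_⟩
      by_contra hne
      refine h [p, y] (G.isCycle_pair_iff.2 (by omega)) ?_
      simp [hyA]
    · exfalso
      obtain ⟨l, h1, h2, h3, h4⟩ := hyz.exists_path
      cases l with
      | nil => simp at h4; exact e h4
      | cons a l =>
        refine h (p :: y :: a :: l) (G.isCycle_cons_cons ?_ ?_) ?_
        · rw [List.nodup_cons]
          exact ⟨fun hp => hpA (h3 p hp), h1⟩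
        · rw [List.isChain_cons_cons]
          refine ⟨hy, ?_⟩
          have : y :: a :: (l ++ [p]) = (y :: a :: l) ++ [p] := by simp
          rw [this, List.isChain_append]
          refine ⟨h2, by simp, ?_⟩
          intro u hu v hv
          rw [h4] at hu
          simp at hu hv
          subst hu hv
          rwa [Sym2.eq_swap]
        · intro x hx
          rcases List.mem_cons.1 hx with rfl | hx
          · simp
          · exact Finset.mem_insert_of_mem (h3 x hx)
  · rintro ⟨hA, hl⟩ c hc hcA
    by_cases hpc : p ∈ c
    · obtain ⟨s, t, rfl⟩ := List.append_of_mem hpc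
      have hc' := hc.rotate s.length
      rw [List.rotate_append_length_eq] at hc'
      have hmem : ∀ x ∈ t ++ s, x ∈ A := by
        intro x hx
        have hxp : x ≠ p := by
          rintro rfl
          have := hc'.1
          rw [List.cons_append, List.nodup_cons] at this
          exact this.1 hx
        refine (Finset.mem_insert.1 (hcA x ?_)).resolve_left hxp
        simp only [List.mem_append, List.mem_cons] at hx ⊢
        tauto
      rw [List.cons_append] at hc'
      generalize t ++ s = l at hc' hmem
      have hch := hc'.isChain
      cases l with
      | nil => have := hc'.2.1; simp at this
      | cons y l =>
        rw [List.cons_append, List.isChain_cons_cons] at hch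
        have hne : (y :: l) ≠ [] := by simp
        have hlast := List.getLast?_eq_getLast_of_ne_nil hne
        have h2 := hch.2
        rw [← List.cons_append, List.isChain_append] at h2
        have hconn := conn_of_isChain h2.1 hmem hlast
        have hz := h2.2.2 _ hlast p (by simp)
        rw [Sym2.eq_swap] at hz
        -- The path that remains after removing `p` starts and ends at neighbours of `p` in one
        -- component, so its ends coincide. A single vertex would need a double edge to `p`; a
        -- longer path would repeat a vertex.
        obtain ⟨he, h1⟩ := hl _ _ hconn hch.1 hz
        cases l with
        | nil =>
          have := G.isCycle_pair_iff.1 hc'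
          omega
        | cons a l =>
          have hn := (List.nodup_cons.1 hc'.1).2
          rw [List.getLast_cons (by simp)] at he
          exact (List.nodup_cons.1 hn).1 (he ▸ List.getLast_mem _)
    · refine hA c hc fun x hx => (Finset.mem_insert.1 (hcA x hx)).resolve_left ?_
      rintro rfl
      exact hpc hx

theorem acyclicOn_empty : G.AcyclicOn ∅ := by
  intro c hc h
  cases c with
  | nil => have := hc.2.1; simp at this
  | cons a c => simpa using h a (by simp)

/-- A nonempty forest has a vertex that is incident with at most one edge. -/
theorem AcyclicOn.exists_leaf {A : Finset V} (h : G.AcyclicOn A) (hA : A.Nonempty) :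
    ∃ x ∈ A, ∀ y ∈ A, ∀ z ∈ A, 0 < G.mult s(x, y) → 0 < G.mult s(x, z) →
      y = z ∧ G.mult s(x, y) = 1 := by
  by_contra hcon
  push Not at hcon
  -- If every vertex of `A` had two edges inside `A`, a path could always be prolonged at its head,
  -- since returning to the path would close a cycle. A path with more than `A.card` vertices is the
  -- contradiction.
  have key : ∀ n : ℕ, ∃ x l, (x :: l).Nodup ∧ (x :: l).length = n + 1 ∧
      (x :: l).IsChain (fun u v => 0 < G.mult s(u, v)) ∧ ∀ z ∈ x :: l, z ∈ A := by
    intro n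
    induction n with
    | zero =>
      obtain ⟨x, hx⟩ := hA
      exact ⟨x, [], by simp, by simp, by simp, by simpa using hx⟩
    | succ n ih =>
      obtain ⟨x, l, h1, h2, h3, h4⟩ := ih
      -- a neighbour of `x` that does not follow `x` on the path by a simple edge
      obtain ⟨y, hyA, hy, hyl⟩ : ∃ y ∈ A, 0 < G.mult s(x, y) ∧
          ∀ a, l.head? = some a → a = y → 2 ≤ G.mult s(x, y) := by
        obtain ⟨y, hy, z, hz, h5, h6, h7⟩ := hcon x (h4 x (by simp))
        by_cases hyz : y = z
        · exact ⟨y, hy, h5, fun _ _ _ => by have := h7 hyz; omega⟩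
        · cases l with
          | nil => exact ⟨y, hy, h5, by simp⟩
          | cons a l =>
            by_cases hay : a = y
            · refine ⟨z, hz, h6, fun b hb hbz => ?_⟩
              simp at hb
              exact absurd (hay.symm.trans (hb.trans hbz)) hyz
            · refine ⟨y, hy, h5, fun b hb hby => ?_⟩
              simp at hb
              exact absurd (hb.trans hby) hay
      have hyx : y ≠ x := by
        rintro rfl
        rw [G.loopless] at hy
        omega
      by_cases hmem : y ∈ x :: l
      · exfalso
        have hmem' : y ∈ l := by simpa [hyx] using hmem
        obtain ⟨s, t, rfl⟩ := List.append_of_mem hmem'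
        cases s with
        | nil =>
          refine h [x, y] (G.isCycle_pair_iff.2 (hyl y (by simp) rfl)) fun z hz => h4 z ?_
          simp only [List.mem_cons, List.not_mem_nil, or_false] at hz
          rcases hz with rfl | rfl <;> simp
        | cons a s =>
          have e : x :: (a :: s ++ y :: t) = (x :: a :: (s ++ [y])) ++ t := by simp
          rw [e] at h1 h3 h4
          refine h (x :: a :: (s ++ [y])) ?_ fun z hz => h4 z (List.mem_append_left _ hz)
          have hn := (List.nodup_append.1 h1).1
          have hch := (List.isChain_append.1 h3).1
          have hch' : List.IsChain (fun u v => 0 < G.mult s(u, v))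
              ((x :: a :: (s ++ [y])) ++ [x]) := by
            rw [List.isChain_append]
            refine ⟨hch, by simp, ?_⟩
            intro u hu v hv
            have e2 : x :: a :: (s ++ [y]) = (x :: a :: s) ++ [y] := by simp
            rw [e2, List.getLast?_concat] at hu
            simp at hu hv
            subst hu hv
            rwa [Sym2.eq_swap]
          cases s with
          | nil => exact G.isCycle_cons_cons hn hch'
          | cons b s => exact G.isCycle_cons_cons hn (by simpa using hch')
      · refine ⟨y, x :: l, List.nodup_cons.2 ⟨hmem, h1⟩, by simpa using h2, ?_, ?_⟩
        · rw [List.isChain_cons_cons]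
          exact ⟨by rwa [Sym2.eq_swap], h3⟩
        · intro z hz
          rcases List.mem_cons.1 hz with rfl | hz
          · exact hyA
          · exact h4 z hz
  obtain ⟨x, l, h1, h2, -, h4⟩ := key A.card
  have : (x :: l).toFinset.card ≤ A.card :=
    Finset.card_le_card fun z hz => h4 z (List.mem_toFinset.1 hz)
  rw [List.toFinset_card_of_nodup h1, h2] at this
  omega

end Multigraph
end Graph
end CountFVS

namespace CountFVS

set_option linter.unusedSectionVars false

/-! ### Building a forest by successive vertices, and by successive edges. -/

section Feasibility

variable {V : Type*} [DecidableEq V]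

namespace Multigraph

variable (G : Multigraph V)

/-- The number of edges from `x` to the vertices of the list `l`. -/
def degTo (x : V) (l : List V) : ℕ :=
  (l.map fun y => G.mult s(x, y)).sum

/-- `x` has a neighbour in the list `l`. -/
def AdjTo (l : List V) (x : V) : Prop :=
  ∃ q ∈ l, 0 < G.mult s(q, x)

/-- The vertices of the list that are outside `S` can be added one by one to a forest whose
components are the classes of `r` without closing a cycle. -/
def Feasible (S : Finset V) : List V → (V → V → Prop) → Prop
  | [], _ => True
  | p :: l, r => (p ∈ S → Feasible S l r) ∧
      (p ∉ S → G.Linkable p r ∧ Feasible S l (G.Extend p r))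

variable {G}

theorem adjTo_cons {p : V} {l : List V} {x : V} (h : G.AdjTo l x) : G.AdjTo (p :: l) x :=
  let ⟨q, hq, h⟩ := h; ⟨q, List.mem_cons_of_mem _ hq, h⟩

theorem degTo_cons {p x : V} {l : List V} :
    G.degTo x (p :: l) = G.mult s(x, p) + G.degTo x l := by
  simp [degTo]

theorem AdjTo.degTo_pos {l : List V} {x : V} (h : G.AdjTo l x) : 0 < G.degTo x l := by
  obtain ⟨q, hq, h⟩ := h
  rw [Sym2.eq_swap] at h
  exact lt_of_lt_of_le h (List.single_le_sum (by simp) _ (List.mem_map.2 ⟨q, hq, rfl⟩))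

/-- Iterates `acyclicOn_insert`; by `conn_insert`, `Extend` computes the components after each
insertion. If an insertion closes a cycle, both sides fail, the right one because acyclicity passes
to subsets. -/
theorem feasible_conn {S : Finset V} : ∀ {l : List V} {A : Finset V}, l.Nodup →
    (∀ x ∈ l, x ∉ A) → G.AcyclicOn A →
    (G.Feasible S l (G.Conn A) ↔ G.AcyclicOn (A ∪ (l.toFinset \ S)))
  | [], A, _, _, hA => by simp [Feasible, hA]
  | p :: l, A, hn, hd, hA => by
    rw [List.nodup_cons] at hn
    by_cases hp : p ∈ S
    · have h := feasible_conn (S := S) (l := l) (A := A) hn.2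
        (fun x hx => hd x (List.mem_cons_of_mem _ hx)) hA
      simp only [Feasible, hp, not_true_eq_false, false_imp_iff, and_true, forall_const, h]
      rw [List.toFinset_cons, Finset.insert_sdiff_of_mem _ hp]
    · have hpA : p ∉ A := hd p (by simp)
      simp only [Feasible, hp, false_imp_iff, true_and, not_false_eq_true, forall_const]
      have hext : G.Extend p (G.Conn A) = G.Conn (insert p A) := by
        funext x y; exact propext (conn_insert hpA).symm
      have hset : A ∪ ((p :: l).toFinset \ S) = insert p A ∪ (l.toFinset \ S) := by
        rw [List.toFinset_cons, Finset.insert_sdiff_of_notMem _ hp]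
        ext x; simp
      rw [hext, hset]
      by_cases hl : G.AcyclicOn (insert p A)
      · rw [feasible_conn (S := S) (l := l) (A := insert p A) hn.2 _ hl]
        · exact and_iff_right ((acyclicOn_insert hpA).1 hl).2
        · intro x hx hx'
          rcases Finset.mem_insert.1 hx' with rfl | h
          · exact hn.1 hx
          · exact hd x (List.mem_cons_of_mem _ hx) h
      · constructor
        · intro h
          exact absurd ((acyclicOn_insert hpA).2 ⟨hA, h.1⟩) hl
        · intro h
          exact absurd (h.mono Finset.subset_union_left) hl

/-- `Linkable` and `Touch` query the relation only at neighbours of the vertices still to come. This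
is why vertices without future edges may be forgotten. -/
theorem feasible_congr {S S' : Finset V} : ∀ {l : List V} {r r' : V → V → Prop},
    (∀ q ∈ l, q ∈ S ↔ q ∈ S') → (∀ x y, G.AdjTo l x → G.AdjTo l y → (r x y ↔ r' x y)) →
      (G.Feasible S l r ↔ G.Feasible S' l r')
  | [], _, _, _, _ => by simp [Feasible]
  | p :: l, r, r', hS, hr => by
    have hS' : ∀ q ∈ l, q ∈ S ↔ q ∈ S' := fun q hq => hS q (List.mem_cons_of_mem _ hq)
    have hp := hS p (by simp)
    have hadj : ∀ {z}, 0 < G.mult s(p, z) → G.AdjTo (p :: l) z := fun h => ⟨p, by simp, h⟩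
    have h1 : G.Linkable p r ↔ G.Linkable p r' := by
      refine forall_congr' fun y => forall_congr' fun z => ?_
      constructor <;> intro h h1 h2 h3
      · exact h ((hr y z (hadj h2) (hadj h3)).2 h1) h2 h3
      · exact h ((hr y z (hadj h2) (hadj h3)).1 h1) h2 h3
    have ht : ∀ x, G.AdjTo l x → (G.Touch p r x ↔ G.Touch p r' x) := by
      intro x hx
      refine or_congr_right (exists_congr fun z => ?_)
      exact and_congr_left fun hz => hr x z (adjTo_cons hx) (hadj hz)
    have h2 : G.Feasible S l r ↔ G.Feasible S' l r' :=
      feasible_congr hS' fun x y hx hy => hr x y (adjTo_cons hx) (adjTo_cons hy)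
    have h3 : G.Feasible S l (G.Extend p r) ↔ G.Feasible S' l (G.Extend p r') :=
      feasible_congr hS' fun x y hx hy => by
        unfold Extend
        rw [hr x y (adjTo_cons hx) (adjTo_cons hy), ht x hx, ht y hy]
    simp only [Feasible, hp, h1, h2, h3]

/-- An isolated vertex that has at most one edge to the remaining vertices is irrelevant. -/
theorem feasible_isolated {S : Finset V} {x : V} : ∀ {l : List V} {r : V → V → Prop},
    x ∉ l → G.degTo x l ≤ 1 → (∀ v, ¬ r x v) → (∀ v, ¬ r v x) →
      (G.Feasible S l (fun u v => r u v ∨ (u = x ∧ v = x)) ↔ G.Feasible S l r)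
  | [], _, _, _, _, _ => by simp [Feasible]
  | p :: l, r, hx, hd, h1, h2 => by
    rw [degTo_cons] at hd
    have hxp : x ≠ p := fun h => hx (by simp [h])
    have hxl : x ∉ l := fun h => hx (List.mem_cons_of_mem _ h)
    have ih := feasible_isolated (S := S) (r := r) hxl (by omega) h1 h2
    have hL : G.Linkable p (fun u v => r u v ∨ (u = x ∧ v = x)) ↔ G.Linkable p r := by
      constructor
      · exact fun h y z hyz => h y z (Or.inl hyz)
      · rintro h y z (hyz | ⟨rfl, rfl⟩) hy hz
        · exact h y z hyz hy hz
        · refine ⟨rfl, ?_⟩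
          rw [Sym2.eq_swap] at hy ⊢
          omega
    simp only [Feasible, hL, ih]
    refine and_congr_right fun _ => imp_congr_right fun _ => and_congr_right fun _ => ?_
    -- If `x` and `p` are not adjacent, `x` is still isolated after the insertion of `p`. Otherwise
    -- its only edge is used up by `p`, and afterwards no later vertex sees `x`.
    by_cases h0 : G.mult s(x, p) = 0
    · have ht : ∀ u, G.Touch p (fun u v => r u v ∨ (u = x ∧ v = x)) u ↔ G.Touch p r u := by
        intro u
        refine or_congr_right (exists_congr fun z => and_congr_left fun hz => ?_)
        refine or_iff_left ?_
        rintro ⟨-, rfl⟩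
        rw [Sym2.eq_swap] at hz
        omega
      have hnt : ¬ G.Touch p r x := by
        rintro (h | ⟨z, h, -⟩)
        · exact hxp h
        · exact h1 z h
      rw [← feasible_isolated (S := S) (r := G.Extend p r) hxl (by omega)]
      · refine feasible_congr (fun _ _ => Iff.rfl) fun u v _ _ => ?_
        unfold Extend
        rw [ht, ht]
        tauto
      · rintro v (h | h)
        · exact h1 v h
        · exact hnt h.1
      · rintro v (h | h)
        · exact h2 v h
        · exact hnt h.2
    · refine feasible_congr (fun _ _ => Iff.rfl) fun u v hu hv => ?_
      have hne : ∀ {u}, G.AdjTo l u → u ≠ x := by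
        rintro u hu rfl
        have := hu.degTo_pos
        omega
      have ht : ∀ u, u ≠ x →
          (G.Touch p (fun u v => r u v ∨ (u = x ∧ v = x)) u ↔ G.Touch p r u) := by
        intro u hu
        refine or_congr_right (exists_congr fun z => and_congr_left fun hz => ?_)
        exact or_iff_left fun h => hu h.1
      unfold Extend
      rw [ht u (hne hu), ht v (hne hv)]
      exact or_congr_left (or_iff_left fun h => hne hu h.1)

end Multigraph

/-- The partial equivalence relation `r`, with the classes of `y` and `p` united. -/
def MergeRel (r : V → V → Prop) (y p : V) (u v : V) : Prop :=
  r u v ∨ (r u y ∨ r u p) ∧ (r v y ∨ r v p)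

/-- The partial equivalence relation `r`, with the classes of the members of `L` and of `p`
united. -/
def MergeList (r : V → V → Prop) (L : List V) (p : V) (u v : V) : Prop :=
  r u v ∨ (r u p ∨ ∃ y ∈ L, r u y) ∧ (r v p ∨ ∃ y ∈ L, r v y)

/-- Symmetric and transitive relations. -/
structure IsPER (r : V → V → Prop) : Prop where
  symm : ∀ {x y}, r x y → r y x
  trans : ∀ {x y z}, r x y → r y z → r x z

theorem IsPER.merge {r : V → V → Prop} (h : IsPER r) (y p : V) :
    IsPER (MergeRel r y p) where
  symm := by
    rintro u v (h1 | h1)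
    · exact Or.inl (h.symm h1)
    · exact Or.inr h1.symm
  trans := by
    rintro u v w (h1 | h1) (h2 | h2)
    · exact Or.inl (h.trans h1 h2)
    · exact Or.inr ⟨h2.1.imp (h.trans h1) (h.trans h1), h2.2⟩
    · exact Or.inr ⟨h1.1, h1.2.imp (h.trans (h.symm h2)) (h.trans (h.symm h2))⟩
    · exact Or.inr ⟨h1.1, h2.2⟩

namespace Multigraph

variable (G : Multigraph V)

/-- The edges from `p` to the vertices of the list can be added one by one without closing a
cycle, and then the vertices of `l` as in `Feasible`. -/
def LinkFeasible (S : Finset V) (p : V) (l : List V) : List V → (V → V → Prop) → Prop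
  | [], r => G.Feasible S l r
  | y :: L, r => ¬ r y p ∧ LinkFeasible S p l L (MergeRel r y p)

variable {G}

theorem linkFeasible_congr {S S' : Finset V} {p : V} {l : List V} (hS : ∀ q ∈ l, q ∈ S ↔ q ∈ S') :
    ∀ {L : List V} {r r' : V → V → Prop},
      (∀ x y, (x = p ∨ x ∈ L ∨ G.AdjTo l x) → (y = p ∨ y ∈ L ∨ G.AdjTo l y) →
        (r x y ↔ r' x y)) →
      (G.LinkFeasible S p l L r ↔ G.LinkFeasible S' p l L r')
  | [], r, r', hr => feasible_congr hS fun x y hx hy => hr x y (by simp [hx]) (by simp [hy])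
  | a :: L, r, r', hr => by
    have hr' : ∀ x y, (x = p ∨ x ∈ L ∨ G.AdjTo l x) → (y = p ∨ y ∈ L ∨ G.AdjTo l y) →
        (MergeRel r a p x y ↔ MergeRel r' a p x y) := by
      intro x y hx hy
      have hx' : x = p ∨ x ∈ a :: L ∨ G.AdjTo l x := by rw [List.mem_cons]; tauto
      have hy' : y = p ∨ y ∈ a :: L ∨ G.AdjTo l y := by rw [List.mem_cons]; tauto
      unfold MergeRel
      rw [hr x y hx' hy', hr x a hx' (by simp), hr y a hy' (by simp), hr x p hx' (by simp),
        hr y p hy' (by simp)]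
    simp only [LinkFeasible, hr a p (by simp) (by simp), linkFeasible_congr hS hr']

/-- Adding the edges in sequence closes a cycle as soon as an endpoint lies in the class of `p` or
in the class of an earlier endpoint. If this never happens, all these classes have been united,
whatever the order. -/
theorem linkFeasible_iff {S : Finset V} {p : V} {l : List V} :
    ∀ {L : List V} {r : V → V → Prop}, IsPER r → r p p →
      (G.LinkFeasible S p l L r ↔ (∀ y ∈ L, ¬ r y p) ∧ L.Pairwise (fun y z => ¬ r y z) ∧
        G.Feasible S l (MergeList r L p))
  | [], r, hr, hp => by
    simp only [LinkFeasible, List.not_mem_nil, false_imp_iff, implies_true, List.Pairwise.nil,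
      true_and]
    refine feasible_congr (fun _ _ => Iff.rfl) fun u v _ _ => ?_
    simp only [MergeList, List.not_mem_nil, false_and, exists_false, or_false]
    exact ⟨Or.inl, fun h => h.elim id fun h => hr.trans h.1 (hr.symm h.2)⟩
  | a :: L, r, hr, hp => by
    have hM := hr.merge a p
    have hMp : MergeRel r a p p p := Or.inl hp
    have hup : ∀ u, MergeRel r a p u p ↔ r u a ∨ r u p := by
      intro u
      unfold MergeRel
      tauto
    have hfin : MergeList (MergeRel r a p) L p = MergeList r (a :: L) p := by
      have ht : ∀ u, (MergeRel r a p u p ∨ ∃ y ∈ L, MergeRel r a p u y) ↔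
          (r u p ∨ ∃ y ∈ a :: L, r u y) := by
        intro u
        rw [hup]
        simp only [List.mem_cons, exists_eq_or_imp]
        constructor
        · rintro (h | ⟨y, hy, h | h⟩)
          · tauto
          · exact Or.inr (Or.inr ⟨y, hy, h⟩)
          · have := h.1; tauto
        · rintro (h | h | ⟨y, hy, h⟩)
          · tauto
          · tauto
          · exact Or.inr ⟨y, hy, Or.inl h⟩
      funext u v
      unfold MergeList
      rw [ht, ht]
      apply propext
      simp only [List.mem_cons, exists_eq_or_imp]
      unfold MergeRel
      tauto
    simp only [LinkFeasible]
    rw [linkFeasible_iff hM hMp, hfin, List.pairwise_cons]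
    constructor
    · rintro ⟨h1, h2, h3, h4⟩
      have h2' : ∀ y ∈ L, ¬ r y a ∧ ¬ r y p := fun y hy => by
        have := h2 y hy
        rw [hup] at this
        tauto
      refine ⟨?_, ⟨fun y hy h => (h2' y hy).1 (hr.symm h), h3.imp fun h h' => h (Or.inl h')⟩, h4⟩
      intro y hy
      rcases List.mem_cons.1 hy with rfl | hy
      · exact h1
      · exact (h2' y hy).2
    · rintro ⟨h1, ⟨h2, h3⟩, h4⟩
      have h2' : ∀ y ∈ L, ¬ (r y a ∨ r y p) := fun y hy h =>
        h.elim (fun h => h2 y hy (hr.symm h)) (h1 y (List.mem_cons_of_mem _ hy))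
      refine ⟨h1 a (by simp), fun y hy => by rw [hup]; exact h2' y hy, ?_, h4⟩
      refine h3.imp_of_mem fun {y z} hy _ h => ?_
      rintro (h' | h')
      · exact h h'
      · exact h2' y hy h'.1

/-- The members of `l` that are adjacent to `p`, twice if there are parallel edges. -/
def nbrs {α : Type*} (G : Multigraph V) (p : V) (l : List (V × α)) : List (V × α) :=
  l.flatMap fun e => List.replicate (min 2 (G.mult s(p, e.1))) e

theorem mem_nbrs {α : Type*} {p : V} {l : List (V × α)} {e : V × α} :
    e ∈ G.nbrs p l ↔ e ∈ l ∧ 0 < G.mult s(p, e.1) := by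
  simp only [nbrs, List.mem_flatMap, List.mem_replicate]
  constructor
  · rintro ⟨a, h1, h2, rfl⟩
    exact ⟨h1, by omega⟩
  · rintro ⟨h1, h2⟩
    exact ⟨e, h1, by omega, rfl⟩

/-- Adding a vertex amounts to adding its edges one by one. -/
theorem linkFeasible_nbrs {α : Type*} {S : Finset V} {p : V} {l : List V} {st : List (V × α)}
    {r : V → V → Prop} (hr : IsPER r) (hst : (st.map Prod.fst).Nodup)
    (hkey : ∀ x y, r x y → x ∈ st.map Prod.fst) (hp : p ∉ st.map Prod.fst) :
    G.LinkFeasible S p l ((G.nbrs p st).map Prod.fst) (fun u v => r u v ∨ (u = p ∧ v = p)) ↔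
      G.Linkable p r ∧ G.Feasible S l (G.Extend p r) := by
  have hpr : ∀ v, ¬ r p v := fun v h => hp (hkey _ _ h)
  have hpr' : ∀ v, ¬ r v p := fun v h => hpr v (hr.symm h)
  have hr' : IsPER (fun u v => r u v ∨ (u = p ∧ v = p)) := by
    constructor
    · rintro x y (h | h)
      · exact Or.inl (hr.symm h)
      · exact Or.inr h.symm
    · rintro x y z (h | h) (h' | h')
      · exact Or.inl (hr.trans h h')
      · exact absurd (h'.1 ▸ h) (hpr' _)
      · exact absurd (h.2 ▸ h') (hpr _)
      · exact Or.inr ⟨h.1, h'.2⟩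
  have hL : ∀ {y}, y ∈ (G.nbrs p st).map Prod.fst ↔ y ∈ st.map Prod.fst ∧ 0 < G.mult s(p, y) := by
    intro y
    simp only [List.mem_map, mem_nbrs]
    constructor
    · rintro ⟨e, ⟨h1, h2⟩, rfl⟩
      exact ⟨⟨e, h1, rfl⟩, h2⟩
    · rintro ⟨⟨e, h1, rfl⟩, h2⟩
      exact ⟨e, ⟨h1, h2⟩, rfl⟩
  have hLp : ∀ y ∈ (G.nbrs p st).map Prod.fst, y ≠ p := by
    rintro y hy rfl
    exact hp (hL.1 hy).1
  rw [linkFeasible_iff hr' (Or.inr ⟨rfl, rfl⟩)]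
  have h1 : ∀ y ∈ (G.nbrs p st).map Prod.fst, ¬ (r y p ∨ y = p ∧ p = p) := by
    rintro y hy (h | h)
    · exact hpr' y h
    · exact hLp y hy h.1
  rw [and_iff_right h1]
  refine and_congr ?_ (feasible_congr (fun _ _ => Iff.rfl) fun u v _ _ => ?_)
  -- The pairwise condition splits into one inside each block of copies, which excludes parallel
  -- edges into a live class, and one between blocks, which excludes two endpoints in one class. Two
  -- copies are enough to detect a multiplicity above one.
  · have hmap : (G.nbrs p st).map Prod.fst =
        (st.map Prod.fst).flatMap fun y => List.replicate (min 2 (G.mult s(p, y))) y := by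
      simp [nbrs, List.map_flatMap, List.flatMap_map]
    rw [hmap, List.pairwise_flatMap]
    constructor
    · rintro ⟨h2, h3⟩ y z hyz hy hz
      have hyk := hkey _ _ hyz
      have hzk := hkey _ _ (hr.symm hyz)
      by_cases e : y = z
      · subst e
        refine ⟨rfl, ?_⟩
        have := h2 y hyk
        by_contra hne
        have h4 : min 2 (G.mult s(p, y)) = 2 := by omega
        rw [h4] at this
        simp [List.replicate, hyz] at this
      · exfalso
        have h5 : ∀ x ∈ List.replicate (min 2 (G.mult s(p, y))) y,
            ∀ w ∈ List.replicate (min 2 (G.mult s(p, z))) z, ¬ (r x w ∨ x = p ∧ w = p) := by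
          have : Std.Symm (fun a b => ∀ x ∈ List.replicate (min 2 (G.mult s(p, a))) a,
              ∀ w ∈ List.replicate (min 2 (G.mult s(p, b))) b, ¬ (r x w ∨ x = p ∧ w = p)) :=
            ⟨fun a b h x hx w hw h' => h w hw x hx (hr'.symm h')⟩
          exact h3.forall hyk hzk e
        exact h5 y (List.mem_replicate.2 ⟨by omega, rfl⟩) z
          (List.mem_replicate.2 ⟨by omega, rfl⟩) (Or.inl hyz)
    · intro h
      constructor
      · intro y hy
        rw [List.pairwise_replicate]
        by_cases hm : G.mult s(p, y) ≤ 1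
        · left; omega
        · right
          rintro (h' | h')
          · have := (h y y h' (by omega) (by omega)).2
            omega
          · exact hp (h'.1 ▸ hy)
      · refine List.Nodup.pairwise_of_forall_ne hst ?_
        intro a ha b hb hab x hx w hw
        rw [List.mem_replicate] at hx hw
        obtain ⟨hx, rfl⟩ := hx
        obtain ⟨hw, rfl⟩ := hw
        rintro (h' | h')
        · exact hab (h _ _ h' (by omega) (by omega)).1
        · exact hp (h'.1 ▸ ha)
  · have ht : ∀ u, ((r u p ∨ u = p ∧ p = p) ∨
        ∃ y ∈ (G.nbrs p st).map Prod.fst, (r u y ∨ u = p ∧ y = p)) ↔ G.Touch p r u := by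
      intro u
      constructor
      · rintro ((h | h) | ⟨y, hy, h | h⟩)
        · exact absurd h (hpr' u)
        · exact Or.inl h.1
        · exact Or.inr ⟨y, h, (hL.1 hy).2⟩
        · exact Or.inl h.1
      · rintro (h | ⟨z, h, hz⟩)
        · exact Or.inl (Or.inr ⟨h, rfl⟩)
        · exact Or.inr ⟨z, hL.2 ⟨hkey _ _ (hr.symm h), hz⟩, Or.inl h⟩
    unfold MergeList Extend
    rw [ht, ht]
    constructor
    · rintro ((h | h) | h)
      · exact Or.inl h
      · exact Or.inr ⟨Or.inl h.1, Or.inl h.2⟩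
      · exact Or.inr h
    · rintro (h | h)
      · exact Or.inl (Or.inl h)
      · exact Or.inr h

end Multigraph
end Feasibility
end CountFVS

namespace CountFVS

set_option linter.unusedSectionVars false

/-! ### Smallest members of a family of sets and their number. -/

section Results

variable {V : Type*} [DecidableEq V]

/-- The result of a search for the smallest members of a family of sets: one of them and their
number, or nothing if all members are too large. -/
abbrev Res (V : Type*) := Option (List V × ℕ)

/-- The result for the union of two disjoint families. -/
def comb : Res V → Res V → Res V
  | none, r => r
  | some a, none => some a
  | some (w, c), some (w', c') =>
    if w.length < w'.length then some (w, c)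
    else if w'.length < w.length then some (w', c')
    else some (w, c + c')

/-- The result after one of the vertices of `cl` is added to every member of a family. -/
def brk (cl : List V) : Res V → Res V
  | none => none
  | some (w, c) => match cl with
    | [] => none
    | v :: _ => some (v :: w, cl.length * c)

/-- `r` describes the smallest members of the family `F`, provided that their size is at most
`k`. -/
def IsRes (k : ℕ) (F : Finset V → Prop) : Res V → Prop
  | none => ∀ S, F S → k < S.card
  | some (w, c) => w.Nodup ∧ F w.toFinset ∧ w.length ≤ k ∧ (∀ S, F S → w.length ≤ S.card) ∧
      c = Set.ncard {S | F S ∧ S.card = w.length}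

/-- Membership in the family `F` does not depend on the vertex `v`. -/
def Insensitive (F : Finset V → Prop) (v : V) : Prop :=
  ∀ S, F (insert v S) ↔ F S

theorem Insensitive.erase {F : Finset V → Prop} {v : V} (h : Insensitive F v) (S : Finset V) :
    F (S.erase v) ↔ F S := by
  by_cases hv : v ∈ S
  · rw [← h (S.erase v), Finset.insert_erase hv]
  · rw [Finset.erase_eq_of_notMem hv]

theorem IsRes.congr {k : ℕ} {F F' : Finset V → Prop} {r : Res V} (h : IsRes k F' r)
    (hF : ∀ S, F S ↔ F' S) : IsRes k F r := by
  have : F = F' := by funext S; exact propext (hF S)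
  rwa [this]

theorem isRes_zero {F : Finset V → Prop} (hF : ∀ S, F S → ∃ v, v ∈ S) :
    IsRes 0 F none := fun S hS => Finset.card_pos.2 (hF S hS)

theorem isRes_false {k : ℕ} {F : Finset V → Prop} (hF : ∀ S, ¬ F S) : IsRes k F none :=
  fun S hS => absurd hS (hF S)

/-- A smallest member of `F'` contains no insensitive vertex, since erasing it would give a smaller
member. Hence requiring it to avoid `cl` loses neither the minimum nor any smallest member. -/
theorem IsRes.avoid {k : ℕ} {F F' : Finset V → Prop} {r : Res V} {cl : List V}
    (h : IsRes k F' r) (hcl : ∀ v ∈ cl, Insensitive F' v)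
    (hF : ∀ S, F S ↔ F' S ∧ ∀ v ∈ cl, v ∉ S) : IsRes k F r := by
  match r, h with
  | none, h => exact fun S hS => h S ((hF S).1 hS).1
  | some (w, c), h =>
    obtain ⟨h1, h2, h3, h4, h5⟩ := h
    have key : ∀ S, F' S → S.card = w.length → F S := by
      intro S hS hc
      refine (hF S).2 ⟨hS, fun v hv hvS => ?_⟩
      have := h4 _ (((hcl v hv).erase S).2 hS)
      rw [Finset.card_erase_of_mem hvS] at this
      have := Finset.card_pos.2 ⟨v, hvS⟩
      omega
    refine ⟨h1, key _ h2 (List.toFinset_card_of_nodup h1), h3,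
      fun S hS => h4 S ((hF S).1 hS).1, ?_⟩
    rw [h5]
    congr 1
    ext S
    exact ⟨fun h => ⟨key S h.1 h.2, h.2⟩, fun h => ⟨((hF S).1 h.1).1, h.2⟩⟩

variable [Fintype V]

theorem IsRes.comb {k : ℕ} {F A B : Finset V → Prop} {r r' : Res V} (hA : IsRes k A r)
    (hB : IsRes k B r') (hd : ∀ S, A S → ¬ B S) (hF : ∀ S, F S ↔ A S ∨ B S) :
    IsRes k F (comb r r') := by
  match r, r', hA, hB with
  | none, none, hA, hB =>
    exact fun S hS => ((hF S).1 hS).elim (hA S) (hB S)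
  | none, some (w, c), hA, hB =>
    obtain ⟨h1, h2, h3, h4, h5⟩ := hB
    refine ⟨h1, (hF _).2 (Or.inr h2), h3, fun S hS => ((hF S).1 hS).elim (fun h => ?_) (h4 S), ?_⟩
    · have := hA S h; omega
    · rw [h5]
      congr 1
      ext S
      refine and_congr_left fun hc => ?_
      rw [hF]
      refine (or_iff_right fun h => ?_).symm
      have := hA S h
      omega
  | some (w, c), none, hA, hB =>
    obtain ⟨h1, h2, h3, h4, h5⟩ := hA
    refine ⟨h1, (hF _).2 (Or.inl h2), h3, fun S hS => ((hF S).1 hS).elim (h4 S) (fun h => ?_), ?_⟩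
    · have := hB S h; omega
    · rw [h5]
      congr 1
      ext S
      refine and_congr_left fun hc => ?_
      rw [hF]
      refine (or_iff_left fun h => ?_).symm
      have := hB S h
      omega
  | some (w, c), some (w', c'), hA, hB =>
    obtain ⟨h1, h2, h3, h4, h5⟩ := hA
    obtain ⟨g1, g2, g3, g4, g5⟩ := hB
    simp only [CountFVS.comb]
    by_cases hlt : w.length < w'.length
    · rw [if_pos hlt]
      refine ⟨h1, (hF _).2 (Or.inl h2), h3,
        fun S hS => ((hF S).1 hS).elim (h4 S) (fun h => ?_), ?_⟩
      · have := g4 S h; omega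
      · rw [h5]
        congr 1
        ext S
        refine and_congr_left fun hc => ?_
        rw [hF]
        refine (or_iff_left fun h => ?_).symm
        have := g4 S h
        omega
    · rw [if_neg hlt]
      by_cases hgt : w'.length < w.length
      · rw [if_pos hgt]
        refine ⟨g1, (hF _).2 (Or.inr g2), g3,
          fun S hS => ((hF S).1 hS).elim (fun h => ?_) (g4 S), ?_⟩
        · have := h4 S h; omega
        · rw [g5]
          congr 1
          ext S
          refine and_congr_left fun hc => ?_
          rw [hF]
          refine (or_iff_right fun h => ?_).symm
          have := h4 S h
          omega
      · rw [if_neg hgt]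
        have he : w'.length = w.length := by omega
        refine ⟨h1, (hF _).2 (Or.inl h2), h3,
          fun S hS => ((hF S).1 hS).elim (h4 S) (fun h => ?_), ?_⟩
        · have := g4 S h; omega
        · rw [h5, g5, he, ← Set.ncard_union_eq _ (Set.toFinite _) (Set.toFinite _)]
          · congr 1
            ext S
            simp only [Set.mem_union, Set.mem_ofPred_eq, hF]
            tauto
          · rw [Set.disjoint_left]
            exact fun S hS hS' => hd S hS.1 hS'.1

/-- The smallest members of `F` are the sets `insert u T` with `u ∈ cl` and `T` a smallest member of
`F'`. Such a `T` avoids `cl` by minimality, so the pair can be recovered from the set, and the count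
is the product. -/
theorem IsRes.brk {k : ℕ} {F F' : Finset V → Prop} {r : Res V} {cl : List V}
    (h : IsRes k F' r) (hn : cl.Nodup) (hcl : ∀ v ∈ cl, Insensitive F' v)
    (hF : ∀ S, F S ↔ F' S ∧ ∃ v ∈ cl, v ∈ S) : IsRes (k + 1) F (brk cl r) := by
  match r, cl, h with
  | none, cl, h =>
    intro S hS
    obtain ⟨hS, v, hv, hvS⟩ := (hF S).1 hS
    have := h _ (((hcl v hv).erase S).2 hS)
    rw [Finset.card_erase_of_mem hvS] at this
    omega
  | some (w, c), [], h => exact isRes_false fun S hS => by simpa using ((hF S).1 hS).2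
  | some (w, c), v :: cl, h =>
    obtain ⟨h1, h2, h3, h4, h5⟩ := h
    have key : ∀ S, F' S → S.card = w.length → ∀ u ∈ v :: cl, u ∉ S := by
      intro S hS hc u hu huS
      have := h4 _ (((hcl u hu).erase S).2 hS)
      rw [Finset.card_erase_of_mem huS] at this
      have := Finset.card_pos.2 ⟨u, huS⟩
      omega
    have hvw : v ∉ w := fun hv =>
      key _ h2 (List.toFinset_card_of_nodup h1) v (by simp) (List.mem_toFinset.2 hv)
    refine ⟨List.nodup_cons.2 ⟨hvw, h1⟩, ?_, by simpa using h3, ?_, ?_⟩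
    · rw [List.toFinset_cons]
      exact (hF _).2 ⟨(hcl v (by simp) _).2 h2, v, by simp, by simp⟩
    · intro S hS
      obtain ⟨hS, u, hu, huS⟩ := (hF S).1 hS
      have := h4 _ (((hcl u hu).erase S).2 hS)
      rw [Finset.card_erase_of_mem huS] at this
      have := Finset.card_pos.2 ⟨u, huS⟩
      simp only [List.length_cons]
      omega
    · have himg : {S | F S ∧ S.card = (v :: w).length} =
          (fun q : V × Finset V => insert q.1 q.2) ''
            (((v :: cl).toFinset : Set V) ×ˢ {S | F' S ∧ S.card = w.length}) := by
        ext S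
        simp only [Set.mem_image, Set.mem_prod, Set.mem_ofPred_eq, Prod.exists, Finset.mem_coe,
          List.mem_toFinset, List.length_cons]
        constructor
        · rintro ⟨hS, hc⟩
          obtain ⟨hS, u, hu, huS⟩ := (hF S).1 hS
          refine ⟨u, S.erase u, ⟨hu, ((hcl u hu).erase S).2 hS, ?_⟩, Finset.insert_erase huS⟩
          rw [Finset.card_erase_of_mem huS]
          omega
        · rintro ⟨u, T, ⟨hu, hT, hc⟩, rfl⟩
          refine ⟨(hF _).2 ⟨(hcl u hu _).2 hT, u, hu, by simp⟩, ?_⟩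
          rw [Finset.card_insert_of_notMem (key T hT hc u hu), hc]
      rw [himg, Set.InjOn.ncard_image, Set.ncard_prod, h5, Set.ncard_coe_finset,
        List.toFinset_card_of_nodup hn]
      rintro ⟨u, T⟩ ⟨hu, hT⟩ ⟨u', T'⟩ ⟨hu', hT'⟩ he
      simp only [Finset.mem_coe, List.mem_toFinset, Set.mem_ofPred_eq] at hu hT hu' hT' he
      have huT := key T hT.1 hT.2
      have huT' := key T' hT'.1 hT'.2
      have huu : u = u' := by
        have : u ∈ insert u' T' := he ▸ Finset.mem_insert_self u T
        exact (Finset.mem_insert.1 this).resolve_right (huT' u hu)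
      subst huu
      rw [← Finset.erase_insert (huT u hu), he, Finset.erase_insert (huT' u hu)]

/-- The count of a result is at most the number of sets. -/
theorem IsRes.count_le {k : ℕ} {F : Finset V → Prop} {w : List V} {c : ℕ}
    (h : IsRes k F (some (w, c))) : c ≤ 2 ^ Fintype.card V := by
  rw [h.2.2.2.2, ← Fintype.card_finset, ← Nat.card_eq_fintype_card, ← Set.ncard_univ]
  exact Set.ncard_le_ncard (Set.subset_univ _) (Set.toFinite _)

end Results
end CountFVS

namespace CountFVS

set_option linter.unusedSectionVars false

/-! ### The branching algorithm, its invariant and its correctness. -/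

section Branching

variable {V : Type*} [DecidableEq V]

/-- An entry `(y, cl, l)` of a state: the vertex `y` is attached to the component with the label
`l`, provided that none of the vertices of `cl` is deleted. -/
abbrev Entry (V : Type*) := V × List V × V

/-- Unite the components with the labels `a` and `p`. -/
def relabel (a p : V) (st : List (Entry V)) : List (Entry V) :=
  st.map fun e => (e.1, e.2.1, if e.2.2 = a then p else e.2.2)

theorem length_relabel (a p : V) (st : List (Entry V)) :
    (relabel a p st).length = st.length := by simp [relabel]

/-- Branch on the edges from the new vertex `p` to the entries in the list. -/
def link (cont : List (Entry V) → ℕ → Res V) (p : V) :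
    List (Entry V) → List (Entry V) → ℕ → Res V
  | [], st, k => cont st k
  | e :: L, st, k =>
    comb
      (if e.2.1 = [] then none else
        match k with
        | 0 => none
        | k + 1 => brk e.2.1 (link cont p L st k))
      (if e.2.2 = p then none else
        link cont p (relabel e.2.2 p L) (relabel e.2.2 p st) k)
termination_by L => L.length
decreasing_by all_goals simp [length_relabel]

theorem link_cons {cont : List (Entry V) → ℕ → Res V} {p : V} {e : Entry V}
    {L st : List (Entry V)} {k : ℕ} :
    link cont p (e :: L) st k = comb
      (if e.2.1 = [] then none else
        match k with
        | 0 => none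
        | k + 1 => brk e.2.1 (link cont p L st k))
      (if e.2.2 = p then none else
        link cont p (relabel e.2.2 p L) (relabel e.2.2 p st) k) := by
  cases k <;> rw [link]

namespace Multigraph

variable (G : Multigraph V)

/-- The branching algorithm: the smallest deletion sets for the state `st` and the vertices `todo`
still to be added. Vertices that are marked by `true` are always branched on. -/
def proc : List (V × Bool) → List (Entry V) → ℕ → Res V
  | [], _, _ => some ([], 1)
  | (p, z) :: rest, st, k =>
    match z, G.nbrs p st with
    | false, [] => proc rest st k
    | false, [e] => proc rest ((p, p :: e.2.1, e.2.2) :: st) k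
    | _, L =>
      comb
        (match k with
        | 0 => none
        | k + 1 => brk [p] (proc rest st k))
        (link (proc rest) p L ((p, [], p) :: st) k)

end Multigraph

/-- After the deletion of `S`, the vertices `x` and `y` lie in the same component. -/
def stRel (S : Finset V) (st : List (Entry V)) (x y : V) : Prop :=
  ∃ cl cl' a, (x, cl, a) ∈ st ∧ (y, cl', a) ∈ st ∧ (∀ v ∈ cl, v ∉ S) ∧ ∀ v ∈ cl', v ∉ S

theorem entry_unique {α : Type*} {st : List (V × α)} (h : (st.map Prod.fst).Nodup) {x : V}
    {a b : α} (ha : (x, a) ∈ st) (hb : (x, b) ∈ st) : a = b := by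
  have := List.inj_on_of_nodup_map h ha hb rfl
  exact (Prod.mk.inj this).2

theorem stRel_key {S : Finset V} {st : List (Entry V)} {x y : V} (h : stRel S st x y) :
    x ∈ st.map Prod.fst := by
  obtain ⟨cl, _, a, h, _⟩ := h
  exact List.mem_map.2 ⟨_, h, rfl⟩

theorem isPER_stRel {S : Finset V} {st : List (Entry V)} (h : (st.map Prod.fst).Nodup) :
    IsPER (stRel S st) where
  symm := fun ⟨cl, cl', a, h1, h2, h3, h4⟩ => ⟨cl', cl, a, h2, h1, h4, h3⟩
  trans := by
    rintro x y z ⟨cl, cl', a, h1, h2, h3, h4⟩ ⟨dl, dl', b, g1, g2, g3, g4⟩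
    have := entry_unique h h2 g1
    simp only [Prod.mk.injEq] at this
    obtain ⟨rfl, rfl⟩ := this
    exact ⟨cl, dl', a, h1, g2, h3, g4⟩

theorem stRel_cons_iff {S : Finset V} {st : List (Entry V)} {p a : V} {cl : List V}
    (hp : p ∉ st.map Prod.fst) (hcl : ∀ v ∈ cl, v ∉ S) {x y : V} :
    stRel S ((p, cl, a) :: st) x y ↔ stRel S st x y ∨
      (x = p ∨ ∃ dl, (x, dl, a) ∈ st ∧ ∀ v ∈ dl, v ∉ S) ∧
      (y = p ∨ ∃ dl, (y, dl, a) ∈ st ∧ ∀ v ∈ dl, v ∉ S) := by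
  constructor
  · rintro ⟨c, c', b, h1, h2, h3, h4⟩
    rw [List.mem_cons] at h1 h2
    rcases h1 with h1 | h1 <;> rcases h2 with h2 | h2
    · simp only [Prod.mk.injEq] at h1 h2
      exact Or.inr ⟨Or.inl h1.1, Or.inl h2.1⟩
    · simp only [Prod.mk.injEq] at h1
      exact Or.inr ⟨Or.inl h1.1, Or.inr ⟨c', h1.2.2 ▸ h2, h4⟩⟩
    · simp only [Prod.mk.injEq] at h2
      exact Or.inr ⟨Or.inr ⟨c, h2.2.2 ▸ h1, h3⟩, Or.inl h2.1⟩
    · exact Or.inl ⟨c, c', b, h1, h2, h3, h4⟩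
  · have key : ∀ x, (x = p ∨ ∃ dl, (x, dl, a) ∈ st ∧ ∀ v ∈ dl, v ∉ S) →
        ∃ c, (x, c, a) ∈ (p, cl, a) :: st ∧ ∀ v ∈ c, v ∉ S := by
      rintro x (rfl | ⟨dl, h, h'⟩)
      · exact ⟨cl, by simp, hcl⟩
      · exact ⟨dl, List.mem_cons_of_mem _ h, h'⟩
    rintro (⟨c, c', b, h1, h2, h3, h4⟩ | ⟨h1, h2⟩)
    · exact ⟨c, c', b, List.mem_cons_of_mem _ h1, List.mem_cons_of_mem _ h2, h3, h4⟩
    · obtain ⟨c, h1, h1'⟩ := key x h1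
      obtain ⟨c', h2, h2'⟩ := key y h2
      exact ⟨c, c', a, h1, h2, h1', h2'⟩

/-- An entry whose class is hit by `S` does not matter. -/
theorem stRel_cons_of_hit {S : Finset V} {st : List (Entry V)} {p a : V} {cl : List V}
    (hcl : ∃ v ∈ cl, v ∈ S) : stRel S ((p, cl, a) :: st) = stRel S st := by
  obtain ⟨v, hv, hvS⟩ := hcl
  funext x y
  apply propext
  constructor
  · rintro ⟨c, c', b, h1, h2, h3, h4⟩
    refine ⟨c, c', b, (List.mem_cons.1 h1).resolve_left ?_, (List.mem_cons.1 h2).resolve_left ?_,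
      h3, h4⟩
    · intro h
      simp only [Prod.mk.injEq] at h
      exact h3 v (h.2.1 ▸ hv) hvS
    · intro h
      simp only [Prod.mk.injEq] at h
      exact h4 v (h.2.1 ▸ hv) hvS
  · rintro ⟨c, c', b, h1, h2, h3, h4⟩
    exact ⟨c, c', b, List.mem_cons_of_mem _ h1, List.mem_cons_of_mem _ h2, h3, h4⟩

/-- If `cl` is not hit, the class of `y` consists of the unhit entries with label `a` and that of
`p` of those with label `p`. Giving both labels the name `p` unites exactly these. -/
theorem stRel_relabel {S : Finset V} {st : List (Entry V)} (h : (st.map Prod.fst).Nodup)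
    {p y a : V} {cl : List V} (hp : (p, [], p) ∈ st) (hy : (y, cl, a) ∈ st)
    (hcl : ∀ v ∈ cl, v ∉ S) : stRel S (relabel a p st) = MergeRel (stRel S st) y p := by
  have ht : ∀ u, (stRel S st u y ∨ stRel S st u p) ↔
      ∃ dl b, (u, dl, b) ∈ st ∧ (b = a ∨ b = p) ∧ ∀ v ∈ dl, v ∉ S := by
    intro u
    constructor
    · rintro (⟨c, c', b, h1, h2, h3, h4⟩ | ⟨c, c', b, h1, h2, h3, h4⟩)
      · have := entry_unique h h2 hy
        simp only [Prod.mk.injEq] at this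
        exact ⟨c, b, h1, Or.inl this.2, h3⟩
      · have := entry_unique h h2 hp
        simp only [Prod.mk.injEq] at this
        exact ⟨c, b, h1, Or.inr this.2, h3⟩
    · rintro ⟨dl, b, h1, rfl | rfl, h3⟩
      · exact Or.inl ⟨dl, cl, b, h1, hy, h3, hcl⟩
      · exact Or.inr ⟨dl, [], b, h1, hp, h3, by simp⟩
  have hmem : ∀ {u dl b}, (u, dl, b) ∈ relabel a p st ↔
      ∃ b', (u, dl, b') ∈ st ∧ (if b' = a then p else b') = b := by
    intro u dl b
    simp only [relabel, List.mem_map, Prod.exists, Prod.mk.injEq]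
    constructor
    · rintro ⟨u', dl', b', h1, rfl, rfl, h2⟩
      exact ⟨b', h1, h2⟩
    · rintro ⟨b', h1, h2⟩
      exact ⟨u, dl, b', h1, rfl, rfl, h2⟩
  funext u v
  apply propext
  unfold MergeRel
  rw [ht, ht]
  constructor
  · rintro ⟨c, c', b, h1, h2, h3, h4⟩
    obtain ⟨b1, g1, e1⟩ := hmem.1 h1
    obtain ⟨b2, g2, e2⟩ := hmem.1 h2
    by_cases hb : b = p
    · right
      refine ⟨⟨c, b1, g1, ?_, h3⟩, ⟨c', b2, g2, ?_, h4⟩⟩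
      · by_cases h : b1 = a
        · exact Or.inl h
        · rw [if_neg h] at e1
          exact Or.inr (e1.trans hb)
      · by_cases h : b2 = a
        · exact Or.inl h
        · rw [if_neg h] at e2
          exact Or.inr (e2.trans hb)
    · left
      have e1' : b1 = b := by split_ifs at e1 with h; exacts [absurd e1.symm hb, e1]
      have e2' : b2 = b := by split_ifs at e2 with h; exacts [absurd e2.symm hb, e2]
      exact ⟨c, c', b, e1' ▸ g1, e2' ▸ g2, h3, h4⟩
  · rintro (⟨c, c', b, h1, h2, h3, h4⟩ | ⟨⟨c, b1, h1, e1, h3⟩, ⟨c', b2, h2, e2, h4⟩⟩)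
    · exact ⟨c, c', _, hmem.2 ⟨b, h1, rfl⟩, hmem.2 ⟨b, h2, rfl⟩, h3, h4⟩
    · refine ⟨c, c', p, hmem.2 ⟨b1, h1, ?_⟩, hmem.2 ⟨b2, h2, ?_⟩, h3, h4⟩
      · rcases e1 with rfl | rfl <;> simp
      · rcases e2 with rfl | rfl <;> simp

namespace Multigraph

variable (G : Multigraph V)

/-- Every unmarked vertex has at most one edge to the later vertices. -/
def Ordered : List (V × Bool) → Prop
  | [] => True
  | (p, z) :: l => (z = false → G.degTo p (l.map Prod.fst) ≤ 1) ∧ Ordered l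

/-- The invariant of the branching algorithm, for the state `st`, the remaining edges `L` of the
current vertex, and the vertices `todo` to be added later. -/
structure Inv (L : List V) (todo : List (V × Bool)) (st : List (Entry V)) : Prop where
  keys : (st.map Prod.fst).Nodup
  todo_nodup : (todo.map Prod.fst).Nodup
  ordered : G.Ordered todo
  key_fresh : ∀ e ∈ st, e.1 ∉ todo.map Prod.fst
  label_fresh : ∀ e ∈ st, e.2.2 ∉ todo.map Prod.fst
  class_fresh : ∀ e ∈ st, ∀ v ∈ e.2.1, v ∉ todo.map Prod.fst
  class_nodup : ∀ e ∈ st, e.2.1.Nodup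
  degree : ∀ e ∈ st, e.2.1 ≠ [] → L.count e.1 + G.degTo e.1 (todo.map Prod.fst) ≤ 1
  disj : ∀ e ∈ st, ∀ e' ∈ st, e.1 ≠ e'.1 → (e.1 ∈ L ∨ G.AdjTo (todo.map Prod.fst) e.1) →
    (e'.1 ∈ L ∨ G.AdjTo (todo.map Prod.fst) e'.1) → List.Disjoint e.2.1 e'.2.1

variable {G}

theorem Inv.tail {y : V} {L : List V} {todo : List (V × Bool)} {st : List (Entry V)}
    (h : G.Inv (y :: L) todo st) : G.Inv L todo st where
  keys := h.keys
  todo_nodup := h.todo_nodup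
  ordered := h.ordered
  key_fresh := h.key_fresh
  label_fresh := h.label_fresh
  class_fresh := h.class_fresh
  class_nodup := h.class_nodup
  degree := fun e he hne => by
    have := h.degree e he hne
    have h2 : L.count e.1 ≤ (y :: L).count e.1 := List.count_le_count_cons
    omega
  disj := fun e he e' he' hne h1 h2 =>
    h.disj e he e' he' hne (h1.imp_left (List.mem_cons_of_mem _))
      (h2.imp_left (List.mem_cons_of_mem _))

theorem Inv.relabel {L : List V} {todo : List (V × Bool)} {st : List (Entry V)} {a p : V}
    (h : G.Inv L todo st) (hp : p ∉ todo.map Prod.fst) : G.Inv L todo (relabel a p st) where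
  keys := by
    have : (CountFVS.relabel a p st).map Prod.fst = st.map Prod.fst := by simp [CountFVS.relabel]
    rw [this]
    exact h.keys
  todo_nodup := h.todo_nodup
  ordered := h.ordered
  key_fresh := by
    intro e he
    obtain ⟨e, h1, rfl⟩ := List.mem_map.1 he
    exact h.key_fresh e h1
  label_fresh := by
    intro e he
    obtain ⟨e, h1, rfl⟩ := List.mem_map.1 he
    dsimp only
    split_ifs
    · exact hp
    · exact h.label_fresh e h1
  class_fresh := by
    intro e he
    obtain ⟨e, h1, rfl⟩ := List.mem_map.1 he
    exact h.class_fresh e h1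
  class_nodup := by
    intro e he
    obtain ⟨e, h1, rfl⟩ := List.mem_map.1 he
    exact h.class_nodup e h1
  degree := by
    intro e he
    obtain ⟨e, h1, rfl⟩ := List.mem_map.1 he
    exact h.degree e h1
  disj := by
    intro e he e' he'
    obtain ⟨e, h1, rfl⟩ := List.mem_map.1 he
    obtain ⟨e', h2, rfl⟩ := List.mem_map.1 he'
    exact h.disj e h1 e' h2

theorem Inv.skip {p : V} {z : Bool} {todo : List (V × Bool)} {st : List (Entry V)}
    (h : G.Inv [] ((p, z) :: todo) st) : G.Inv [] todo st where
  keys := h.keys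
  todo_nodup := (List.nodup_cons.1 h.todo_nodup).2
  ordered := h.ordered.2
  key_fresh := fun e he hm => h.key_fresh e he (List.mem_cons_of_mem _ hm)
  label_fresh := fun e he hm => h.label_fresh e he (List.mem_cons_of_mem _ hm)
  class_fresh := fun e he v hv hm => h.class_fresh e he v hv (List.mem_cons_of_mem _ hm)
  class_nodup := h.class_nodup
  degree := fun e he hne => by
    have := h.degree e he hne
    rw [List.map_cons, degTo_cons] at this
    omega
  disj := fun e he e' he' hne h1 h2 =>
    h.disj e he e' he' hne (h1.imp_right adjTo_cons) (h2.imp_right adjTo_cons)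

theorem Inv.fresh {p : V} {z : Bool} {todo : List (V × Bool)} {st : List (Entry V)}
    (h : G.Inv [] ((p, z) :: todo) st) : p ∉ todo.map Prod.fst ∧ p ∉ st.map Prod.fst ∧
      (∀ e ∈ st, e.2.2 ≠ p) ∧ ∀ e ∈ st, p ∉ e.2.1 := by
  refine ⟨(List.nodup_cons.1 h.todo_nodup).1, ?_, ?_, ?_⟩
  · intro hp
    obtain ⟨e, he, rfl⟩ := List.mem_map.1 hp
    exact h.key_fresh e he (by simp)
  · rintro e he rfl
    exact h.label_fresh e he (by simp)
  · exact fun e he hp => h.class_fresh e he p hp (by simp)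

theorem count_nbrs {p : V} {st : List (Entry V)} (h : (st.map Prod.fst).Nodup) {e : Entry V}
    (he : e ∈ st) : ((G.nbrs p st).map Prod.fst).count e.1 = min 2 (G.mult s(p, e.1)) := by
  induction st with
  | nil => simp at he
  | cons a st ih =>
    simp only [nbrs, List.flatMap_cons, List.map_append, List.count_append, List.map_replicate]
    rw [List.map_cons, List.nodup_cons] at h
    rcases List.mem_cons.1 he with rfl | he
    · rw [List.count_replicate_self, List.count_eq_zero_of_not_mem]
      · rfl
      · intro hm
        obtain ⟨b, hb, hb'⟩ := List.mem_map.1 hm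
        exact h.1 (hb' ▸ List.mem_map.2 ⟨b, (mem_nbrs.1 hb).1, rfl⟩)
    · have hne : a.1 ≠ e.1 := fun hae => h.1 (hae ▸ List.mem_map.2 ⟨e, he, rfl⟩)
      have := ih h.2 he
      rw [nbrs] at this
      rw [this, List.count_replicate, if_neg (by simpa using hne), zero_add]

/-- The edges of `p` move from the degrees towards the list to the pending edges `L`, so no degree
sum grows. An entry with a pending edge was adjacent to `p`, which was still to come, so
disjointness is inherited; the new entry has an empty class. -/
theorem Inv.keep {p : V} {z : Bool} {todo : List (V × Bool)} {st : List (Entry V)}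
    (h : G.Inv [] ((p, z) :: todo) st) :
    G.Inv ((G.nbrs p st).map Prod.fst) todo ((p, [], p) :: st) := by
  obtain ⟨f1, f2, f3, f4⟩ := h.fresh
  have hs := h.skip
  have hact : ∀ x, (x ∈ (G.nbrs p st).map Prod.fst ∨ G.AdjTo (todo.map Prod.fst) x) →
      (x ∈ [] ∨ G.AdjTo (((p, z) :: todo).map Prod.fst) x) := by
    rintro x (hx | hx)
    · obtain ⟨e, he, rfl⟩ := List.mem_map.1 hx
      exact Or.inr ⟨p, by simp, (mem_nbrs.1 he).2⟩
    · exact Or.inr (adjTo_cons hx)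
  constructor
  · rw [List.map_cons, List.nodup_cons]
    exact ⟨f2, h.keys⟩
  · exact hs.todo_nodup
  · exact hs.ordered
  · intro e he
    rcases List.mem_cons.1 he with rfl | he
    · exact f1
    · exact hs.key_fresh e he
  · intro e he
    rcases List.mem_cons.1 he with rfl | he
    · exact f1
    · exact hs.label_fresh e he
  · intro e he
    rcases List.mem_cons.1 he with rfl | he
    · simp
    · exact hs.class_fresh e he
  · intro e he
    rcases List.mem_cons.1 he with rfl | he
    · simp
    · exact hs.class_nodup e he
  · intro e he hne
    rcases List.mem_cons.1 he with rfl | he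
    · exact absurd rfl hne
    · rw [count_nbrs h.keys he]
      have := h.degree e he hne
      rw [List.map_cons, degTo_cons, List.count_nil, Sym2.eq_swap] at this
      dsimp only at this
      omega
  · intro e he e' he' hne h1 h2
    rcases List.mem_cons.1 he with rfl | he
    · simp
    · rcases List.mem_cons.1 he' with rfl | he'
      · simp
      · exact h.disj e he e' he' hne (hact _ h1) (hact _ h2)

/-- If `cl` is nonempty, `y` has spent its only edge on `p` and is invisible to later vertices. The
class can therefore pass to the entry of `p` without clashing with another visible entry. -/
theorem Inv.chain {p y a : V} {cl : List V} {todo : List (V × Bool)} {st : List (Entry V)}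
    (h : G.Inv [] ((p, false) :: todo) st) (hL : G.nbrs p st = [(y, cl, a)]) :
    G.Inv [] todo ((p, p :: cl, a) :: st) := by
  obtain ⟨f1, f2, f3, f4⟩ := h.fresh
  have hs := h.skip
  have hy : (y, cl, a) ∈ st ∧ 0 < G.mult s(p, y) := by
    have := mem_nbrs (G := G) (p := p) (l := st) (e := (y, cl, a))
    rw [hL] at this
    simpa using this
  have hdisj : ∀ e ∈ st, G.AdjTo (todo.map Prod.fst) e.1 → List.Disjoint (p :: cl) e.2.1 := by
    intro e he hadj
    rw [List.disjoint_cons_left]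
    refine ⟨f4 e he, ?_⟩
    by_cases hcl : cl = []
    · simp [hcl]
    · refine h.disj (y, cl, a) hy.1 e he ?_ (Or.inr ⟨p, by simp, hy.2⟩) (Or.inr (adjTo_cons hadj))
      -- If `e` were the entry of `y` itself, `y` would have an edge to `p` and another one to a
      -- later vertex, against the degree bound for nonempty classes.
      rintro rfl
      have := h.degree _ hy.1 hcl
      rw [List.map_cons, degTo_cons, List.count_nil, Sym2.eq_swap] at this
      have := hadj.degTo_pos
      have := hy.2
      dsimp only at *
      omega
  constructor
  · rw [List.map_cons, List.nodup_cons]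
    exact ⟨f2, h.keys⟩
  · exact hs.todo_nodup
  · exact hs.ordered
  · intro e he
    rcases List.mem_cons.1 he with rfl | he
    · exact f1
    · exact hs.key_fresh e he
  · intro e he
    rcases List.mem_cons.1 he with rfl | he
    · exact hs.label_fresh (y, cl, a) hy.1
    · exact hs.label_fresh e he
  · intro e he
    rcases List.mem_cons.1 he with rfl | he
    · intro v hv
      rcases List.mem_cons.1 hv with rfl | hv
      · exact f1
      · exact hs.class_fresh _ hy.1 v hv
    · exact hs.class_fresh e he
  · intro e he
    rcases List.mem_cons.1 he with rfl | he
    · exact List.nodup_cons.2 ⟨f4 _ hy.1, h.class_nodup _ hy.1⟩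
    · exact hs.class_nodup e he
  · intro e he hne
    rcases List.mem_cons.1 he with rfl | he
    · simpa using h.ordered.1 rfl
    · exact hs.degree e he hne
  · intro e he e' he' hne h1 h2
    rcases List.mem_cons.1 he with rfl | he
    · rcases List.mem_cons.1 he' with rfl | he'
      · exact absurd rfl hne
      · exact hdisj e' he' (h2.resolve_left (by simp))
    · rcases List.mem_cons.1 he' with rfl | he'
      · exact (hdisj e he (h1.resolve_left (by simp))).symm
      · exact hs.disj e he e' he' hne h1 h2

/-- Membership in the family of a state only depends on the vertices in the classes of the
entries that have edges to vertices added later. -/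
theorem Inv.stRel_insert {v : V} {st : List (Entry V)} {P : V → Prop}
    (hv : ∀ e ∈ st, P e.1 → v ∉ e.2.1) (S : Finset V) {x y : V} (hx : P x) (hy : P y) :
    stRel (insert v S) st x y ↔ stRel S st x y := by
  have key : ∀ {z cl a}, (z, cl, a) ∈ st → P z →
      ((∀ u ∈ cl, u ∉ insert v S) ↔ ∀ u ∈ cl, u ∉ S) := by
    intro z cl a hz hP
    refine forall₂_congr fun u hu => ?_
    rw [Finset.mem_insert, or_iff_right]
    rintro rfl
    exact hv _ hz hP hu
  constructor
  · rintro ⟨c, c', a, h1, h2, h3, h4⟩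
    exact ⟨c, c', a, h1, h2, (key h1 hx).1 h3, (key h2 hy).1 h4⟩
  · rintro ⟨c, c', a, h1, h2, h3, h4⟩
    exact ⟨c, c', a, h1, h2, (key h1 hx).2 h3, (key h2 hy).2 h4⟩

/-- A vertex can matter only by being inserted later or by lying in the class of an entry that a
later vertex sees. -/
theorem feasible_insensitive {v : V} {l : List V} {st : List (Entry V)} (hvl : v ∉ l)
    (hv : ∀ e ∈ st, G.AdjTo l e.1 → v ∉ e.2.1) :
    Insensitive (fun S => G.Feasible S l (stRel S st)) v := by
  intro S
  refine feasible_congr (fun q hq => ?_) fun x y hx hy => Inv.stRel_insert hv S hx hy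
  rw [Finset.mem_insert, or_iff_right]
  rintro rfl
  exact hvl hq

theorem linkFeasible_insensitive {v p : V} {L l : List V} {st : List (Entry V)} (hvl : v ∉ l)
    (hkeys : (st.map Prod.fst).Nodup) (hp : (p, [], p) ∈ st)
    (hv : ∀ e ∈ st, (e.1 ∈ L ∨ G.AdjTo l e.1) → v ∉ e.2.1) :
    Insensitive (fun S => G.LinkFeasible S p l L (stRel S st)) v := by
  intro S
  refine linkFeasible_congr (fun q hq => ?_) fun x y hx hy =>
    Inv.stRel_insert (P := fun x => x = p ∨ x ∈ L ∨ G.AdjTo l x) (fun e he h => ?_) S hx hy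
  · rw [Finset.mem_insert, or_iff_right]
    rintro rfl
    exact hvl hq
  · rcases h with h | h
    · obtain ⟨x, cl, a⟩ := e
      dsimp only at h
      subst h
      have := entry_unique hkeys he hp
      simp only [Prod.mk.injEq] at this
      simp [this.1]
    · exact hv e he h

variable [Fintype V]

/-- Splits the solutions by whether they hit the class of the first pending edge. If they do, the
edge is gone and the rest does not depend on the class, so `IsRes.brk` applies. If not, the edge
must join two different components, and `IsRes.avoid` removes the side condition. -/
theorem isRes_link {cont : List (Entry V) → ℕ → Res V} {todo : List (V × Bool)} {p : V}
    (hcont : ∀ st k, G.Inv [] todo st →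
      IsRes k (fun S => G.Feasible S (todo.map Prod.fst) (stRel S st)) (cont st k))
    (hpt : p ∉ todo.map Prod.fst) :
    ∀ (n : ℕ) (L st : List (Entry V)) (k : ℕ), L.length = n → L ⊆ st → (p, [], p) ∈ st →
      G.Inv (L.map Prod.fst) todo st →
      IsRes k (fun S => G.LinkFeasible S p (todo.map Prod.fst) (L.map Prod.fst) (stRel S st))
        (link cont p L st k) := by
  intro n
  induction n with
  | zero =>
    intro L st k hn _ _ hinv
    rw [List.length_eq_zero_iff] at hn
    subst hn
    rw [link]
    exact hcont st k hinv
  | succ n ih =>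
    intro L st k hn hLst hp hinv
    match L, hn with
    | (y, cl, a) :: L, hn =>
    have hn' : L.length = n := by simpa using hn
    have hy : (y, cl, a) ∈ st := hLst (by simp)
    have hLst' : L ⊆ st := fun e he => hLst (List.mem_cons_of_mem _ he)
    have hinv' : G.Inv (L.map Prod.fst) todo st := hinv.tail
    have hpr : ∀ S, stRel S st p p := fun S => ⟨[], [], p, hp, hp, by simp, by simp⟩
    -- After this edge no visible entry has a vertex of `cl` in its class: other entries by
    -- disjointness, `y` itself because a nonempty class allows only one edge.
    have hact : ∀ v ∈ cl, ∀ e ∈ st,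
        (e.1 ∈ L.map Prod.fst ∨ G.AdjTo (todo.map Prod.fst) e.1) → v ∉ e.2.1 := by
      intro v hv e he hact
      refine hinv.disj _ hy e he ?_ (Or.inl (by simp)) (hact.imp_left (List.mem_cons_of_mem _)) hv
      rintro rfl
      have := hinv.degree _ hy (List.ne_nil_of_mem hv)
      dsimp only at this hact
      rw [List.map_cons, List.count_cons_self] at this
      rcases hact with hact | hact
      · have := List.count_pos_iff.2 hact
        omega
      · have := hact.degTo_pos
        omega
    have hins : ∀ v ∈ cl, Insensitive (fun S => G.LinkFeasible S p (todo.map Prod.fst)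
        (L.map Prod.fst) (stRel S st)) v := fun v hv =>
      linkFeasible_insensitive (hinv.class_fresh _ hy v hv) hinv.keys hp (hact v hv)
    have hrel : ∀ {S v}, v ∈ cl → v ∈ S → ∀ u, ¬ stRel S st u y := by
      rintro S v hv hvS u ⟨c, c', b, h1, h2, h3, h4⟩
      have := entry_unique hinv.keys h2 hy
      simp only [Prod.mk.injEq] at this
      exact h4 v (this.1 ▸ hv) hvS
    rw [link_cons]
    refine IsRes.comb (A := fun S => G.LinkFeasible S p (todo.map Prod.fst)
        (L.map Prod.fst) (stRel S st) ∧ ∃ v ∈ cl, v ∈ S)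
      -- With an unhit class, `a = p` means that `y` and `p` are already connected and the edge
      -- would close a cycle.
      (B := fun S => (a ≠ p ∧ G.LinkFeasible S p (todo.map Prod.fst)
        (L.map Prod.fst) (stRel S (CountFVS.relabel a p st))) ∧ ∀ v ∈ cl, v ∉ S) ?_ ?_ ?_ ?_
    · dsimp only
      by_cases hcl : cl = []
      · rw [if_pos hcl]
        exact isRes_false fun S hS => by simpa [hcl] using hS.2
      · rw [if_neg hcl]
        cases k with
        | zero => exact isRes_zero fun S hS => let ⟨v, _, h⟩ := hS.2; ⟨v, h⟩
        | succ k =>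
          exact (ih L st k hn' hLst' hp hinv').brk (hinv.class_nodup _ hy) hins fun S => Iff.rfl
    · dsimp only
      by_cases hap : a = p
      · rw [if_pos hap]
        exact isRes_false fun S hS => hS.1.1 hap
      · rw [if_neg hap]
        have hmap : (CountFVS.relabel a p L).map Prod.fst = L.map Prod.fst := by
          simp [CountFVS.relabel]
        have hp' : (p, [], p) ∈ CountFVS.relabel a p st :=
          List.mem_map.2 ⟨_, hp, by simp⟩
        have hrinv := hinv'.relabel (a := a) hpt
        have h2 := ih (CountFVS.relabel a p L) (CountFVS.relabel a p st) k
          (by rw [length_relabel, hn']) (List.map_subset _ hLst') hp' (by rwa [hmap])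
        rw [hmap] at h2
        refine h2.avoid (cl := cl) (fun v hv => ?_) fun S => ?_
        · refine linkFeasible_insensitive (hinv.class_fresh _ hy v hv) hrinv.keys hp' ?_
          intro e he h
          obtain ⟨e, he', rfl⟩ := List.mem_map.1 he
          exact hact v hv e he' h
        · exact and_congr_left fun _ => and_iff_right hap
    · rintro S ⟨-, v, hv, hvS⟩ ⟨-, h⟩
      exact h v hv hvS
    · intro S
      simp only [List.map_cons, LinkFeasible]
      by_cases hS : ∃ v ∈ cl, v ∈ S
      -- Once the class is hit, `y` belongs to no class of the relation, so merging it with that of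
      -- `p` changes nothing.
      · have hS' : ¬ ∀ v ∈ cl, v ∉ S := by push Not; exact hS
        rw [and_iff_left hS, or_iff_left fun h => hS' h.2]
        obtain ⟨v, hv, hvS⟩ := hS
        have hyp : ¬ stRel S st y p := fun h =>
          hrel hv hvS p ((isPER_stRel hinv.keys).symm h)
        rw [and_iff_right hyp]
        refine linkFeasible_congr (fun _ _ => Iff.rfl) fun u w _ _ => ?_
        unfold MergeRel
        constructor
        · rintro (h | ⟨h1, h2⟩)
          · exact h
          · exact (isPER_stRel hinv.keys).trans (h1.resolve_left (hrel hv hvS u))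
              ((isPER_stRel hinv.keys).symm (h2.resolve_left (hrel hv hvS w)))
        · exact Or.inl
      · have hS' : ∀ v ∈ cl, v ∉ S := fun v hv hvS => hS ⟨v, hv, hvS⟩
        rw [or_iff_right fun h => hS h.2, and_iff_left hS',
          stRel_relabel hinv.keys hp hy hS']
        refine and_congr_left fun _ => not_congr ?_
        constructor
        · rintro ⟨c, c', b, h1, h2, h3, h4⟩
          have e1 := entry_unique hinv.keys h1 hy
          have e2 := entry_unique hinv.keys h2 hp
          simp only [Prod.mk.injEq] at e1 e2
          exact e1.2.symm.trans e2.2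
        · rintro rfl
          exact ⟨cl, [], a, hy, hp, hS', by simp⟩

theorem isRes_nil {k : ℕ} {F : Finset V → Prop} (hF : ∀ S, F S) :
    IsRes k F (some ([], 1)) := by
  refine ⟨List.nodup_nil, hF _, by simp, by simp, ?_⟩
  have : {S : Finset V | F S ∧ S.card = ([] : List V).length} = {∅} := by
    ext S; simp [hF]
  rw [this, Set.ncard_singleton]

theorem proc_cons_of_branch {p : V} {z : Bool} {rest : List (V × Bool)} {st : List (Entry V)}
    {k : ℕ} (h : z = true ∨ 2 ≤ (G.nbrs p st).length) :
    G.proc ((p, z) :: rest) st k = CountFVS.comb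
      (match k with
        | 0 => none
        | k + 1 => CountFVS.brk [p] (G.proc rest st k))
      (link (G.proc rest) p (G.nbrs p st) ((p, [], p) :: st) k) := by
  rw [proc.eq_def]
  dsimp only
  split
  · next h' => rw [h'] at h; simp at h
  · next h' => rw [h'] at h; simp at h
  · rfl

theorem proc_cons_of_nil {p : V} {rest : List (V × Bool)} {st : List (Entry V)} {k : ℕ}
    (h : G.nbrs p st = []) : G.proc ((p, false) :: rest) st k = G.proc rest st k := by
  rw [proc.eq_def]
  simp only [h]

theorem proc_cons_of_singleton {p : V} {rest : List (V × Bool)} {st : List (Entry V)} {k : ℕ}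
    {e : Entry V} (h : G.nbrs p st = [e]) :
    G.proc ((p, false) :: rest) st k = G.proc rest ((p, p :: e.2.1, e.2.2) :: st) k := by
  rw [proc.eq_def]
  simp only [h]

/-- Branching vertices reduce to `isRes_link`. An unmarked vertex with at most one edge into the
state sends at most one to later vertices, so it is either irrelevant or extends a path whose
cutting can be postponed. -/
theorem isRes_proc : ∀ (todo : List (V × Bool)) (st : List (Entry V)) (k : ℕ), G.Inv [] todo st →
    IsRes k (fun S => G.Feasible S (todo.map Prod.fst) (stRel S st)) (G.proc todo st k) := by
  intro todo
  induction todo with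
  | nil => intro st k _; exact isRes_nil fun S => by simp [Feasible]
  | cons pz rest ih =>
    obtain ⟨p, z⟩ := pz
    intro st k hinv
    obtain ⟨f1, f2, f3, f4⟩ := hinv.fresh
    have hkeyp : ∀ S v, ¬ stRel S st p v := fun S v h => f2 (stRel_key h)
    have hkeyp' : ∀ S v, ¬ stRel S st v p := fun S v h =>
      hkeyp S v ((isPER_stRel hinv.keys).symm h)
    by_cases hb : z = true ∨ 2 ≤ (G.nbrs p st).length
    · rw [proc_cons_of_branch hb]
      refine IsRes.comb (A := fun S => G.Feasible S (rest.map Prod.fst) (stRel S st) ∧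
          ∃ v ∈ [p], v ∈ S)
        (B := fun S => G.LinkFeasible S p (rest.map Prod.fst) ((G.nbrs p st).map Prod.fst)
          (stRel S ((p, [], p) :: st)) ∧ ∀ v ∈ [p], v ∉ S) ?_ ?_ ?_ ?_
      · cases k with
        | zero => exact isRes_zero fun S hS => let ⟨v, _, h⟩ := hS.2; ⟨v, h⟩
        | succ k =>
          refine (ih st k hinv.skip).brk (List.nodup_singleton p) (fun v hv => ?_) fun S => Iff.rfl
          rw [List.mem_singleton] at hv
          subst hv
          exact feasible_insensitive f1 fun e he _ => f4 e he
      · have hk := hinv.keep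
        refine (isRes_link ih f1 _ _ _ k rfl ?_ (by simp) hk).avoid (fun v hv => ?_)
          fun S => Iff.rfl
        · exact fun e he => List.mem_cons_of_mem _ (mem_nbrs.1 he).1
        · rw [List.mem_singleton] at hv
          subst hv
          refine linkFeasible_insensitive f1 hk.keys (by simp) fun e he _ => ?_
          rcases List.mem_cons.1 he with rfl | he
          · simp
          · exact f4 e he
      · rintro S ⟨-, v, hv, hvS⟩ ⟨-, h⟩
        exact h v hv hvS
      · intro S
        simp only [List.map_cons, Feasible, List.mem_singleton, exists_eq_left, forall_eq]
        have hst : stRel S ((p, [], p) :: st) = fun u v => stRel S st u v ∨ (u = p ∧ v = p) := by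
          funext u v
          apply propext
          rw [stRel_cons_iff f2 (by simp)]
          have hno : ∀ u, ¬ ∃ dl, (u, dl, p) ∈ st ∧ ∀ v ∈ dl, v ∉ S := by
            rintro u ⟨dl, h, -⟩
            exact f3 _ h rfl
          simp only [hno, or_false]
        rw [hst, linkFeasible_nbrs (isPER_stRel hinv.keys) hinv.keys (fun x y h => stRel_key h) f2]
        by_cases hpS : p ∈ S <;> simp [hpS]
    · push Not at hb
      have hz : z = false := by simpa using hb.1
      subst hz
      have hnb : ∀ x ∈ st.map Prod.fst, 0 < G.mult s(p, x) →
          ∃ e ∈ G.nbrs p st, e.1 = x := by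
        intro x hx h
        obtain ⟨e, he, rfl⟩ := List.mem_map.1 hx
        exact ⟨e, mem_nbrs.2 ⟨he, h⟩, rfl⟩
      have hdeg := hinv.ordered.1 rfl
      match hL : G.nbrs p st with
      | [] =>
        rw [proc_cons_of_nil hL]
        refine (ih st k hinv.skip).congr fun S => ?_
        have hno : ∀ x y, stRel S st x y → ¬ 0 < G.mult s(p, x) := by
          intro x y hxy h
          obtain ⟨e, he, -⟩ := hnb x (stRel_key hxy) h
          rw [hL] at he
          simp at he
        simp only [List.map_cons, Feasible]
        by_cases hpS : p ∈ S
        · simp [hpS]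
        · simp only [hpS, false_imp_iff, true_and, not_false_eq_true, forall_const]
          -- Without edges into the state, `p` can always be kept and is then isolated. Its single
          -- possible later edge closes no cycle, so keeping it imposes no condition.
          have hlk : G.Linkable p (stRel S st) := fun y z hyz hy _ => absurd hy (hno y z hyz)
          rw [and_iff_right hlk, ← feasible_isolated f1 hdeg (hkeyp S) (hkeyp' S)]
          have ht : ∀ u, G.Touch p (stRel S st) u ↔ u = p := by
            intro u
            refine or_iff_left ?_
            rintro ⟨z, hz, hz'⟩
            exact hno z u ((isPER_stRel hinv.keys).symm hz) hz'
          refine feasible_congr (fun _ _ => Iff.rfl) fun u v _ _ => ?_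
          unfold Extend
          rw [ht, ht]
      | [(y, cl, a)] =>
        rw [proc_cons_of_singleton hL]
        refine (ih _ k (hinv.chain hL)).congr fun S => ?_
        have hy : (y, cl, a) ∈ st ∧ 0 < G.mult s(p, y) := by
          have := mem_nbrs (G := G) (p := p) (l := st) (e := (y, cl, a))
          rw [hL] at this
          simpa using this
        have hm1 : G.mult s(p, y) = 1 := by
          have := count_nbrs (G := G) (p := p) hinv.keys hy.1
          rw [hL] at this
          simp at this
          omega
        have honly : ∀ x z, stRel S st x z → 0 < G.mult s(p, x) → x = y := by
          intro x z hxz h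
          obtain ⟨e, he, rfl⟩ := hnb x (stRel_key hxz) h
          rw [hL, List.mem_singleton] at he
          rw [he]
        simp only [List.map_cons, Feasible]
        by_cases hpS : p ∈ S
        · simp only [hpS, forall_const, not_true_eq_false, false_imp_iff, and_true]
          rw [stRel_cons_of_hit ⟨p, by simp, hpS⟩]
        · simp only [hpS, false_imp_iff, true_and, not_false_eq_true, forall_const]
          have hlk : G.Linkable p (stRel S st) := by
            intro u v huv hu hv
            have e1 := honly u v huv hu
            have e2 := honly v u ((isPER_stRel hinv.keys).symm huv) hv
            exact ⟨e1.trans e2.symm, by rw [e1, hm1]⟩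
          rw [and_iff_right hlk]
          -- If the path behind `y` is already cut, `y` belongs to no live class and `p` is isolated
          -- as before. Otherwise `p` joins the class with label `a`.
          by_cases hS : ∃ v ∈ cl, v ∈ S
          · have hS' : ∃ v ∈ p :: cl, v ∈ S :=
              let ⟨v, hv, h⟩ := hS; ⟨v, List.mem_cons_of_mem _ hv, h⟩
            rw [stRel_cons_of_hit hS', ← feasible_isolated f1 hdeg (hkeyp S) (hkeyp' S)]
            have ht : ∀ u, G.Touch p (stRel S st) u ↔ u = p := by
              intro u
              refine or_iff_left ?_
              rintro ⟨z, hz, hz'⟩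
              have hz2 := (isPER_stRel hinv.keys).symm hz
              have := honly z u hz2 hz'
              subst this
              obtain ⟨c, c', b, h1, h2, h3, h4⟩ := hz2
              have e1 := entry_unique hinv.keys h1 hy.1
              simp only [Prod.mk.injEq] at e1
              obtain ⟨v, hv, hvS⟩ := hS
              exact h3 v (e1.1 ▸ hv) hvS
            refine feasible_congr (fun _ _ => Iff.rfl) fun u v _ _ => ?_
            unfold Extend
            rw [ht, ht]
          · have hcl : ∀ v ∈ cl, v ∉ S := fun v hv hvS => hS ⟨v, hv, hvS⟩
            have hcl' : ∀ v ∈ p :: cl, v ∉ S := by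
              intro v hv
              rcases List.mem_cons.1 hv with rfl | hv
              exacts [hpS, hcl v hv]
            refine feasible_congr (fun _ _ => Iff.rfl) fun u v _ _ => ?_
            rw [stRel_cons_iff f2 hcl']
            have ht : ∀ u, G.Touch p (stRel S st) u ↔
                (u = p ∨ ∃ dl, (u, dl, a) ∈ st ∧ ∀ v ∈ dl, v ∉ S) := by
              intro u
              refine or_congr_right ?_
              constructor
              · rintro ⟨z, hz, hz'⟩
                have := honly z u ((isPER_stRel hinv.keys).symm hz) hz'
                subst this
                obtain ⟨c, c', b, h1, h2, h3, h4⟩ := hz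
                have e1 := entry_unique hinv.keys h2 hy.1
                simp only [Prod.mk.injEq] at e1
                exact ⟨c, e1.2 ▸ h1, h3⟩
              · rintro ⟨dl, h, h'⟩
                exact ⟨y, ⟨dl, cl, a, h, hy.1, h', hcl⟩, hy.2⟩
            unfold Extend
            rw [ht, ht]
      | _ :: _ :: _ =>
        have := hb.2
        rw [hL] at this
        simp at this

end Multigraph
end Branching
end CountFVS

namespace CountFVS

set_option linter.unusedSectionVars false

/-! ### Leaf orders of forests and iterative compression. -/

section Compression

variable {V : Type*} [DecidableEq V]

namespace Multigraph

variable (G : Multigraph V)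

/-- The first member of the second list that has at most one edge to the first list. -/
def findLeaf (all : List (V × Bool)) : List (V × Bool) → Option (V × Bool)
  | [] => none
  | x :: l => if (G.nbrs x.1 all).length ≤ 1 then some x else findLeaf all l

/-- Order the vertices of a forest such that every vertex has at most one edge to the later ones.
The first argument bounds the number of vertices. -/
def order : ℕ → List (V × Bool) → List (V × Bool)
  | 0, _ => []
  | n + 1, l => match G.findLeaf l l with
    | none => []
    | some x => x :: order n (l.filter fun y => y.1 ∉ [x.1])

/-- The vertices of the next instance of the branching algorithm, if `w` is a feedback vertex set
of the graph that is induced by `vs`. -/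
def nextTodo (v : V) (vs w : List V) : List (V × Bool) :=
  (v, true) :: (w.map (fun x => (x, true)) ++
    G.order vs.length ((vs.map fun x => (x, false)).filter fun x => x.1 ∉ w))

/-- The smallest feedback vertex sets of the graph induced by the list, by iterative compression. -/
def solve (k : ℕ) : List V → Res V
  | [] => some ([], 1)
  | v :: vs => match solve k vs with
    | none => none
    | some (w, _) => G.proc (G.nextTodo v vs w) [] k

variable {G}

theorem degTo_le_one {x : V} : ∀ {l : List V}, l.Nodup →
    (∀ y ∈ l, ∀ z ∈ l, 0 < G.mult s(x, y) → 0 < G.mult s(x, z) →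
      y = z ∧ G.mult s(x, y) = 1) → G.degTo x l ≤ 1
  | [], _, _ => by simp [degTo]
  | a :: l, hn, h => by
    rw [List.nodup_cons] at hn
    rw [degTo_cons]
    by_cases ha : G.mult s(x, a) = 0
    · have := degTo_le_one hn.2 fun y hy z hz =>
        h y (List.mem_cons_of_mem _ hy) z (List.mem_cons_of_mem _ hz)
      omega
    · have h1 := (h a (by simp) a (by simp) (by omega) (by omega)).2
      have h0 : G.degTo x l = 0 := by
        refine List.sum_eq_zero fun m hm => ?_
        obtain ⟨y, hy, rfl⟩ := List.mem_map.1 hm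
        by_contra hne
        have := (h a (by simp) y (List.mem_cons_of_mem _ hy) (by omega) (by omega)).1
        exact hn.1 (this ▸ hy)
      omega

/-- Capping multiplicities at two does not affect a comparison with one. The stronger alternative
inside is what passes through the induction. -/
theorem length_nbrs_le_one {α : Type*} {x : V} : ∀ {l : List (V × α)},
    (G.nbrs x l).length ≤ 1 ↔ G.degTo x (l.map Prod.fst) ≤ 1 := by
  have key : ∀ l : List (V × α), (G.nbrs x l).length = min 2 (G.degTo x (l.map Prod.fst)) ∨
      2 ≤ (G.nbrs x l).length ∧ 2 ≤ G.degTo x (l.map Prod.fst) := by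
    intro l
    induction l with
    | nil => simp [nbrs, degTo]
    | cons a l ih =>
      have h1 : (G.nbrs x (a :: l)).length =
          min 2 (G.mult s(x, a.1)) + (G.nbrs x l).length := by
        simp [nbrs]
      rw [h1, List.map_cons, degTo_cons]
      omega
  intro l
  have := key l
  omega

theorem findLeaf_mem {all : List (V × Bool)} {x : V × Bool} : ∀ {l : List (V × Bool)},
    G.findLeaf all l = some x → x ∈ l ∧ (G.nbrs x.1 all).length ≤ 1
  | [], h => by simp [findLeaf] at h
  | a :: l, h => by
    rw [findLeaf] at h
    split_ifs at h with h1
    · obtain rfl := Option.some.inj h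
      exact ⟨by simp, h1⟩
    · have := findLeaf_mem h
      exact ⟨List.mem_cons_of_mem _ this.1, this.2⟩

theorem findLeaf_eq_none {all : List (V × Bool)} : ∀ {l : List (V × Bool)},
    G.findLeaf all l = none → ∀ x ∈ l, ¬ (G.nbrs x.1 all).length ≤ 1
  | [], _ => by simp
  | a :: l, h => by
    rw [findLeaf] at h
    split_ifs at h with h1
    intro x hx
    rcases List.mem_cons.1 hx with rfl | hx
    · exact h1
    · exact findLeaf_eq_none h x hx

theorem filter_ne_perm {l : List (V × Bool)} (hn : (l.map Prod.fst).Nodup) {x : V × Bool}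
    (hx : x ∈ l) : (x :: l.filter fun y => y.1 ∉ [x.1]).Perm l := by
  have : (l.filter fun y => y.1 ∉ [x.1]) = l.erase x := by
    rw [(List.Nodup.of_map _ hn).erase_eq_filter]
    refine List.filter_congr fun y hy => ?_
    have : y.1 = x.1 ↔ y = x :=
      ⟨fun h => List.inj_on_of_nodup_map hn hy hx h, fun h => by rw [h]⟩
    by_cases hyx : y = x <;> simp [this, hyx]
  rw [this]
  exact (List.perm_cons_erase hx).symm

/-- In a forest the search for a leaf always succeeds (`AcyclicOn.exists_leaf`), and removing a
vertex leaves a forest. A leaf has at most one edge to all that remains, hence to the vertices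
listed after it. -/
theorem order_spec : ∀ {n : ℕ} {l : List (V × Bool)}, l.length ≤ n → (l.map Prod.fst).Nodup →
    G.AcyclicOn (l.map Prod.fst).toFinset → (G.order n l).Perm l ∧ G.Ordered (G.order n l)
  | 0, l, hl, _, _ => by
    have : l = [] := List.length_eq_zero_iff.1 (by omega)
    subst this
    simp [order, Ordered]
  | n + 1, l, hl, hn, hac => by
    rw [order]
    match hf : G.findLeaf l l with
    | none =>
      have : l = [] := by
        by_contra hne
        obtain ⟨a, ha⟩ := List.exists_mem_of_ne_nil l hne
        obtain ⟨x, hx, hleaf⟩ := hac.exists_leaf ⟨a.1, List.mem_toFinset.2 (List.mem_map.2 ⟨a, ha, rfl⟩)⟩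
        obtain ⟨e, he, rfl⟩ := List.mem_map.1 (List.mem_toFinset.1 hx)
        refine findLeaf_eq_none hf e he (length_nbrs_le_one.2 (degTo_le_one hn ?_))
        simpa only [List.mem_toFinset] using hleaf
      subst this
      simp [Ordered]
    | some x =>
      obtain ⟨hx, hdeg⟩ := findLeaf_mem hf
      have hperm := filter_ne_perm hn hx
      have hsub : (l.filter fun y => y.1 ∉ [x.1]).Sublist l := List.filter_sublist
      have hlen := hperm.length_eq
      rw [List.length_cons] at hlen
      have ih := order_spec (n := n) (l := l.filter fun y => y.1 ∉ [x.1]) (by omega)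
        (hn.sublist (hsub.map _)) (hac.mono fun y hy => by
          rw [List.mem_toFinset] at hy ⊢
          exact (hsub.map _).subset hy)
      refine ⟨(ih.1.cons x).trans hperm, fun _ => ?_, ih.2⟩
      have h1 : G.degTo x.1 ((G.order n (l.filter fun y => y.1 ∉ [x.1])).map Prod.fst) =
          G.degTo x.1 ((l.filter fun y => y.1 ∉ [x.1]).map Prod.fst) :=
        ((ih.1.map _).map _).sum_eq
      have h2 : G.degTo x.1 ((l.filter fun y => y.1 ∉ [x.1]).map Prod.fst) ≤
          G.degTo x.1 (l.map Prod.fst) :=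
        ((hsub.map _).map _).sum_le_sum (by simp)
      have h3 := length_nbrs_le_one.1 hdeg
      omega

theorem ordered_marked {l : List (V × Bool)} (h : G.Ordered l) : ∀ w : List V,
    G.Ordered (w.map (fun x => (x, true)) ++ l)
  | [] => h
  | _ :: w => ⟨fun h => by simp at h, ordered_marked h w⟩

variable [Fintype V]

/-- A member outside `vs` could be erased, contradicting minimality. -/
theorem subset_of_isRes {k : ℕ} {vs w : List V} {c : ℕ}
    (h : IsRes k (fun S => G.AcyclicOn (vs.toFinset \ S)) (some (w, c))) : w ⊆ vs := by
  intro u hu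
  by_contra huv
  obtain ⟨h1, h2, -, h4, -⟩ := h
  have := h4 (w.toFinset.erase u) (h2.mono ?_)
  · rw [Finset.card_erase_of_mem (List.mem_toFinset.2 hu), List.toFinset_card_of_nodup h1] at this
    have := List.length_pos_of_mem hu
    omega
  · intro x hx
    rw [Finset.mem_sdiff, List.mem_toFinset] at hx ⊢
    refine ⟨hx.1, fun h => hx.2 (Finset.mem_erase.2 ⟨?_, h⟩)⟩
    rintro rfl
    exact huv hx.1

/-- The marked vertices are exempt from the degree condition, and the rest is a forest because `w`
is a feedback vertex set. With an empty state the conditions on entries are vacuous. -/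
theorem nextTodo_spec {v : V} {vs w : List V} (hn : (v :: vs).Nodup) (hw : w.Nodup)
    (hwv : w ⊆ vs) (hac : G.AcyclicOn (vs.toFinset \ w.toFinset)) :
    ((G.nextTodo v vs w).map Prod.fst).Perm (v :: vs) ∧ G.Inv [] (G.nextTodo v vs w) [] := by
  rw [List.nodup_cons] at hn
  set F := (vs.map fun x => (x, false)).filter (fun x : V × Bool => x.1 ∉ w) with hF
  have hFk : F.map Prod.fst = vs.filter (· ∉ w) := by
    rw [hF, List.filter_map, List.map_map]
    simp [Function.comp_def]
  have hFn : (F.map Prod.fst).Nodup := by rw [hFk]; exact hn.2.filter _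
  have hFl : F.length ≤ vs.length := by
    have := List.length_filter_le (fun x : V × Bool => x.1 ∉ w) (vs.map fun x => (x, false))
    rwa [List.length_map] at this
  have hFa : (F.map Prod.fst).toFinset = vs.toFinset \ w.toFinset := by
    rw [hFk]; ext x; simp
  obtain ⟨hp, ho⟩ := order_spec (G := G) hFl hFn (by rwa [hFa])
  have hperm : ((G.nextTodo v vs w).map Prod.fst).Perm (v :: vs) := by
    have e : (G.nextTodo v vs w).map Prod.fst =
        v :: (w ++ (G.order vs.length F).map Prod.fst) := by
      simp [nextTodo, hF, Function.comp_def]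
    rw [e]
    refine List.Perm.cons _ ?_
    refine ((hp.map Prod.fst).append_left w).trans ?_
    rw [hFk, List.perm_ext_iff_of_nodup _ hn.2]
    · intro x
      rw [List.mem_append, List.mem_filter]
      constructor
      · rintro (h | h)
        exacts [hwv h, h.1]
      · intro h
        by_cases hx : x ∈ w
        · exact Or.inl hx
        · exact Or.inr ⟨h, by simpa using hx⟩
    · refine List.nodup_append.2 ⟨hw, hn.2.filter _, ?_⟩
      rintro x hx y hy rfl
      simpa [hx] using (List.mem_filter.1 hy).2
  refine ⟨hperm, ?_⟩
  constructor
  · simp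
  · exact hperm.nodup_iff.2 (List.nodup_cons.2 hn)
  · exact ⟨fun h => by simp at h, ordered_marked ho w⟩
  all_goals simp

/-- A solution for `v :: vs` also solves `vs`, so failure on `vs` is final. Otherwise the witness
for `vs` serves only to set up the search; the result for `v :: vs` is computed afresh by `proc`. -/
theorem isRes_solve {k : ℕ} : ∀ {vs : List V}, vs.Nodup →
    IsRes k (fun S => G.AcyclicOn (vs.toFinset \ S)) (G.solve k vs)
  | [], _ => isRes_nil fun S => by simpa using acyclicOn_empty
  | v :: vs, hn => by
    have ih := isRes_solve (k := k) (vs := vs) (List.nodup_cons.1 hn).2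
    rw [solve]
    match hs : G.solve k vs with
    | none =>
      rw [hs] at ih
      refine fun S hS => ih S (hS.mono ?_)
      rw [List.toFinset_cons]
      exact Finset.sdiff_subset_sdiff (Finset.subset_insert _ _) subset_rfl
    | some (w, c) =>
      rw [hs] at ih
      obtain ⟨hp, hinv⟩ := nextTodo_spec hn ih.1 (subset_of_isRes ih) ih.2.1
      refine (isRes_proc _ _ k hinv).congr fun S => ?_
      have h0 : stRel S ([] : List (Entry V)) = G.Conn ∅ := by
        funext x y
        simp [stRel, Conn]
      rw [h0, feasible_conn hinv.todo_nodup (by simp) acyclicOn_empty, List.toFinset_eq_of_perm _ _ hp,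
        Finset.empty_union]

/-- The number that is read off from the result of the compression algorithm. -/
def countOf : Res V → ℕ
  | none => 0
  | some (_, c) => c

theorem countOf_solve {k : ℕ} {vs : List V} (hn : vs.Nodup) (hall : ∀ v, v ∈ vs) :
    countOf (G.solve k vs) = G.numMinFVS k := by
  have h := isRes_solve (G := G) (k := k) hn
  have hu : vs.toFinset = Finset.univ := by ext; simp [hall]
  rw [hu] at h
  simp only [← isFVS_iff] at h
  unfold numMinFVS
  match hs : G.solve k vs with
  | none =>
    rw [hs] at h
    have : {S | G.IsMinimumFVS S ∧ S.card ≤ k} = ∅ := by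
      ext S
      simp only [Set.mem_ofPred_eq, Set.mem_empty_iff_false, iff_false, not_and, not_le]
      exact fun hS => h S hS.1
    rw [this, Set.ncard_empty, countOf]
  | some (w, c) =>
    rw [hs] at h
    obtain ⟨h1, h2, h3, h4, h5⟩ := h
    rw [countOf, h5]
    congr 1
    ext S
    simp only [Set.mem_ofPred_eq, IsMinimumFVS]
    constructor
    · rintro ⟨hS, hc⟩
      exact ⟨⟨hS, fun T hT => hc ▸ h4 T hT⟩, by omega⟩
    · rintro ⟨⟨hS, hm⟩, hc⟩
      have := hm _ h2
      rw [List.toFinset_card_of_nodup h1] at this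
      have := h4 S hS
      exact ⟨hS, by omega⟩

end Multigraph
end Compression
end CountFVS

namespace CountFVS

/-! ### Symbolic evaluation with time bounds, and the program. -/

section Machine

namespace Data

theorem head_nil : head nil = nil := rfl

theorem tail_nil : tail nil = nil := rfl

theorem head_cons (a b : Data) : head (cons a b) = a := rfl

theorem tail_cons (a b : Data) : tail (cons a b) = b := rfl

end Data

/-- Function number `f` of the program `P` maps `x` to `y` in at most `T` steps. -/
def Fn (P : Program) (f : ℕ) (x y : Data) (T : ℕ) : Prop :=
  ∃ b t, P[f]? = some b ∧ Eval P [x] b y t ∧ t ≤ T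

/-- Symbolic evaluation: `wp P e env Q` implies that `e` evaluates to some value in a number of
steps such that the value and an upper bound for the number of steps satisfy `Q`. -/
def wp (P : Program) : Code → List Data → (Data → ℕ → Prop) → Prop
  | .var i, env, Q => Q (env.getD i .nil) 1
  | .nil, _, Q => Q .nil 1
  | .cons a b, env, Q => wp P a env fun v s => wp P b env fun w t => Q (.cons v w) (s + t + 1)
  | .head a, env, Q => wp P a env fun v s => Q v.head (s + 1)
  | .tail a, env, Q => wp P a env fun v s => Q v.tail (s + 1)
  | .ite c a b, env, Q => wp P c env fun v s =>
      match v with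
      | .nil => wp P b env fun w t => Q w (s + t + 1)
      | .cons _ _ => wp P a env fun w t => Q w (s + t + 1)
  | .bind a b, env, Q => wp P a env fun v s => wp P b (v :: env) fun w t => Q w (s + t + 1)
  | .call f a, env, Q => wp P a env fun v s => ∃ w T, Fn P f v w T ∧ Q w (s + T + 1)

/-- The time in `wp` is only an upper bound, because a call contributes the bound from its
specification. The evaluation itself still has an exact number of steps. -/
theorem wp_sound {P : Program} : ∀ {e : Code} {env : List Data} {Q : Data → ℕ → Prop},
    wp P e env Q → ∃ v t T, Eval P env e v t ∧ t ≤ T ∧ Q v T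
  | .var i, env, Q, h => ⟨_, _, _, .var env i, le_rfl, h⟩
  | .nil, env, Q, h => ⟨_, _, _, .nil env, le_rfl, h⟩
  | .cons a b, env, Q, h => by
    obtain ⟨v, t, T, h1, h2, h3⟩ := wp_sound (e := a) h
    obtain ⟨v', t', T', h1', h2', h3'⟩ := wp_sound (e := b) h3
    exact ⟨_, _, _, .cons h1 h1', by omega, h3'⟩
  | .head a, env, Q, h => by
    obtain ⟨v, t, T, h1, h2, h3⟩ := wp_sound (e := a) h
    exact ⟨_, _, _, .head h1, by omega, h3⟩
  | .tail a, env, Q, h => by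
    obtain ⟨v, t, T, h1, h2, h3⟩ := wp_sound (e := a) h
    exact ⟨_, _, _, .tail h1, by omega, h3⟩
  | .ite c a b, env, Q, h => by
    obtain ⟨v, t, T, h1, h2, h3⟩ := wp_sound (e := c) h
    cases v with
    | nil =>
      obtain ⟨v', t', T', h1', h2', h3'⟩ := wp_sound (e := b) h3
      exact ⟨_, _, _, .ite_nil h1 h1', by omega, h3'⟩
    | cons x y =>
      obtain ⟨v', t', T', h1', h2', h3'⟩ := wp_sound (e := a) h3
      exact ⟨_, _, _, .ite_cons h1 h1', by omega, h3'⟩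
  | .bind a b, env, Q, h => by
    obtain ⟨v, t, T, h1, h2, h3⟩ := wp_sound (e := a) h
    obtain ⟨v', t', T', h1', h2', h3'⟩ := wp_sound (e := b) h3
    exact ⟨_, _, _, .bind h1 h1', by omega, h3'⟩
  | .call f a, env, Q, h => by
    obtain ⟨v, t, T, h1, h2, w, T', ⟨b, t', h4, h5, h6⟩, h3⟩ := wp_sound (e := a) h
    exact ⟨_, _, _, .call h4 h1 h5, by omega, h3⟩

theorem wp_mono {P : Program} : ∀ {e : Code} {env : List Data} {Q Q' : Data → ℕ → Prop},
    wp P e env Q → (∀ v t, Q v t → Q' v t) → wp P e env Q'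
  | .var _, _, _, _, h, hQ => hQ _ _ h
  | .nil, _, _, _, h, hQ => hQ _ _ h
  | .cons a b, _, _, _, h, hQ => wp_mono (e := a) h fun _ _ h =>
      wp_mono (e := b) h fun _ _ h => hQ _ _ h
  | .head a, _, _, _, h, hQ => wp_mono (e := a) h fun _ _ h => hQ _ _ h
  | .tail a, _, _, _, h, hQ => wp_mono (e := a) h fun _ _ h => hQ _ _ h
  | .ite c a b, _, _, _, h, hQ => wp_mono (e := c) h fun v _ h => by
      cases v with
      | nil => exact wp_mono (e := b) h fun _ _ h => hQ _ _ h
      | cons _ _ => exact wp_mono (e := a) h fun _ _ h => hQ _ _ h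
  | .bind a b, _, _, _, h, hQ => wp_mono (e := a) h fun _ _ h =>
      wp_mono (e := b) h fun _ _ h => hQ _ _ h
  | .call _ a, _, _, _, h, hQ => wp_mono (e := a) h fun _ _ ⟨w, T, h1, h2⟩ =>
      ⟨w, T, h1, hQ _ _ h2⟩

theorem wp_of {P : Program} {e : Code} {env : List Data} {Q : Data → ℕ → Prop} {y : Data} {T : ℕ}
    (h : wp P e env fun v t => v = y ∧ t ≤ T) (hQ : ∀ t ≤ T, Q y t) : wp P e env Q :=
  wp_mono h fun _ t ⟨hv, ht⟩ => hv ▸ hQ t ht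

theorem Fn.of_wp {P : Program} {f : ℕ} {b : Code} {x y : Data} {T : ℕ} (hb : P[f]? = some b)
    (h : wp P b [x] fun v t => v = y ∧ t ≤ T) : Fn P f x y T := by
  obtain ⟨v, t, T', h1, h2, rfl, h3⟩ := wp_sound h
  exact ⟨b, t, hb, h1, h2.trans h3⟩

theorem Fn.mono {P : Program} {f : ℕ} {x y : Data} {T T' : ℕ} (h : Fn P f x y T) (hT : T ≤ T') :
    Fn P f x y T' :=
  let ⟨b, t, h1, h2, h3⟩ := h; ⟨b, t, h1, h2, h3.trans hT⟩

/-! ### The program -/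

/-- The `n`-fold second projection of a program expression. -/
def tl : ℕ → Code → Code
  | 0, c => c
  | n + 1, c => .tail (tl n c)

/-- Component `j` of the tuple that is the value of variable `i`. -/
def sel (i j : ℕ) : Code := .head (tl j (.var i))

/-- The last component, with number `j`, of the tuple that is the value of variable `i`. -/
def rst (i j : ℕ) : Code := tl j (.var i)

/-- The program expression for the truth value `true`. -/
def tt : Code := .cons .nil .nil

/-- The argument is `(k, A)`. -/
def mainBody : Code :=
  .bind (.call 2 (sel 0 0))
    (.bind (.call 3 (.cons (rst 1 1) .nil))
      (.tail (.call 21 (.cons (rst 2 1) (.cons (.var 1) (.var 0))))))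

/-- Concatenation of the lists `a` and `b`, given as `(a, b)`. -/
def appBody : Code :=
  .ite (sel 0 0)
    (.cons (.head (sel 0 0)) (.call 1 (.cons (.tail (sel 0 0)) (rst 0 1))))
    (rst 0 1)

/-- The unary representation of a number in binary. -/
def toUnBody : Code :=
  .ite (.var 0)
    (.bind (.call 2 (.tail (.var 0)))
      (.bind (.call 1 (.cons (.var 0) (.var 0)))
        (.ite (.head (.var 2)) (.cons .nil (.var 0)) (.var 0))))
    .nil

/-- The list of the vertices `i, i + 1, …`, one for every row in `(rows, i)`. -/
def vertsBody : Code :=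
  .ite (sel 0 0)
    (.cons (rst 0 1) (.call 3 (.cons (.tail (sel 0 0)) (.cons .nil (rst 0 1)))))
    .nil

/-- Member number `i` of the list `l`, given as `(l, i)`. -/
def getBody : Code :=
  .ite (rst 0 1) (.call 4 (.cons (.tail (sel 0 0)) (.tail (rst 0 1)))) (.head (sel 0 0))

/-- Equality of two unary numbers. -/
def eqBody : Code :=
  .ite (sel 0 0)
    (.ite (rst 0 1) (.call 5 (.cons (.tail (sel 0 0)) (.tail (rst 0 1)))) .nil)
    (.ite (rst 0 1) .nil tt)

/-- The multiplicity of the edge between `u` and `v`, given as `(A, u, v)`. -/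
def multBody : Code :=
  .call 4 (.cons (.call 4 (.cons (sel 0 0) (sel 0 1))) (rst 0 2))

/-- The function `nbrs`, for `(A, p, l)`. -/
def nbrsBody : Code :=
  .ite (rst 0 2)
    (.bind (.call 7 (.cons (sel 0 0) (.cons (sel 0 1) (.tail (rst 0 2)))))
      (.bind (.call 6 (.cons (sel 1 0) (.cons (sel 1 1) (.head (.head (rst 1 2))))))
        (.ite (.var 0)
          (.ite (.tail (.var 0))
            (.cons (.head (rst 2 2)) (.cons (.head (rst 2 2)) (.var 1)))
            (.cons (.head (rst 2 2)) (.var 1)))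
          (.var 1))))
    .nil

/-- Membership of `x` in the list `l`, given as `(x, l)`. -/
def memBody : Code :=
  .ite (rst 0 1)
    (.ite (.call 5 (.cons (sel 0 0) (.head (rst 0 1)))) tt
      (.call 8 (.cons (sel 0 0) (.tail (rst 0 1)))))
    .nil

/-- The items of the list `l` whose key is not in `w`, given as `(l, w)`. -/
def diffBody : Code :=
  .ite (sel 0 0)
    (.bind (.call 9 (.cons (.tail (sel 0 0)) (rst 0 1)))
      (.ite (.call 8 (.cons (.head (.head (sel 1 0))) (rst 1 1))) (.var 0)
        (.cons (.head (sel 1 0)) (.var 0))))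
    .nil

/-- The function `relabel`, for `(st, a, p)`. -/
def relabelBody : Code :=
  .ite (sel 0 0)
    (.bind (.head (sel 0 0))
      (.cons
        (.cons (sel 0 0) (.cons (sel 0 1)
          (.ite (.call 5 (.cons (rst 0 2) (sel 1 1))) (rst 1 2) (rst 0 2))))
        (.call 10 (.cons (.tail (sel 1 0)) (rst 1 1)))))
    .nil

/-- The expression for the exclusive disjunction of two truth values. -/
def xorCode (a b : Code) : Code := .ite a (.ite b .nil tt) (.ite b tt .nil)

/-- The sum of two numbers and a carry bit in binary, given as `(a, b, c)`. -/
def addBody : Code :=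
  .bind
    (.cons (xorCode (.head (sel 0 0)) (xorCode (.head (sel 0 1)) (rst 0 2)))
      (.cons (.tail (sel 0 0)) (.cons (.tail (sel 0 1))
        (.ite (.head (sel 0 0)) (.ite (.head (sel 0 1)) tt (rst 0 2))
          (.ite (.head (sel 0 1)) (rst 0 2) .nil)))))
    (.ite (sel 1 0) (.cons (sel 0 0) (.call 11 (rst 0 1)))
      (.ite (sel 1 1) (.cons (sel 0 0) (.call 11 (rst 0 1)))
        (.ite (rst 1 2) (.cons tt .nil) .nil)))

/-- The product of the length of a list and a number, given as `(cl, c)`. -/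
def mulBody : Code :=
  .ite (sel 0 0)
    (.call 11 (.cons (rst 0 1) (.cons (.call 12 (.cons (.tail (sel 0 0)) (rst 0 1))) .nil)))
    .nil

/-- Whether the first list of the pair is shorter than the second one. -/
def ltBody : Code :=
  .ite (rst 0 1)
    (.ite (sel 0 0) (.call 13 (.cons (.tail (sel 0 0)) (.tail (rst 0 1)))) tt)
    .nil

/-- The function `comb`. -/
def combBody : Code :=
  .ite (sel 0 0)
    (.ite (rst 0 1)
      (.ite (.call 13 (.cons (.head (sel 0 0)) (.head (rst 0 1)))) (sel 0 0)
        (.ite (.call 13 (.cons (.head (rst 0 1)) (.head (sel 0 0)))) (rst 0 1)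
          (.cons (.head (sel 0 0))
            (.call 11 (.cons (.tail (sel 0 0)) (.cons (.tail (rst 0 1)) .nil))))))
      (sel 0 0))
    (rst 0 1)

/-- The function `brk`. -/
def brkBody : Code :=
  .ite (rst 0 1)
    (.ite (sel 0 0)
      (.cons (.cons (.head (sel 0 0)) (.head (rst 0 1)))
        (.call 12 (.cons (sel 0 0) (.tail (rst 0 1)))))
      .nil)
    .nil

/-- The first branch of the function `link`, for the variables `e` and `(A, p, L, rest, st, k)`. -/
def linkBreakCode : Code :=
  .ite (sel 0 1)
    (.ite (rst 1 5)
      (.call 15 (.cons (sel 0 1)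
        (.call 16 (.cons (sel 1 0) (.cons (sel 1 1) (.cons (.tail (sel 1 2))
          (.cons (sel 1 3) (.cons (sel 1 4) (.tail (rst 1 5))))))))))
      .nil)
    .nil

/-- The second branch of the function `link`, for the variables `e` and
`(A, p, L, rest, st, k)`. -/
def linkKeepCode : Code :=
  .ite (.call 5 (.cons (rst 0 2) (sel 1 1))) .nil
    (.call 16 (.cons (sel 1 0) (.cons (sel 1 1)
      (.cons (.call 10 (.cons (.tail (sel 1 2)) (.cons (rst 0 2) (sel 1 1))))
        (.cons (sel 1 3)
          (.cons (.call 10 (.cons (sel 1 4) (.cons (rst 0 2) (sel 1 1))))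
            (rst 1 5)))))))

/-- The function `link`, for `(A, p, L, rest, st, k)`. -/
def linkBody : Code :=
  .ite (sel 0 2)
    (.bind (.head (sel 0 2)) (.call 14 (.cons linkBreakCode linkKeepCode)))
    (.call 17 (.cons (sel 0 0) (.cons (sel 0 3) (.cons (sel 0 4) (rst 0 5)))))

/-- The first branch of the function `proc`, for the variables `L` and `(A, todo, st, k)`. -/
def deleteCode : Code :=
  .ite (rst 1 3)
    (.call 15 (.cons (.cons (.head (.head (sel 1 1))) .nil)
      (.call 17 (.cons (sel 1 0) (.cons (.tail (sel 1 1)) (.cons (sel 1 2)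
        (.tail (rst 1 3))))))))
    .nil

/-- The branching step of the function `proc`, for the variables `L` and `(A, todo, st, k)`. -/
def branchCode : Code :=
  .call 14 (.cons deleteCode
    (.call 16 (.cons (sel 1 0) (.cons (.head (.head (sel 1 1))) (.cons (.var 0)
      (.cons (.tail (sel 1 1))
        (.cons (.cons (.cons (.head (.head (sel 1 1))) (.cons .nil (.head (.head (sel 1 1)))))
          (sel 1 2)) (rst 1 3))))))))

/-- The function `proc`, for `(A, todo, st, k)`. -/
def procBody : Code :=
  .ite (sel 0 1)
    (.bind (.call 7 (.cons (sel 0 0) (.cons (.head (.head (sel 0 1))) (sel 0 2))))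
      (.ite (.tail (.head (sel 1 1))) branchCode
        (.ite (.var 0)
          (.ite (.tail (.var 0)) branchCode
            (.call 17 (.cons (sel 1 0) (.cons (.tail (sel 1 1))
              (.cons
                (.cons (.cons (.head (.head (sel 1 1)))
                    (.cons (.cons (.head (.head (sel 1 1))) (.head (.tail (.head (.var 0)))))
                      (.tail (.tail (.head (.var 0))))))
                  (sel 1 2))
                (rst 1 3))))))
          (.call 17 (.cons (sel 1 0) (.cons (.tail (sel 1 1)) (rst 1 2)))))))
    (.cons .nil (.cons tt .nil))

/-- The function `findLeaf`, for `(A, all, l)`. -/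
def findLeafBody : Code :=
  .ite (rst 0 2)
    (.ite (.tail (.call 7 (.cons (sel 0 0) (.cons (.head (.head (rst 0 2))) (sel 0 1)))))
      (.call 18 (.cons (sel 0 0) (.cons (sel 0 1) (.tail (rst 0 2)))))
      (.head (rst 0 2)))
    .nil

/-- The function `order`, for `(A, n, l)` where `n` is represented by a list of this length. -/
def orderBody : Code :=
  .ite (sel 0 1)
    (.bind (.call 18 (.cons (sel 0 0) (.cons (rst 0 2) (rst 0 2))))
      (.ite (.var 0)
        (.cons (.var 0)
          (.call 19 (.cons (sel 1 0) (.cons (.tail (sel 1 1))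
            (.call 9 (.cons (rst 1 2) (.cons (.head (.var 0)) .nil)))))))
        .nil))
    .nil

/-- The items `(x, z)` for the members `x` of the list `w`, followed by `l`, for `(w, z, l)`. -/
def markBody : Code :=
  .ite (sel 0 0)
    (.cons (.cons (.head (sel 0 0)) (sel 0 1))
      (.call 20 (.cons (.tail (sel 0 0)) (rst 0 1))))
    (rst 0 2)

/-- The function `solve`, for `(A, k, vs)`. -/
def solveBody : Code :=
  .ite (rst 0 2)
    (.bind (.call 21 (.cons (sel 0 0) (.cons (sel 0 1) (.tail (rst 0 2)))))
      (.ite (.var 0)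
        (.call 17 (.cons (sel 1 0) (.cons
          (.cons (.cons (.head (rst 1 2)) tt)
            (.call 20 (.cons (.head (.var 0)) (.cons tt
              (.call 19 (.cons (sel 1 0) (.cons (.tail (rst 1 2))
                (.call 9 (.cons
                  (.call 20 (.cons (.tail (rst 1 2)) (.cons .nil .nil)))
                  (.head (.var 0)))))))))))
          (.cons .nil (sel 1 1)))))
        .nil))
    (.cons .nil (.cons tt .nil))

/-- The program that counts the minimum feedback vertex sets. -/
def prog : Program :=
  [mainBody, appBody, toUnBody, vertsBody, getBody, eqBody, multBody, nbrsBody, memBody, diffBody,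
    relabelBody, addBody, mulBody, ltBody, combBody, brkBody, linkBody, procBody, findLeafBody,
    orderBody, markBody, solveBody]

end Machine
end CountFVS

namespace CountFVS

set_option linter.unusedSimpArgs false

/-! ### Arithmetic and lists on the machine. -/

section BasicFunctions

/-- The unary representation of a number. -/
def un : ℕ → Data
  | 0 => .nil
  | n + 1 => .cons .nil (un n)

/-- The representation of a list whose members are represented by `f`. -/
def dList {α : Type*} (f : α → Data) (l : List α) : Data := Data.ofList (l.map f)

theorem dList_nil {α : Type*} (f : α → Data) : dList f [] = .nil := rfl

theorem dList_cons {α : Type*} (f : α → Data) (a : α) (l : List α) :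
    dList f (a :: l) = .cons (f a) (dList f l) := rfl

theorem ofNat_zero : Data.ofNat 0 = .nil := by simp [Data.ofNat, Data.ofList]

theorem ofNat_bit (b : Bool) (n : ℕ) (h : n = 0 → b = true) :
    Data.ofNat (Nat.bit b n) = .cons (Data.ofBool b) (Data.ofNat n) := by
  rw [Data.ofNat, Nat.bits_append_bit n b h]
  rfl

theorem ofNat_of_ne_zero {m : ℕ} (h : m ≠ 0) :
    Data.ofNat m = .cons (Data.ofBool (m % 2 == 1)) (Data.ofNat (m / 2)) := by
  conv_lhs => rw [show m = Nat.bit (m % 2 == 1) (m / 2) by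
    rw [Nat.bit_val]; rcases Nat.mod_two_eq_zero_or_one m with h | h <;> simp [h] <;> omega]
  refine ofNat_bit _ _ fun h0 => ?_
  have : m % 2 = 1 := by omega
  simp [this]

theorem ofNat_head (m : ℕ) : (Data.ofNat m).head = Data.ofBool (m % 2 == 1) := by
  by_cases h : m = 0
  · subst h; rw [ofNat_zero]; rfl
  · rw [ofNat_of_ne_zero h]; rfl

theorem ofNat_tail (m : ℕ) : (Data.ofNat m).tail = Data.ofNat (m / 2) := by
  by_cases h : m = 0
  · subst h; simp [ofNat_zero, Data.tail]
  · rw [ofNat_of_ne_zero h]; rfl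

theorem fn_append : ∀ a b : ℕ, Fn prog 1 (.cons (un a) (un b)) (un (a + b)) (20 * (a + 1))
  | 0, b => by
    refine Fn.of_wp rfl ?_
    simp [wp, appBody, sel, rst, tl, un, Data.head_cons, Data.tail_cons, Data.head_nil, Data.tail_nil]
  | a + 1, b => by
    refine Fn.of_wp rfl ?_
    simp only [wp, appBody, sel, rst, tl, un, Data.head_cons, Data.tail_cons, Data.head_nil, Data.tail_nil, List.getD_cons_zero]
    refine ⟨_, _, fn_append a b, ?_, by omega⟩
    rw [show a + 1 + b = (a + b) + 1 by omega, un]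

/-- The unary form of `m / 2` is doubled by concatenation. The cost is linear in `m`, hence
exponential in the number of bits, which is affordable for the budget since `k < 26 ^ k`. -/
theorem fn_toUn : ∀ m : ℕ, Fn prog 2 (Data.ofNat m) (un m) (100 * m + 20) := by
  intro m
  induction m using Nat.strong_induction_on with
  | _ m ih =>
    refine Fn.of_wp rfl ?_
    by_cases h : m = 0
    · subst h
      simp [wp, toUnBody, ofNat_zero, un]
    · rw [ofNat_of_ne_zero h]
      simp only [wp, toUnBody, Data.head_cons, Data.tail_cons, Data.head_nil, Data.tail_nil, List.getD_cons_zero, List.getD_cons_succ]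
      refine ⟨_, _, ih (m / 2) (by omega), _, _, fn_append _ _, ?_⟩
      rcases Nat.mod_two_eq_zero_or_one m with h2 | h2
      · simp only [h2, Data.ofBool]
        refine ⟨?_, by omega⟩
        congr 1; omega
      · simp only [h2, Data.ofBool]
        refine ⟨?_, by omega⟩
        change un (_ + 1) = un m
        congr 1; omega

theorem fn_verts : ∀ (rows : List Data) (i : ℕ),
    Fn prog 3 (.cons (.ofList rows) (un i)) (dList un (List.range' i rows.length))
      (20 * (rows.length + 1))
  | [], i => by
    refine Fn.of_wp rfl ?_
    simp [wp, vertsBody, sel, tl, Data.ofList, Data.head_cons, dList]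
  | r :: rows, i => by
    refine Fn.of_wp rfl ?_
    simp only [wp, vertsBody, sel, rst, tl, Data.ofList, Data.head_cons, Data.tail_cons, Data.head_nil, Data.tail_nil, List.getD_cons_zero]
    refine ⟨_, _, fn_verts rows (i + 1), ?_, ?_⟩
    · rw [List.length_cons, List.range'_succ, dList_cons]
    · rw [List.length_cons]; omega

theorem fn_get : ∀ (l : List Data) (i : ℕ) (h : i < l.length),
    Fn prog 4 (.cons (.ofList l) (un i)) l[i] (20 * (i + 1))
  | a :: l, 0, h => by
    refine Fn.of_wp rfl ?_
    simp [wp, getBody, sel, rst, tl, Data.ofList, Data.head_cons, Data.tail_cons, Data.head_nil, Data.tail_nil, un]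
  | a :: l, i + 1, h => by
    refine Fn.of_wp rfl ?_
    simp only [wp, getBody, sel, rst, tl, Data.ofList, Data.head_cons, Data.tail_cons, Data.head_nil, Data.tail_nil, un,
      List.getD_cons_zero]
    exact ⟨_, _, fn_get l i (by simpa using h), by simp, by omega⟩

theorem fn_eq : ∀ i j : ℕ,
    Fn prog 5 (.cons (un i) (un j)) (.ofBool (i == j)) (20 * (i + 1))
  | 0, 0 => by
    refine Fn.of_wp rfl ?_
    simp [wp, eqBody, sel, rst, tl, tt, Data.head_cons, Data.tail_cons, Data.head_nil, Data.tail_nil, un, Data.ofBool]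
  | 0, j + 1 => by
    refine Fn.of_wp rfl ?_
    simp [wp, eqBody, sel, rst, tl, Data.head_cons, Data.tail_cons, Data.head_nil, Data.tail_nil, un, Data.ofBool]
  | i + 1, 0 => by
    refine Fn.of_wp rfl ?_
    simp [wp, eqBody, sel, rst, tl, Data.head_cons, Data.tail_cons, Data.head_nil, Data.tail_nil, un, Data.ofBool]
    omega
  | i + 1, j + 1 => by
    refine Fn.of_wp rfl ?_
    simp only [wp, eqBody, sel, rst, tl, Data.head_cons, Data.tail_cons, Data.head_nil, Data.tail_nil, un, List.getD_cons_zero]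
    exact ⟨_, _, fn_eq i j, by simp, by omega⟩

theorem fn_add : ∀ (s a b : ℕ) (c : Bool), a < 2 ^ s → b < 2 ^ s →
    Fn prog 11 (.cons (.ofNat a) (.cons (.ofNat b) (.ofBool c))) (.ofNat (a + b + c.toNat))
      (80 * (s + 1)) := by
  intro s
  induction s with
  | zero =>
    intro a b c ha hb
    obtain rfl : a = 0 := by simpa using ha
    obtain rfl : b = 0 := by simpa using hb
    refine Fn.of_wp rfl ?_
    cases c
    · simp [wp, addBody, xorCode, sel, rst, tl, tt, Data.head_cons, Data.tail_cons, Data.head_nil, Data.tail_nil, ofNat_zero, Data.ofBool]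
    · have : Data.ofNat 1 = .cons (.cons .nil .nil) .nil := by
        rw [ofNat_of_ne_zero one_ne_zero, show 1 / 2 = 0 from rfl, ofNat_zero]; rfl
      simp [wp, addBody, xorCode, sel, rst, tl, tt, Data.head_cons, Data.tail_cons, Data.head_nil, Data.tail_nil, ofNat_zero, Data.ofBool,
        this]
  | succ s ih =>
    intro a b c ha hb
    -- If both numbers are exhausted, the program does not recurse, and the answer depends on the
    -- carry alone.
    by_cases h0 : a = 0 ∧ b = 0
    · obtain ⟨rfl, rfl⟩ := h0
      exact (ih 0 0 c (by positivity) (by positivity)).mono (by omega)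
    · refine Fn.of_wp rfl ?_
      have ha2 : a / 2 < 2 ^ s := by rw [pow_succ] at ha; omega
      have hb2 : b / 2 < 2 ^ s := by rw [pow_succ] at hb; omega
      set m := a + b + c.toNat with hm
      have hm0 : m ≠ 0 := by omega
      set carry : Bool := (a % 2 + b % 2 + c.toNat) / 2 == 1 with hcarry
      have hrec := ih (a / 2) (b / 2) carry ha2 hb2
      have hc : carry.toNat = (a % 2 + b % 2 + c.toNat) / 2 := by
        have := c.toNat_le
        have h3 : (a % 2 + b % 2 + c.toNat) / 2 = 0 ∨ (a % 2 + b % 2 + c.toNat) / 2 = 1 := by omega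
        rcases h3 with h3 | h3 <;> simp [hcarry, h3]
      have hsum : a / 2 + b / 2 + carry.toNat = m / 2 := by rw [hc]; omega
      rw [hsum] at hrec
      have hbit : (m % 2 == 1) = ((a % 2 == 1) ^^ ((b % 2 == 1) ^^ c)) := by
        have h3 : m % 2 = (a % 2 + b % 2 + c.toNat) % 2 := by omega
        rw [h3]
        rcases Nat.mod_two_eq_zero_or_one a with h1 | h1 <;>
        rcases Nat.mod_two_eq_zero_or_one b with h2 | h2 <;> cases c <;> simp [h1, h2]
      have hcar : carry = if (a % 2 == 1) then ((b % 2 == 1) || c) else ((b % 2 == 1) && c) := by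
        rw [hcarry]
        rcases Nat.mod_two_eq_zero_or_one a with h1 | h1 <;>
        rcases Nat.mod_two_eq_zero_or_one b with h2 | h2 <;> cases c <;> simp [h1, h2]
      rw [ofNat_of_ne_zero hm0, hbit]
      rw [hcar] at hrec
      simp only [wp, addBody, xorCode, sel, rst, tl, tt, List.getD_cons_zero, List.getD_cons_succ,
        Data.head_cons, Data.tail_cons, Data.head_nil, Data.tail_nil, ofNat_head, ofNat_tail]
      generalize (a % 2 == 1) = x at hrec ⊢
      generalize (b % 2 == 1) = y at hrec ⊢
      -- The body asks first for bits of `a`, then for bits of `b`. In both cases it recurses on the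
      -- halves.
      have hab : (∃ u v, Data.ofNat a = .cons u v) ∨
          Data.ofNat a = .nil ∧ ∃ u v, Data.ofNat b = .cons u v := by
        by_cases h : a = 0
        · right
          subst h
          exact ⟨ofNat_zero, _, _, ofNat_of_ne_zero fun hb => h0 ⟨rfl, hb⟩⟩
        · exact Or.inl ⟨_, _, ofNat_of_ne_zero h⟩
      rcases hab with ⟨u, v, ha⟩ | ⟨ha, u, v, hb⟩
      · rw [ha]
        cases x <;> cases y <;> cases c <;>
          exact ⟨_, _, hrec, rfl, by omega⟩
      · rw [ha, hb]
        cases x <;> cases y <;> cases c <;>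
          exact ⟨_, _, hrec, rfl, by omega⟩

theorem fn_mul {α : Type*} (f : α → Data) {s c : ℕ} : ∀ l : List α, l.length * c < 2 ^ s →
    c < 2 ^ s →
    Fn prog 12 (.cons (dList f l) (.ofNat c)) (.ofNat (l.length * c))
      ((l.length + 1) * (80 * (s + 1) + 30))
  | [], _, _ => by
    refine Fn.of_wp rfl ?_
    simp [wp, mulBody, sel, tl, Data.head_cons, Data.head_nil, dList_nil, ofNat_zero]
  | a :: l, h, hc => by
    rw [List.length_cons, add_mul, one_mul] at h
    have ih := fn_mul f (s := s) (c := c) l (by omega) hc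
    have hadd := fn_add s c (l.length * c) false hc (by omega)
    refine Fn.of_wp rfl ?_
    simp only [wp, mulBody, sel, rst, tl, List.getD_cons_zero, Data.head_cons, Data.tail_cons, Data.head_nil, Data.tail_nil, dList_cons]
    refine ⟨_, _, ih, _, _, hadd, ?_, ?_⟩
    · rw [List.length_cons]
      congr 1
      simp [add_mul, add_comm]
    · rw [List.length_cons, add_mul (_ + 1) 1, one_mul]
      omega

theorem fn_lt {α β : Type*} (f : α → Data) (g : β → Data) : ∀ (l : List α) (l' : List β),
    Fn prog 13 (.cons (dList f l) (dList g l')) (.ofBool (decide (l.length < l'.length)))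
      (20 * (l.length + 1))
  | [], [] => by
    refine Fn.of_wp rfl ?_
    simp [wp, ltBody, rst, tl, Data.tail_cons, Data.tail_nil, dList_nil, Data.ofBool]
  | [], _ :: _ => by
    refine Fn.of_wp rfl ?_
    simp [wp, ltBody, sel, rst, tl, tt, Data.head_cons, Data.tail_cons, Data.head_nil, Data.tail_nil, dList_nil, dList_cons, Data.ofBool]
  | _ :: l, [] => by
    refine Fn.of_wp rfl ?_
    simp [wp, ltBody, rst, tl, Data.tail_cons, Data.tail_nil, dList_nil, Data.ofBool]
    omega
  | a :: l, b :: l' => by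
    refine Fn.of_wp rfl ?_
    simp only [wp, ltBody, sel, rst, tl, Data.head_cons, Data.tail_cons, Data.head_nil, Data.tail_nil, dList_cons, List.getD_cons_zero]
    refine ⟨_, _, fn_lt f g l l', by simp, ?_⟩
    rw [List.length_cons]
    omega

theorem fn_mark {α : Type*} (f : α → Data) (g : α × Bool → Data)
    (hg : ∀ x z, g (x, z) = .cons (f x) (.ofBool z)) (z : Bool) (l : List (α × Bool)) :
    ∀ w : List α, Fn prog 20 (.cons (dList f w) (.cons (.ofBool z) (dList g l)))
      (dList g (w.map (fun x => (x, z)) ++ l)) (30 * (w.length + 1))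
  | [] => by
    refine Fn.of_wp rfl ?_
    simp [wp, markBody, sel, rst, tl, Data.head_cons, Data.tail_cons, Data.head_nil, Data.tail_nil, dList_nil]
  | a :: w => by
    refine Fn.of_wp rfl ?_
    simp only [wp, markBody, sel, rst, tl, Data.head_cons, Data.tail_cons, Data.head_nil, Data.tail_nil, dList_cons, List.getD_cons_zero]
    refine ⟨_, _, fn_mark f g hg z l w, ?_, ?_⟩
    · rw [List.map_cons, List.cons_append, dList_cons, hg]
    · rw [List.length_cons]
      omega

end BasicFunctions

/-! ### The graph operations and operations on results on the machine. -/

section GraphFunctions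

variable {n : ℕ}

/-- The representation of a vertex. -/
def dV (v : Fin n) : Data := un v

/-- The representation of a graph by its adjacency matrix. -/
def dGraph (G : Multigraph (Fin n)) : Data :=
  Data.ofList (List.ofFn fun u : Fin n =>
    Data.ofList (List.ofFn fun v : Fin n => Data.ofNat (G.mult s(u, v))))

/-- The representation of an entry of a state. -/
def dEntry (e : Entry (Fin n)) : Data := .cons (dV e.1) (.cons (dList dV e.2.1) (dV e.2.2))

/-- The representation of a marked vertex. -/
def dItem (x : Fin n × Bool) : Data := .cons (dV x.1) (.ofBool x.2)

/-- The representation of a result. -/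
def dRes : Res (Fin n) → Data
  | none => .nil
  | some (w, c) => .cons (dList dV w) (.ofNat c)

theorem fn_eqV (u v : Fin n) :
    Fn prog 5 (.cons (dV u) (dV v)) (.ofBool (u == v)) (20 * (n + 1)) := by
  have := fn_eq u v
  have h : ((u : ℕ) == (v : ℕ)) = (u == v) := by
    rw [Bool.eq_iff_iff]; simp [Fin.ext_iff]
  rw [h] at this
  exact this.mono (by have := u.2; omega)

theorem fn_mult (G : Multigraph (Fin n)) (u v : Fin n) :
    Fn prog 6 (.cons (dGraph G) (.cons (dV u) (dV v))) (.ofNat (G.mult s(u, v)))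
      (60 * (n + 1)) := by
  refine Fn.of_wp rfl ?_
  simp only [wp, multBody, sel, rst, tl, Data.head_cons, Data.tail_cons, Data.head_nil, Data.tail_nil, List.getD_cons_zero]
  have h1 := fn_get (List.ofFn fun u : Fin n =>
    Data.ofList (List.ofFn fun v : Fin n => Data.ofNat (G.mult s(u, v)))) u (by simp)
  have h2 := fn_get (List.ofFn fun v : Fin n => Data.ofNat (G.mult s(u, v))) v (by simp)
  simp only [List.getElem_ofFn, Fin.eta] at h1 h2
  have := u.2
  have := v.2
  exact ⟨_, _, h1, _, _, h2, rfl, by omega⟩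

theorem nbrs_cons {V α : Type*} [DecidableEq V] (G : Multigraph V) (p : V) (e : V × α)
    (l : List (V × α)) :
    G.nbrs p (e :: l) = List.replicate (min 2 (G.mult s(p, e.1))) e ++ G.nbrs p l := by
  simp [Multigraph.nbrs]

theorem fn_nbrs {α : Type*} (G : Multigraph (Fin n)) (p : Fin n) (f : Fin n × α → Data)
    (hf : ∀ e, (f e).head = dV e.1) : ∀ l : List (Fin n × α),
    Fn prog 7 (.cons (dGraph G) (.cons (dV p) (dList f l))) (dList f (G.nbrs p l))
      ((l.length + 1) * (150 * (n + 1)))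
  | [] => by
    refine Fn.of_wp rfl ?_
    simp [wp, nbrsBody, rst, tl, Data.tail_cons, Data.tail_nil, dList_nil, Multigraph.nbrs]
    omega
  | e :: l => by
    refine Fn.of_wp rfl ?_
    simp only [wp, nbrsBody, sel, rst, tl, Data.head_cons, Data.tail_cons, Data.head_nil, Data.tail_nil, List.getD_cons_zero,
      List.getD_cons_succ, dList_cons, hf]
    refine ⟨_, _, fn_nbrs G p f hf l, _, _, fn_mult G p e.1, ?_⟩
    rw [nbrs_cons, List.length_cons, add_mul (_ + 1) 1, one_mul]
    -- Zero has no bits, one has a single bit, and every larger number has at least two. Inspecting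
    -- the first two cells yields `min 2` of the multiplicity at constant cost.
    match hm : G.mult s(p, e.1) with
    | 0 =>
      rw [ofNat_zero]
      exact ⟨by simp, by omega⟩
    | 1 =>
      rw [ofNat_of_ne_zero one_ne_zero, show (1 / 2) = 0 from rfl, ofNat_zero]
      exact ⟨rfl, by omega⟩
    | m + 2 =>
      rw [ofNat_of_ne_zero (by omega), ofNat_of_ne_zero (m := (m + 2) / 2) (by omega)]
      refine ⟨?_, by omega⟩
      rw [show min 2 (m + 2) = 2 by omega]
      rfl

theorem fn_mem (x : Fin n) : ∀ l : List (Fin n),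
    Fn prog 8 (.cons (dV x) (dList dV l)) (.ofBool (decide (x ∈ l)))
      ((l.length + 1) * (40 * (n + 1)))
  | [] => by
    refine Fn.of_wp rfl ?_
    simp [wp, memBody, rst, tl, Data.tail_cons, Data.tail_nil, dList_nil, Data.ofBool]
    omega
  | y :: l => by
    refine Fn.of_wp rfl ?_
    simp only [wp, memBody, sel, rst, tl, tt, Data.head_cons, Data.tail_cons, Data.head_nil, Data.tail_nil, List.getD_cons_zero, dList_cons]
    refine ⟨_, _, fn_eqV x y, ?_⟩
    rw [List.length_cons, add_mul (_ + 1) 1, one_mul]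
    by_cases h : x = y
    · subst h
      simp only [BEq.rfl, Data.ofBool]
      exact ⟨by simp [Data.ofBool], by omega⟩
    · rw [show (x == y) = false by simpa using h]
      simp only [Data.ofBool]
      refine ⟨_, _, fn_mem x l, ?_, by omega⟩
      simp [h, Data.ofBool]

theorem fn_diff {α : Type*} (f : Fin n × α → Data) (hf : ∀ e, (f e).head = dV e.1)
    {w : List (Fin n)} (hw : w.length ≤ n) : ∀ l : List (Fin n × α),
    Fn prog 9 (.cons (dList f l) (dList dV w)) (dList f (l.filter fun x => x.1 ∉ w))
      ((l.length + 1) * (80 * (n + 1) ^ 2))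
  | [] => by
    refine Fn.of_wp rfl ?_
    have : 0 < (n + 1) ^ 2 := by positivity
    simp [wp, diffBody, sel, tl, Data.head_cons, Data.head_nil, dList_nil]
    omega
  | e :: l => by
    refine Fn.of_wp rfl ?_
    have hpos : 0 < (n + 1) ^ 2 := by positivity
    have hle : (w.length + 1) * (40 * (n + 1)) ≤ 40 * (n + 1) ^ 2 := by
      calc _ ≤ (n + 1) * (40 * (n + 1)) := Nat.mul_le_mul_right _ (by omega)
        _ = _ := by ring
    simp only [wp, diffBody, sel, rst, tl, Data.head_cons, Data.tail_cons, Data.head_nil, Data.tail_nil, List.getD_cons_zero,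
      List.getD_cons_succ, dList_cons, hf]
    refine ⟨_, _, fn_diff f hf hw l, _, _, fn_mem e.1 w, ?_⟩
    rw [List.length_cons, add_mul (_ + 1) 1, one_mul]
    by_cases h : e.1 ∈ w
    · simp only [h, decide_true, Data.ofBool]
      exact ⟨by simp [h], by omega⟩
    · simp only [h, decide_false, Data.ofBool]
      exact ⟨by simp [h, dList_cons], by omega⟩

theorem fn_relabel (a p : Fin n) : ∀ st : List (Entry (Fin n)),
    Fn prog 10 (.cons (dList dEntry st) (.cons (dV a) (dV p))) (dList dEntry (relabel a p st))
      ((st.length + 1) * (80 * (n + 1)))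
  | [] => by
    refine Fn.of_wp rfl ?_
    simp [wp, relabelBody, sel, tl, Data.head_cons, Data.head_nil, dList_nil, relabel]
    omega
  | e :: st => by
    refine Fn.of_wp rfl ?_
    simp only [wp, relabelBody, sel, rst, tl, Data.head_cons, Data.tail_cons, Data.head_nil, Data.tail_nil, List.getD_cons_zero,
      List.getD_cons_succ, dList_cons, dEntry]
    refine ⟨_, _, fn_eqV e.2.2 a, ?_⟩
    rw [List.length_cons, add_mul (_ + 1) 1, one_mul]
    by_cases h : e.2.2 = a
    · rw [show (e.2.2 == a) = true by simpa using h]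
      simp only [Data.ofBool]
      refine ⟨_, _, fn_relabel a p st, ?_, by omega⟩
      simp only [relabel, List.map_cons, dList_cons, dEntry, if_pos h]
    · rw [show (e.2.2 == a) = false by simpa using h]
      simp only [Data.ofBool]
      refine ⟨_, _, fn_relabel a p st, ?_, by omega⟩
      simp only [relabel, List.map_cons, dList_cons, dEntry, if_neg h]

/-- Bounds for the length of the witness and for the number of a result. -/
def ResBound (s : ℕ) : Res (Fin n) → Prop
  | none => True
  | some (w, c) => w.length ≤ s ∧ c < 2 ^ s

theorem fn_comb {s : ℕ} {r r' : Res (Fin n)} (h : ResBound s r) (h' : ResBound s r') :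
    Fn prog 14 (.cons (dRes r) (dRes r')) (dRes (comb r r')) (200 * (s + 1)) := by
  refine Fn.of_wp rfl ?_
  match r, r', h, h' with
  | none, r', _, _ =>
    simp [wp, combBody, sel, rst, tl, Data.head_cons, Data.tail_cons, Data.head_nil, Data.tail_nil, dRes, comb]
    omega
  | some (w, c), none, _, _ =>
    simp [wp, combBody, sel, rst, tl, Data.head_cons, Data.tail_cons, Data.head_nil, Data.tail_nil, dRes, comb]
    omega
  | some (w, c), some (w', c'), h, h' =>
    obtain ⟨h1, h2⟩ := h
    obtain ⟨h3, h4⟩ := h'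
    simp only [wp, combBody, sel, rst, tl, Data.head_cons, Data.tail_cons, Data.head_nil, Data.tail_nil, dRes, comb, List.getD_cons_zero]
    refine ⟨_, _, fn_lt dV dV w w', ?_⟩
    by_cases hlt : w.length < w'.length
    · simp only [hlt, decide_true, Data.ofBool, if_true]
      exact ⟨trivial, by omega⟩
    · simp only [hlt, decide_false, Data.ofBool, if_false]
      refine ⟨_, _, fn_lt dV dV w' w, ?_⟩
      by_cases hgt : w'.length < w.length
      · simp only [hgt, decide_true, Data.ofBool, if_true]
        exact ⟨trivial, by omega⟩
      · simp only [hgt, decide_false, Data.ofBool, if_false]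
        exact ⟨_, _, fn_add s c c' false h2 h4, rfl, by omega⟩

theorem fn_brk {s : ℕ} {cl : List (Fin n)} {r : Res (Fin n)} (hcl : cl.length ≤ n)
    (hr : ResBound s r) :
    Fn prog 15 (.cons (dList dV cl) (dRes r)) (dRes (brk cl r))
      ((n + 1) * (120 * (s + n + 1))) := by
  refine Fn.of_wp rfl ?_
  have hpos : 120 * (s + n + 1) ≤ (n + 1) * (120 * (s + n + 1)) := Nat.le_mul_of_pos_left _ (by omega)
  match r, cl, hcl, hr with
  | none, _, _, _ =>
    simp [wp, brkBody, rst, tl, Data.tail_cons, Data.tail_nil, dRes, brk]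
    omega
  | some (w, c), [], _, _ =>
    simp [wp, brkBody, sel, rst, tl, Data.head_cons, Data.tail_cons, Data.head_nil, Data.tail_nil, dRes, brk, dList_nil]
    omega
  | some (w, c), v :: cl, hcl, hr =>
    -- A class has at most `n ≤ 2 ^ n` members, so the product needs at most `n` bits more.
    have hlt : (v :: cl).length * c < 2 ^ (s + n) := by
      calc _ < (v :: cl).length * 2 ^ s := Nat.mul_lt_mul_of_pos_left hr.2 (by simp)
        _ ≤ 2 ^ n * 2 ^ s := Nat.mul_le_mul_right _ (hcl.trans Nat.lt_two_pow_self.le)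
        _ = _ := by rw [← pow_add, add_comm]
    have hc : c < 2 ^ (s + n) := hr.2.trans_le (Nat.pow_le_pow_right (by omega) (by omega))
    have hm := fn_mul dV (v :: cl) hlt hc
    simp only [wp, brkBody, sel, rst, tl, Data.head_cons, Data.tail_cons, Data.head_nil, Data.tail_nil, dRes, brk, dList_cons,
      List.getD_cons_zero] at hm ⊢
    refine ⟨_, _, hm, rfl, ?_⟩
    have : ((v :: cl).length + 1) * (80 * (s + n + 1) + 30) ≤
      (n + 1) * (80 * (s + n + 1) + 30) := Nat.mul_le_mul_right _ (by omega)
    have e : (n + 1) * (120 * (s + n + 1)) =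
      (n + 1) * (80 * (s + n + 1) + 30) + (n + 1) * (40 * (s + n + 1) - 30) := by
      rw [← mul_add]; congr 1; omega
    have : 40 * (s + n + 1) - 30 ≤ (n + 1) * (40 * (s + n + 1) - 30) :=
      Nat.le_mul_of_pos_left _ (by omega)
    simp only [List.length_cons] at *
    omega

end GraphFunctions
end CountFVS

namespace CountFVS

set_option linter.unusedSimpArgs false

/-! ### Cost of the leaf order. -/

section Ordering

variable {n : ℕ}

/-- The representation of an optional marked vertex. -/
def dOption : Option (Fin n × Bool) → Data
  | none => .nil
  | some x => dItem x

theorem fn_nbrs_le {α : Type*} (G : Multigraph (Fin n)) (p : Fin n) (f : Fin n × α → Data)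
    (hf : ∀ e, (f e).head = dV e.1) {l : List (Fin n × α)} (hl : l.length ≤ n) :
    Fn prog 7 (.cons (dGraph G) (.cons (dV p) (dList f l))) (dList f (G.nbrs p l))
      (150 * (n + 1) ^ 2) := by
  refine (fn_nbrs G p f hf l).mono ?_
  calc _ ≤ (n + 1) * (150 * (n + 1)) := Nat.mul_le_mul_right _ (by omega)
    _ = _ := by ring

theorem fn_findLeaf (G : Multigraph (Fin n)) {all : List (Fin n × Bool)} (hall : all.length ≤ n) :
    ∀ l : List (Fin n × Bool),
    Fn prog 18 (.cons (dGraph G) (.cons (dList dItem all) (dList dItem l)))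
      (dOption (G.findLeaf all l)) ((l.length + 1) * (200 * (n + 1) ^ 2))
  | [] => by
    refine Fn.of_wp rfl ?_
    have : 0 < (n + 1) ^ 2 := by positivity
    simp [wp, findLeafBody, rst, tl, Data.tail_cons, Data.tail_nil, dList_nil, dOption,
      Multigraph.findLeaf]
    omega
  | x :: l => by
    refine Fn.of_wp rfl ?_
    have hpos : 0 < (n + 1) ^ 2 := by positivity
    simp only [wp, findLeafBody, sel, rst, tl, Data.head_cons, Data.tail_cons, Data.head_nil,
      Data.tail_nil, List.getD_cons_zero, dList_cons]
    refine ⟨_, _, fn_nbrs_le G x.1 dItem (fun _ => rfl) hall, ?_⟩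
    rw [List.length_cons, add_mul (_ + 1) 1, one_mul, Multigraph.findLeaf]
    match G.nbrs x.1 all with
    | [] => exact ⟨rfl, by omega⟩
    | [_] => exact ⟨rfl, by omega⟩
    | _ :: _ :: _ =>
      exact ⟨_, _, fn_findLeaf G hall l, by simp, by omega⟩

theorem fn_order {α : Type*} (f : α → Data) (G : Multigraph (Fin n)) :
    ∀ (fuel : List α) (l : List (Fin n × Bool)), l.length ≤ n →
    Fn prog 19 (.cons (dGraph G) (.cons (dList f fuel) (dList dItem l)))
      (dList dItem (G.order fuel.length l)) ((fuel.length + 1) * (400 * (n + 1) ^ 3))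
  | [], l, _ => by
    refine Fn.of_wp rfl ?_
    have : 0 < (n + 1) ^ 3 := by positivity
    simp [wp, orderBody, sel, tl, Data.head_cons, Data.head_nil, Data.tail_cons, dList_nil,
      Multigraph.order]
    omega
  | a :: fuel, l, hl => by
    refine Fn.of_wp rfl ?_
    have hpos : 0 < (n + 1) ^ 3 := by positivity
    have h1 : (l.length + 1) * (200 * (n + 1) ^ 2) ≤ 200 * (n + 1) ^ 3 := by
      calc _ ≤ (n + 1) * (200 * (n + 1) ^ 2) := Nat.mul_le_mul_right _ (by omega)
        _ = _ := by ring
    have h2 : (l.length + 1) * (80 * (n + 1) ^ 2) ≤ 80 * (n + 1) ^ 3 := by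
      calc _ ≤ (n + 1) * (80 * (n + 1) ^ 2) := Nat.mul_le_mul_right _ (by omega)
        _ = _ := by ring
    simp only [wp, orderBody, sel, rst, tl, Data.head_cons, Data.tail_cons, Data.head_nil,
      Data.tail_nil, List.getD_cons_zero, List.getD_cons_succ, dList_cons]
    refine ⟨_, _, fn_findLeaf G hl l, ?_⟩
    rw [List.length_cons, add_mul (_ + 1) 1, one_mul, Multigraph.order]
    match G.findLeaf l l with
    | none => exact ⟨rfl, by omega⟩
    | some x =>
      have hx : [x.1].length ≤ n := by have := x.1.2; simp; omega
      refine ⟨_, _, fn_diff dItem (fun _ => rfl) hx l, _, _,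
        fn_order f G fuel (l.filter fun y => y.1 ∉ [x.1]) ?_, rfl, ?_⟩
      · exact (List.length_filter_le _ _).trans hl
      · omega

end Ordering

/-! ### The measure and the cost of branching on edges. -/

section BranchingCost

variable {n : ℕ}

/-- The number of labels that occur in a state. -/
def numLabels (st : List (Entry (Fin n))) : ℕ := (st.map fun e => e.2.2).toFinset.card

/-- The bound for the number of leaves of the search tree, for budget `k`, with `c` components and
`j` marked vertices. -/
def leafBound (k c j : ℕ) : ℕ := 7 ^ k * 2 ^ c * 3 ^ j

/-- The improvement, in units of `1 / 196`, for a new component with some remaining edges. -/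
def linkWeight : ℕ → ℕ
  | 0 => 196
  | 1 => 126
  | _ => 81

/-- The weights are `14 * 14`, `14 * 9` and `9 * 9`: each pending edge gains a factor `9 / 14 = 1 /
7 + 1 / 2`. The gain of two edges suffices, so the weight is constant from there on. -/
theorem linkWeight_succ (m : ℕ) : 9 * linkWeight m ≤ 14 * linkWeight (m + 1) := by
  match m with
  | 0 => simp [linkWeight]
  | 1 => simp [linkWeight]
  | m + 2 => simp [linkWeight]

theorem le_linkWeight (m : ℕ) : 81 ≤ linkWeight m := by
  match m with
  | 0 => simp [linkWeight]
  | 1 => simp [linkWeight]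
  | m + 2 => simp [linkWeight]

theorem linkWeight_le (m : ℕ) : linkWeight m ≤ 196 := by
  match m with
  | 0 => simp [linkWeight]
  | 1 => simp [linkWeight]
  | m + 2 => simp [linkWeight]

theorem leafBound_pos (k c j : ℕ) : 0 < leafBound k c j := by unfold leafBound; positivity

theorem leafBound_mono {k c c' j : ℕ} (h : c ≤ c') : leafBound k c j ≤ leafBound k c' j := by
  unfold leafBound
  gcongr
  norm_num

theorem leafBound_succ_left (k c j : ℕ) : leafBound (k + 1) c j = 7 * leafBound k c j := by
  unfold leafBound; ring

theorem leafBound_succ_mid (k c j : ℕ) : leafBound k (c + 1) j = 2 * leafBound k c j := by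
  unfold leafBound; ring

theorem leafBound_succ_right (k c j : ℕ) : leafBound k c (j + 1) = 3 * leafBound k c j := by
  unfold leafBound; ring

/-- `F₁` is the bound after a deletion, a seventh of `F`, and `F₂` that after a merger, half of `F`.
The increment of the height `h` pays for the local work `D`. -/
theorem link_arith {B D h w w' F F₁ F₂ T₁ T₂ : ℕ} (h1 : 196 * T₁ ≤ B * h * (w' * F₁))
    (h2 : 196 * T₂ ≤ B * h * (w' * F₂)) (hF₁ : 7 * F₁ ≤ F) (hF₂ : 2 * F₂ ≤ F)
    (hw : 9 * w' ≤ 14 * w) (hD : 196 * D ≤ B * (w * F)) :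
    196 * (D + T₁ + T₂) ≤ B * (h + 1) * (w * F) := by
  have h3 : w' * F₁ + w' * F₂ ≤ w * F := by
    have e1 : 14 * (w' * F₁ + w' * F₂) ≤ w' * (9 * F) := by
      calc _ = w' * (14 * F₁ + 14 * F₂) := by ring
        _ ≤ _ := Nat.mul_le_mul_left _ (by omega)
    have e2 : w' * (9 * F) ≤ 14 * (w * F) := by
      calc _ = 9 * w' * F := by ring
        _ ≤ 14 * w * F := Nat.mul_le_mul_right _ hw
        _ = _ := by ring
    omega
  have h4 : B * h * (w' * F₁) + B * h * (w' * F₂) ≤ B * h * (w * F) := by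
    rw [← mul_add]
    exact Nat.mul_le_mul_left _ h3
  have h5 : B * (h + 1) * (w * F) = B * h * (w * F) + B * (w * F) := by ring
  omega

/-- Here `F₁` belongs to the deletion of the vertex, and `F₂`, in units of `1 / 196`, to keeping it.
-/
theorem branch_arith {B D h F F₁ F₂ T₁ T₂ : ℕ} (h1 : T₁ ≤ B * h * F₁)
    (h2 : 196 * T₂ ≤ B * h * F₂) (hF : 196 * F₁ + F₂ ≤ 196 * F) (hD : D ≤ B * F) :
    D + T₁ + T₂ ≤ B * (h + 1) * F := by
  have h3 : B * h * (196 * F₁) + B * h * F₂ ≤ B * h * (196 * F) := by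
    rw [← mul_add]
    exact Nat.mul_le_mul_left _ hF
  have h4 : B * h * (196 * F₁) = 196 * (B * h * F₁) := by ring
  have h5 : B * h * (196 * F) = 196 * (B * h * F) := by ring
  have h6 : B * (h + 1) * F = B * h * F + B * F := by ring
  omega

/-- The label `a` disappears and `p` was in use before. -/
theorem numLabels_relabel {st : List (Entry (Fin n))} {a p : Fin n} (hap : a ≠ p)
    (ha : ∃ e ∈ st, e.2.2 = a) (hp : ∃ e ∈ st, e.2.2 = p) :
    numLabels (relabel a p st) + 1 ≤ numLabels st := by
  have hsub : ((relabel a p st).map fun e => e.2.2).toFinset ⊆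
      ((st.map fun e => e.2.2).toFinset).erase a := by
    intro x hx
    simp only [relabel, List.map_map, List.mem_toFinset, List.mem_map, Function.comp_apply] at hx
    obtain ⟨e, he, rfl⟩ := hx
    rw [Finset.mem_erase, List.mem_toFinset, List.mem_map]
    split_ifs with h
    · exact ⟨hap.symm, hp⟩
    · exact ⟨h, e, he, rfl⟩
  have hmem : a ∈ (st.map fun e => e.2.2).toFinset := by
    rw [List.mem_toFinset, List.mem_map]
    exact ha
  have h1 := Finset.card_le_card hsub
  rw [Finset.card_erase_of_mem hmem] at h1
  have h2 := Finset.card_pos.2 ⟨a, hmem⟩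
  unfold numLabels
  omega

theorem numLabels_cons_le (e : Entry (Fin n)) (st : List (Entry (Fin n))) :
    numLabels (e :: st) ≤ numLabels st + 1 := by
  unfold numLabels
  rw [List.map_cons, List.toFinset_cons]
  exact Finset.card_insert_le _ _

theorem numLabels_cons_of_mem {e : Entry (Fin n)} {st : List (Entry (Fin n))}
    (h : ∃ e' ∈ st, e'.2.2 = e.2.2) : numLabels (e :: st) = numLabels st := by
  unfold numLabels
  rw [List.map_cons, List.toFinset_cons, Finset.insert_eq_of_mem]
  rw [List.mem_toFinset, List.mem_map]
  exact h

theorem IsRes.resBound {k : ℕ} {F : Finset (Fin n) → Prop} {r : Res (Fin n)} (h : IsRes k F r) :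
    ResBound (n + 1) r := by
  match r, h with
  | none, _ => trivial
  | some (w, c), h =>
    constructor
    · have := h.1.length_le_card
      rw [Fintype.card_fin] at this
      omega
    · have := h.count_le
      rw [Fintype.card_fin] at this
      rw [pow_succ]
      have : 0 < 2 ^ n := by positivity
      omega

theorem ResBound.mono {s s' : ℕ} {r : Res (Fin n)} (h : ResBound s r) (hs : s ≤ s') :
    ResBound s' r := by
  match r, h with
  | none, _ => trivial
  | some (w, c), h => exact ⟨h.1.trans hs, h.2.trans_le (Nat.pow_le_pow_right (by omega) hs)⟩

theorem ResBound.brk {s : ℕ} {r : Res (Fin n)} (h : ResBound s r) {cl : List (Fin n)}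
    (hcl : cl.length ≤ n) : ResBound (s + n) (brk cl r) := by
  match r, cl, h, hcl with
  | none, _, _, _ => trivial
  | some (w, c), [], _, _ => trivial
  | some (w, c), v :: cl, h, hcl =>
    constructor
    · have := h.1
      simp only [List.length_cons] at *
      omega
    · calc _ < (v :: cl).length * 2 ^ s := Nat.mul_lt_mul_of_pos_left h.2 (by simp)
        _ ≤ 2 ^ n * 2 ^ s := Nat.mul_le_mul_right _ (hcl.trans Nat.lt_two_pow_self.le)
        _ = _ := by rw [← pow_add, add_comm]

theorem Multigraph.Inv.length_le {G : Multigraph (Fin n)} {L : List (Fin n)}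
    {todo : List (Fin n × Bool)} {st : List (Entry (Fin n))} (h : G.Inv L todo st) :
    st.length ≤ n := by
  have := h.keys.length_le_card
  rwa [List.length_map, Fintype.card_fin] at this

theorem length_nbrs_le {α : Type*} (G : Multigraph (Fin n)) (p : Fin n) :
    ∀ l : List (Fin n × α), (G.nbrs p l).length ≤ 2 * l.length
  | [] => by simp [Multigraph.nbrs]
  | e :: l => by
    have := length_nbrs_le G p l
    rw [nbrs_cons, List.length_append, List.length_replicate, List.length_cons]
    omega

/-- The argument of the function `link`. -/
def linkArg (G : Multigraph (Fin n)) (p : Fin n) (L : List (Entry (Fin n)))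
    (rest : List (Fin n × Bool)) (st : List (Entry (Fin n))) (k : ℕ) : Data :=
  .cons (dGraph G) (.cons (dV p) (.cons (dList dEntry L) (.cons (dList dItem rest)
    (.cons (dList dEntry st) (un k)))))

/-- The argument of the function `proc`. -/
def procArg (G : Multigraph (Fin n)) (todo : List (Fin n × Bool)) (st : List (Entry (Fin n)))
    (k : ℕ) : Data :=
  .cons (dGraph G) (.cons (dList dItem todo) (.cons (dList dEntry st) (un k)))

theorem fn_comb_le {r r' : Res (Fin n)} (h : ResBound (n + 1 + n) r)
    (h' : ResBound (n + 1 + n) r') :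
    Fn prog 14 (.cons (dRes r) (dRes r')) (dRes (comb r r')) (400 * (n + 1) ^ 2) := by
  refine (fn_comb h h').mono ?_
  have : n + 1 ≤ (n + 1) ^ 2 := Nat.le_self_pow (by norm_num) _
  omega

theorem fn_brk_le {cl : List (Fin n)} {r : Res (Fin n)} (hcl : cl.length ≤ n)
    (hr : ResBound (n + 1) r) :
    Fn prog 15 (.cons (dList dV cl) (dRes r)) (dRes (brk cl r)) (240 * (n + 1) ^ 2) := by
  refine (fn_brk hcl hr).mono ?_
  have : (n + 1) * (120 * (n + 1 + n + 1)) = 240 * (n + 1) ^ 2 := by ring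
  omega

theorem fn_relabel_le (a p : Fin n) {st : List (Entry (Fin n))} (h : st.length ≤ 2 * n) :
    Fn prog 10 (.cons (dList dEntry st) (.cons (dV a) (dV p))) (dList dEntry (relabel a p st))
      (160 * (n + 1) ^ 2) := by
  refine (fn_relabel a p st).mono ?_
  calc _ ≤ (2 * (n + 1)) * (80 * (n + 1)) := Nat.mul_le_mul_right _ (by omega)
    _ = _ := by ring

/-- Cutting a class lowers the budget and merging lowers the number of components, so `link_arith`
applies with a seventh and a half of the bound. A branch without a recursive call is charged with
`0`. -/
theorem fn_link {G : Multigraph (Fin n)} {rest : List (Fin n × Bool)} {p : Fin n} {h j : ℕ}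
    (hcont : ∀ st k, G.Inv [] rest st → ∃ T,
      Fn prog 17 (procArg G rest st k) (dRes (G.proc rest st k)) T ∧
        T ≤ 4500 * (n + 1) ^ 2 * h * leafBound k (numLabels st) j)
    (hpt : p ∉ rest.map Prod.fst) :
    ∀ (m : ℕ) (L st : List (Entry (Fin n))) (k : ℕ), L.length = m → L.length ≤ 2 * n → L ⊆ st →
      (p, [], p) ∈ st → G.Inv (L.map Prod.fst) rest st → ∃ T,
        Fn prog 16 (linkArg G p L rest st k) (dRes (link (G.proc rest) p L st k)) T ∧
          196 * T ≤ 4500 * (n + 1) ^ 2 * (h + 1 + L.length) *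
            (linkWeight L.length * leafBound k (numLabels st) j) := by
  intro m
  have hpos : 0 < (n + 1) ^ 2 := by positivity
  have hnn : n + 1 ≤ (n + 1) ^ 2 := Nat.le_self_pow (by norm_num) _
  -- The least weight `81` still covers the local work: `196 * 1500 ≤ 4500 * 81`.
  have hD : ∀ w F : ℕ, 81 ≤ w → 0 < F →
      196 * (1500 * (n + 1) ^ 2) ≤ 4500 * (n + 1) ^ 2 * (w * F) := by
    intro w F hw hF
    have h1 : 81 ≤ w * F := hw.trans (Nat.le_mul_of_pos_right _ hF)
    have := Nat.mul_le_mul_left (4500 * (n + 1) ^ 2) h1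
    omega
  induction m with
  | zero =>
    intro L st k hm _ _ _ hinv
    rw [List.length_eq_zero_iff] at hm
    subst hm
    obtain ⟨T, hT, hT'⟩ := hcont st k hinv
    refine ⟨50 + T, Fn.of_wp rfl ?_, ?_⟩
    · simp only [wp, linkBody, linkArg, sel, rst, tl, Data.head_cons, Data.tail_cons,
        List.getD_cons_zero, dList_nil]
      rw [link]
      exact ⟨_, _, hT, rfl, by omega⟩
    · have hd := hD 81 _ le_rfl (leafBound_pos k (numLabels st) j)
      have e : 4500 * (n + 1) ^ 2 * (h + 1 + ([] : List (Entry (Fin n))).length) *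
          (linkWeight ([] : List (Entry (Fin n))).length * leafBound k (numLabels st) j) =
          196 * (4500 * (n + 1) ^ 2 * h * leafBound k (numLabels st) j) +
          4500 * (n + 1) ^ 2 * (196 * leafBound k (numLabels st) j) := by
        simp only [List.length_nil, linkWeight]; ring
      rw [e]
      have : 4500 * (n + 1) ^ 2 * (81 * leafBound k (numLabels st) j) ≤
          4500 * (n + 1) ^ 2 * (196 * leafBound k (numLabels st) j) :=
        Nat.mul_le_mul_left _ (Nat.mul_le_mul_right _ (by norm_num))
      omega
  | succ m ih =>
    intro L st k hm hL2 hLst hp hinv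
    match L, hm with
    | (y, cl, a) :: L, hm =>
    have hm' : L.length = m := by simpa using hm
    have hy : (y, cl, a) ∈ st := hLst (by simp)
    have hLst' : L ⊆ st := fun e he => hLst (List.mem_cons_of_mem _ he)
    have hinv' : G.Inv (L.map Prod.fst) rest st := hinv.tail
    have hL2' : L.length ≤ 2 * n := by rw [List.length_cons] at hL2; omega
    have hst := hinv.length_le
    have hcl : cl.length ≤ n := by
      have := (hinv.class_nodup _ hy).length_le_card
      rwa [Fintype.card_fin] at this
    set env : List Data := [dEntry (y, cl, a), linkArg G p ((y, cl, a) :: L) rest st k] with henv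
    set r₁ : Res (Fin n) := if cl = [] then none else
        match k with
        | 0 => none
        | k + 1 => brk cl (link (G.proc rest) p L st k) with hr₁
    set r₂ : Res (Fin n) := if a = p then none else
        link (G.proc rest) p (relabel a p L) (relabel a p st) k with hr₂
    have hbreak : ∃ T₁ F₁, wp prog linkBreakCode env
          (fun v t => v = dRes r₁ ∧ t ≤ 300 * (n + 1) ^ 2 + T₁) ∧
        196 * T₁ ≤ 4500 * (n + 1) ^ 2 * (h + 1 + L.length) * (linkWeight L.length * F₁) ∧
        7 * F₁ ≤ leafBound k (numLabels st) j ∧ ResBound (n + 1 + n) r₁ := by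
      by_cases hc : cl = []
      · refine ⟨0, 0, ?_, by simp, by simp, ?_⟩
        · simp only [wp, linkBreakCode, henv, dEntry, sel, rst, tl, Data.head_cons, Data.tail_cons,
            List.getD_cons_zero, hc, dList_nil, hr₁, if_true]
          exact ⟨rfl, by omega⟩
        · rw [hr₁, if_pos hc]; trivial
      · obtain ⟨v, cl', hv⟩ := List.exists_cons_of_ne_nil hc
        cases k with
        | zero =>
          refine ⟨0, 0, ?_, by simp, by simp, ?_⟩
          · simp only [wp, linkBreakCode, henv, dEntry, linkArg, sel, rst, tl, Data.head_cons,
              Data.tail_cons, List.getD_cons_zero, List.getD_cons_succ, hv, dList_cons, hr₁, un]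
            exact ⟨rfl, by omega⟩
          · rw [hr₁, if_neg hc]; trivial
        | succ k =>
          obtain ⟨T, hT, hT'⟩ := ih L st k hm' hL2' hLst' hp hinv'
          have hres := (G.isRes_link (G.isRes_proc rest) hpt _ L st k rfl hLst' hp hinv').resBound
          refine ⟨T, leafBound k (numLabels st) j, ?_, hT', (leafBound_succ_left _ _ _).ge, ?_⟩
          · have hb := fn_brk_le hcl hres
            rw [hr₁, if_neg hc]
            subst hv
            simp only [wp, linkBreakCode, henv, dEntry, linkArg, sel, rst, tl, Data.head_cons,
              Data.tail_cons, List.getD_cons_zero, List.getD_cons_succ, dList_cons, un] at hT hb ⊢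
            exact ⟨_, _, hT, _, _, hb, rfl, by omega⟩
          · rw [hr₁, if_neg hc]; exact hres.brk hcl
    have hkeep : ∃ T₂ F₂, wp prog linkKeepCode env
          (fun v t => v = dRes r₂ ∧ t ≤ 400 * (n + 1) ^ 2 + T₂) ∧
        196 * T₂ ≤ 4500 * (n + 1) ^ 2 * (h + 1 + L.length) * (linkWeight L.length * F₂) ∧
        2 * F₂ ≤ leafBound k (numLabels st) j ∧ ResBound (n + 1 + n) r₂ := by
      have heq := fn_eqV a p
      by_cases hap : a = p
      · refine ⟨0, 0, ?_, by simp, by simp, ?_⟩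
        · rw [show (a == p) = true by simpa using hap] at heq
          simp only [wp, linkKeepCode, henv, dEntry, linkArg, sel, rst, tl, Data.head_cons,
            Data.tail_cons, List.getD_cons_zero, List.getD_cons_succ, hr₂, if_pos hap]
          exact ⟨_, _, heq, rfl, by omega⟩
        · rw [hr₂, if_pos hap]; trivial
      · have hmap : (relabel a p L).map Prod.fst = L.map Prod.fst := by simp [relabel]
        have hp' : (p, [], p) ∈ relabel a p st := List.mem_map.2 ⟨_, hp, by simp⟩
        have hrinv := hinv'.relabel (a := a) hpt
        rw [← hmap] at hrinv
        have hlen := length_relabel a p L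
        have hsub : relabel a p L ⊆ relabel a p st := List.map_subset _ hLst'
        obtain ⟨T, hT, hT'⟩ := ih (relabel a p L) (relabel a p st) k (by omega) (by omega)
          hsub hp' hrinv
        have hres := (G.isRes_link (G.isRes_proc rest) hpt _ (relabel a p L) (relabel a p st) k
          rfl hsub hp' hrinv).resBound
        refine ⟨T, leafBound k (numLabels (relabel a p st)) j, ?_, by rwa [hlen] at hT', ?_, ?_⟩
        · rw [show (a == p) = false by simpa using hap] at heq
          rw [hr₂, if_neg hap]
          have hr1 := fn_relabel_le a p hL2'
          have hr2 := fn_relabel_le (st := st) a p (by omega)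
          simp only [wp, linkKeepCode, henv, dEntry, linkArg, sel, rst, tl, Data.head_cons,
            Data.tail_cons, List.getD_cons_zero, List.getD_cons_succ, dList_cons] at hT ⊢
          exact ⟨_, _, heq, _, _, hr1, _, _, hr2, _, _, hT, rfl, by omega⟩
        · rw [← leafBound_succ_mid]
          exact leafBound_mono (numLabels_relabel hap ⟨_, hy, rfl⟩ ⟨_, hp, rfl⟩)
        · rw [hr₂, if_neg hap]; exact hres.mono (by omega)
    obtain ⟨T₁, F₁, hw₁, hT₁, hF₁, hb₁⟩ := hbreak
    obtain ⟨T₂, F₂, hw₂, hT₂, hF₂, hb₂⟩ := hkeep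
    refine ⟨1500 * (n + 1) ^ 2 + T₁ + T₂, Fn.of_wp rfl ?_, ?_⟩
    · have hc := fn_comb_le hb₁ hb₂
      have hl : link (G.proc rest) p ((y, cl, a) :: L) st k = comb r₁ r₂ := by
        rw [hr₁, hr₂, link_cons]
        cases k <;> rfl
      rw [hl]
      simp only [linkBody, wp, linkArg, sel, rst, tl, Data.head_cons, Data.tail_cons,
        List.getD_cons_zero, dList_cons]
      refine wp_of hw₁ fun t₁ ht₁ => wp_of hw₂ fun t₂ ht₂ => ⟨_, _, hc, rfl, by omega⟩
    · have := link_arith hT₁ hT₂ hF₁ hF₂ (linkWeight_succ L.length)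
        (hD _ _ (le_linkWeight _) (leafBound_pos _ _ _))
      rw [List.length_cons]
      exact this

end BranchingCost
end CountFVS

namespace CountFVS

set_option linter.unusedSimpArgs false

/-! ### Cost of a compression step and of the whole algorithm. -/

section MainCost

variable {n : ℕ}

theorem ofNat_one : Data.ofNat 1 = .cons (.cons .nil .nil) .nil := by
  rw [ofNat_of_ne_zero one_ne_zero, show 1 / 2 = 0 from rfl, ofNat_zero]; rfl

/-- The cost of the branching step of the function `proc`. -/
theorem wp_branchCode {G : Multigraph (Fin n)} {rest : List (Fin n × Bool)} {p : Fin n} {z : Bool}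
    {h j : ℕ} (hcont : ∀ st k, G.Inv [] rest st → ∃ T,
      Fn prog 17 (procArg G rest st k) (dRes (G.proc rest st k)) T ∧
        T ≤ 4500 * (n + 1) ^ 2 * h * leafBound k (numLabels st) j)
    {st : List (Entry (Fin n))} {k : ℕ} (hinv : G.Inv [] ((p, z) :: rest) st)
    (hb : z = true ∨ 2 ≤ (G.nbrs p st).length) {F : ℕ}
    (hF : 196 * leafBound k (numLabels st) j +
      7 * (linkWeight (G.nbrs p st).length * (2 * leafBound k (numLabels st) j)) ≤ 7 * (196 * F)) :
    ∃ T, wp prog branchCode [dList dEntry (G.nbrs p st), procArg G ((p, z) :: rest) st k]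
        (fun v t => v = dRes (G.proc ((p, z) :: rest) st k) ∧ t + 200 * (n + 1) ^ 2 ≤ T) ∧
      T ≤ 4500 * (n + 1) ^ 2 * (h + 2 * n + 2) * F := by
  have hpos : 0 < (n + 1) ^ 2 := by positivity
  obtain ⟨hpt, -, -, -⟩ := hinv.fresh
  have hk := hinv.keep
  have hst := hinv.length_le
  have hL : (G.nbrs p st).length ≤ 2 * n := by
    have := length_nbrs_le G p st
    omega
  have hsub : G.nbrs p st ⊆ (p, [], p) :: st :=
    fun e he => List.mem_cons_of_mem _ (Multigraph.mem_nbrs.1 he).1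
  have hF0 : 0 < F := by
    rcases Nat.eq_zero_or_pos F with h0 | h0
    · have := leafBound_pos k (numLabels st) j
      subst h0
      omega
    · exact h0
  set env : List Data := [dList dEntry (G.nbrs p st), procArg G ((p, z) :: rest) st k] with henv
  set r₁ : Res (Fin n) := match k with
    | 0 => none
    | k + 1 => brk [p] (G.proc rest st k) with hr₁
  set r₂ : Res (Fin n) := link (G.proc rest) p (G.nbrs p st) ((p, [], p) :: st) k with hr₂
  have hdel : ∃ T₁ F₁, wp prog deleteCode env
        (fun v t => v = dRes r₁ ∧ t ≤ 300 * (n + 1) ^ 2 + T₁) ∧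
      T₁ ≤ 4500 * (n + 1) ^ 2 * h * F₁ ∧ 7 * F₁ ≤ leafBound k (numLabels st) j ∧
        ResBound (n + 1 + n) r₁ := by
    cases k with
    | zero =>
      refine ⟨0, 0, ?_, by simp, by simp, trivial⟩
      simp only [wp, deleteCode, henv, procArg, sel, rst, tl, Data.head_cons,
        Data.tail_cons, List.getD_cons_zero, List.getD_cons_succ, hr₁, un]
      exact ⟨rfl, by omega⟩
    | succ k =>
      obtain ⟨T, hT, hT'⟩ := hcont st k hinv.skip
      have hres := (G.isRes_proc rest st k hinv.skip).resBound
      have hcl : [p].length ≤ n := by have := p.2; simp; omega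
      have hbk := fn_brk_le hcl hres
      refine ⟨T, leafBound k (numLabels st) j, ?_, hT', (leafBound_succ_left _ _ _).ge,
        hres.brk hcl⟩
      simp only [wp, deleteCode, henv, procArg, sel, rst, tl, Data.head_cons, dItem, dList_nil,
        Data.tail_cons, List.getD_cons_zero, List.getD_cons_succ, hr₁, un, dList_cons] at hT hbk ⊢
      exact ⟨_, _, hT, _, _, hbk, rfl, by omega⟩
  obtain ⟨T₁, F₁, hw₁, hT₁, hF₁, hb₁⟩ := hdel
  obtain ⟨T₂, hT₂, hT₂'⟩ := fn_link hcont hpt _ (G.nbrs p st) ((p, [], p) :: st) k rfl hL hsub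
    (by simp) hk
  have hb₂ : ResBound (n + 1 + n) r₂ :=
    ((G.isRes_link (G.isRes_proc rest) hpt _ (G.nbrs p st) ((p, [], p) :: st) k
      rfl hsub (by simp) hk).resBound).mono (by omega)
  have hc := fn_comb_le hb₁ hb₂
  refine ⟨1500 * (n + 1) ^ 2 + T₁ + T₂, ?_, ?_⟩
  · have hp : G.proc ((p, z) :: rest) st k = comb r₁ r₂ := by
      rw [hr₁, hr₂, Multigraph.proc_cons_of_branch hb]
      cases k <;> rfl
    rw [hp]
    simp only [branchCode, wp]
    refine wp_of hw₁ fun t₁ ht₁ => ?_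
    simp only [linkArg, henv, procArg, sel, rst, tl, Data.head_cons, dItem, dList_nil, dEntry,
        Data.tail_cons, List.getD_cons_zero, List.getD_cons_succ, dList_cons] at hT₂ ⊢
    exact ⟨_, _, hT₂, _, _, hc, rfl, by omega⟩
  · have hT₁' : T₁ ≤ 4500 * (n + 1) ^ 2 * (h + 2 * n + 1) * F₁ :=
      hT₁.trans (Nat.mul_le_mul_right _ (Nat.mul_le_mul_left _ (by omega)))
    -- Keeping `p` creates at most one new component, which accounts for the factor `2`. There are
    -- at most `2 * n` pending edges, as every entry occurs at most twice among them.
    have hT₂'' : 196 * T₂ ≤ 4500 * (n + 1) ^ 2 * (h + 2 * n + 1) *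
        (linkWeight (G.nbrs p st).length * (2 * leafBound k (numLabels st) j)) := by
      refine hT₂'.trans (Nat.mul_le_mul (Nat.mul_le_mul_left _ (by omega))
        (Nat.mul_le_mul_left _ ?_))
      rw [← leafBound_succ_mid]
      exact leafBound_mono (numLabels_cons_le _ _)
    refine branch_arith hT₁' hT₂'' (by omega) ?_
    have := Nat.mul_le_mul_left (4500 * (n + 1) ^ 2) hF0
    omega

/-- A vertex adds at most `2 * n + 2` levels to the search tree, one or two for itself and one for
each pending edge. The cost is the work per node times depth times the number of leaves. -/
theorem fn_proc {G : Multigraph (Fin n)} : ∀ (todo : List (Fin n × Bool))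
    (st : List (Entry (Fin n))) (k : ℕ), G.Inv [] todo st → ∃ T,
      Fn prog 17 (procArg G todo st k) (dRes (G.proc todo st k)) T ∧
        T ≤ 4500 * (n + 1) ^ 2 * (todo.length * (2 * n + 2) + 1) *
          leafBound k (numLabels st) (todo.countP (·.2)) := by
  have hpos : 0 < (n + 1) ^ 2 := by positivity
  intro todo
  induction todo with
  | nil =>
    intro st k _
    refine ⟨20, Fn.of_wp rfl ?_, ?_⟩
    · simp [wp, procBody, procArg, sel, tl, tt, Data.head_cons, Data.tail_cons, dList_nil,
        Multigraph.proc, dRes, ofNat_one]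
    · have h1 := Nat.mul_le_mul_left (4500 * (n + 1) ^ 2) (leafBound_pos k (numLabels st) 0)
      simp only [List.length_nil, List.countP_nil, zero_mul, zero_add, mul_one]
      omega
  | cons pz rest ih =>
    obtain ⟨p, z⟩ := pz
    intro st k hinv
    have hst := hinv.length_le
    have hnb := fn_nbrs_le G p dEntry (fun _ => rfl) hst
    have hlen : ((p, z) :: rest).length * (2 * n + 2) + 1 =
        rest.length * (2 * n + 2) + 1 + 2 * n + 2 := by rw [List.length_cons]; ring
    rw [hlen]
    by_cases hb : z = true ∨ 2 ≤ (G.nbrs p st).length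
    -- For an unmarked vertex, with at least two edges, this is `196 + 7 * 81 * 2 ≤ 7 * 196`; for a
    -- marked one it is `196 + 7 * 196 * 2 ≤ 7 * 196 * 3`.
    · have hF : 196 * leafBound k (numLabels st) (rest.countP (·.2)) +
          7 * (linkWeight (G.nbrs p st).length *
            (2 * leafBound k (numLabels st) (rest.countP (·.2)))) ≤
          7 * (196 * leafBound k (numLabels st) (((p, z) :: rest).countP (·.2))) := by
        cases z with
        | false =>
          have hl : 2 ≤ (G.nbrs p st).length := by simpa using hb
          obtain ⟨m, hm⟩ : ∃ m, (G.nbrs p st).length = m + 2 := ⟨_, (Nat.sub_add_cancel hl).symm⟩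
          rw [hm]
          simp only [linkWeight, List.countP_cons, Bool.false_eq_true, if_false, add_zero]
          omega
        | true =>
          have hw := Nat.mul_le_mul_right (2 * leafBound k (numLabels st) (rest.countP (·.2)))
            (linkWeight_le (G.nbrs p st).length)
          simp only [List.countP_cons, if_true, leafBound_succ_right]
          omega
      obtain ⟨T, hw, hT⟩ := wp_branchCode ih hinv hb hF
      refine ⟨T, Fn.of_wp rfl ?_, hT⟩
      simp only [wp, procBody, procArg, sel, rst, tl, Data.head_cons, Data.tail_cons,
        List.getD_cons_zero, List.getD_cons_succ, dList_cons, dItem]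
      refine ⟨_, _, hnb, ?_⟩
      simp only [procArg, dList_cons, dItem] at hw
      cases z with
      | true =>
        simp only [Data.ofBool] at hw ⊢
        exact wp_mono hw fun v t ⟨h1, h2⟩ => ⟨h1, by omega⟩
      | false =>
        have hl : 2 ≤ (G.nbrs p st).length := by simpa using hb
        match hL : G.nbrs p st with
        | [] => rw [hL] at hl; simp at hl
        | [_] => rw [hL] at hl; simp at hl
        | e :: e' :: L =>
          rw [hL] at hw
          simp only [Data.ofBool, dList_cons, Data.tail_cons] at hw ⊢
          exact wp_mono hw fun v t ⟨h1, h2⟩ => ⟨h1, by omega⟩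
    · push Not at hb
      have hz : z = false := by simpa using hb.1
      subst hz
      simp only [List.countP_cons, Bool.false_eq_true, if_false, add_zero]
      have hfin : ∀ T F, T ≤ 4500 * (n + 1) ^ 2 * (rest.length * (2 * n + 2) + 1) * F → 0 < F →
          300 * (n + 1) ^ 2 + T ≤
            4500 * (n + 1) ^ 2 * (rest.length * (2 * n + 2) + 1 + 2 * n + 2) * F := by
        intro T F hT hF
        have h1 : 4500 * (n + 1) ^ 2 * (rest.length * (2 * n + 2) + 1 + 1) * F ≤
            4500 * (n + 1) ^ 2 * (rest.length * (2 * n + 2) + 1 + 2 * n + 2) * F :=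
          Nat.mul_le_mul_right _ (Nat.mul_le_mul_left _ (by omega))
        have h2 : 4500 * (n + 1) ^ 2 * (rest.length * (2 * n + 2) + 1 + 1) * F =
          4500 * (n + 1) ^ 2 * (rest.length * (2 * n + 2) + 1) * F +
            4500 * (n + 1) ^ 2 * F := by ring
        have h3 := Nat.mul_le_mul_left (4500 * (n + 1) ^ 2) hF
        omega
      match hL : G.nbrs p st with
      | [] =>
        obtain ⟨T, hT, hT'⟩ := ih st k hinv.skip
        refine ⟨300 * (n + 1) ^ 2 + T, Fn.of_wp rfl ?_, hfin T _ hT' (leafBound_pos _ _ _)⟩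
        rw [Multigraph.proc_cons_of_nil hL]
        rw [hL] at hnb
        simp only [wp, procBody, procArg, sel, rst, tl, Data.head_cons, Data.tail_cons,
          List.getD_cons_zero, List.getD_cons_succ, dList_cons, dItem] at hT ⊢
        refine ⟨_, _, hnb, ?_⟩
        simp only [Data.ofBool, dList_nil]
        exact ⟨_, _, hT, rfl, by omega⟩
      | [e] =>
        obtain ⟨y, cl, a⟩ := e
        have hy : (y, cl, a) ∈ st :=
          (Multigraph.mem_nbrs.1 (hL ▸ List.mem_singleton_self _ : (y, cl, a) ∈ G.nbrs p st)).1
        obtain ⟨T, hT, hT'⟩ := ih _ k (hinv.chain hL)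
        -- Extending a path reuses the label of the component, so the bound does not grow although
        -- nothing is decided.
        have hnl : numLabels ((p, p :: cl, a) :: st) = numLabels st :=
          numLabels_cons_of_mem ⟨(y, cl, a), hy, rfl⟩
        rw [hnl] at hT'
        refine ⟨300 * (n + 1) ^ 2 + T, Fn.of_wp rfl ?_, hfin T _ hT' (leafBound_pos _ _ _)⟩
        rw [Multigraph.proc_cons_of_singleton hL]
        rw [hL] at hnb
        simp only [wp, procBody, procArg, sel, rst, tl, Data.head_cons, Data.tail_cons,
          List.getD_cons_zero, List.getD_cons_succ, dList_cons, dItem, dEntry] at hT ⊢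
        refine ⟨_, _, hnb, ?_⟩
        simp only [Data.ofBool, dList_nil, dList_cons, dEntry, Data.head_cons, Data.tail_cons]
        exact ⟨_, _, hT, rfl, by omega⟩
      | _ :: _ :: _ =>
        have := hb.2
        rw [hL] at this
        simp at this

/-- One compression step is made for each vertex, each starting from an empty state with at most `k
+ 1` marked vertices. The preparation, done with `diff`, `mark` and `order`, is polynomial. -/
theorem fn_solve {G : Multigraph (Fin n)} {k : ℕ} : ∀ vs : List (Fin n), vs.Nodup → ∃ T,
    Fn prog 21 (.cons (dGraph G) (.cons (un k) (dList dV vs))) (dRes (G.solve k vs)) T ∧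
      T ≤ (vs.length + 1) * (60000 * (n + 1) ^ 4 * 26 ^ k)
  | [], _ => by
    refine ⟨20, Fn.of_wp rfl ?_, ?_⟩
    · simp [wp, solveBody, rst, tl, tt, Data.tail_cons, dList_nil, Multigraph.solve, dRes,
        ofNat_one]
    · have : 0 < (n + 1) ^ 4 * 26 ^ k := by positivity
      simp only [List.length_nil, mul_assoc]
      omega
  | v :: vs, hn => by
    have hpos : 0 < (n + 1) ^ 4 * 26 ^ k := by positivity
    have hn' := (List.nodup_cons.1 hn).2
    obtain ⟨T, hT, hT'⟩ := fn_solve (G := G) (k := k) vs hn'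
    have hvs : vs.length + 1 ≤ n := by
      have := hn.length_le_card
      rwa [Fintype.card_fin] at this
    have ih := G.isRes_solve (k := k) hn'
    have he : (60000 * (n + 1) ^ 4 * 26 ^ k) = 60000 * ((n + 1) ^ 4 * 26 ^ k) := by ring
    rw [List.length_cons, add_mul (_ + 1) 1, one_mul]
    match hs : G.solve k vs with
    | none =>
      rw [hs] at hT
      refine ⟨T + 60, Fn.of_wp rfl ?_, by omega⟩
      rw [Multigraph.solve, hs]
      simp only [wp, solveBody, sel, rst, tl, Data.head_cons, Data.tail_cons,
        List.getD_cons_zero, List.getD_cons_succ, dList_cons]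
      exact ⟨_, _, hT, rfl, by omega⟩
    | some (w, c) =>
      rw [hs] at hT ih
      obtain ⟨hp, hinv⟩ := Multigraph.nextTodo_spec hn ih.1 (Multigraph.subset_of_isRes ih) ih.2.1
      obtain ⟨T₂, hT₂, hT₂'⟩ := fn_proc _ _ k hinv
      have hw : w.length ≤ n := by
        have := ih.1.length_le_card
        rwa [Fintype.card_fin] at this
      have hm1 := fn_mark dV dItem (fun _ _ => rfl) false [] vs
      have hm1' : (vs.map fun x => (x, false)).length ≤ n := by rw [List.length_map]; omega
      rw [List.append_nil] at hm1
      have hd := fn_diff dItem (fun _ => rfl) hw (vs.map fun x => (x, false))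
      have hd' := (List.length_filter_le (fun x : Fin n × Bool => x.1 ∉ w)
        (vs.map fun x => (x, false))).trans hm1'
      have ho := fn_order dV G vs _ hd'
      have hm2 := fn_mark dV dItem (fun _ _ => rfl) true
        (G.order vs.length ((vs.map fun x => (x, false)).filter fun x => x.1 ∉ w)) w
      have hle : ∀ i : ℕ, i ≤ 4 → (n + 1) ^ i ≤ (n + 1) ^ 4 * 26 ^ k := fun i hi =>
        (Nat.pow_le_pow_right (by omega) hi).trans (Nat.le_mul_of_pos_right _ (by positivity))
      have hd1 : ((vs.map fun x => (x, false)).length + 1) * (80 * (n + 1) ^ 2) ≤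
          80 * ((n + 1) ^ 4 * 26 ^ k) := by
        calc _ ≤ (n + 1) * (80 * (n + 1) ^ 2) := Nat.mul_le_mul_right _ (by omega)
          _ = 80 * (n + 1) ^ 3 := by ring
          _ ≤ _ := Nat.mul_le_mul_left _ (hle 3 (by norm_num))
      have ho1 : (vs.length + 1) * (400 * (n + 1) ^ 3) ≤ 400 * ((n + 1) ^ 4 * 26 ^ k) := by
        calc _ ≤ (n + 1) * (400 * (n + 1) ^ 3) := Nat.mul_le_mul_right _ (by omega)
          _ = 400 * (n + 1) ^ 4 := by ring
          _ ≤ _ := Nat.mul_le_mul_left _ (hle 4 (by norm_num))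
      have hn1 := hle 1 (by norm_num)
      rw [pow_one] at hn1
      -- Only `v` and the at most `k` vertices of the witness are marked; ordering the forest
      -- introduces no marks.
      have hcount : (G.nextTodo v vs w).countP (·.2) ≤ k + 1 := by
        have hF : ∀ (m : ℕ) (l : List (Fin n × Bool)), (∀ x ∈ l, x.2 = false) →
            ∀ x ∈ G.order m l, x.2 = false := by
          intro m
          induction m with
          | zero => intro l _ x hx; simp [Multigraph.order] at hx
          | succ m ihm =>
            intro l hl x hx
            rw [Multigraph.order] at hx
            match hf : G.findLeaf l l with
            | none => rw [hf] at hx; simp at hx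
            | some y =>
              rw [hf] at hx
              rcases List.mem_cons.1 hx with rfl | hx
              · exact hl _ (Multigraph.findLeaf_mem hf).1
              · exact ihm _ (fun z hz => hl z (List.mem_filter.1 hz).1) x hx
        have h0 : (G.order vs.length ((vs.map fun x => (x, false)).filter
            fun x => x.1 ∉ w)).countP (·.2) = 0 := by
          rw [List.countP_eq_zero]
          intro x hx
          rw [hF _ _ (fun y hy => ?_) x hx]
          · simp
          · obtain ⟨u, _, rfl⟩ := List.mem_map.1 (List.mem_filter.1 hy).1
            rfl
        rw [Multigraph.nextTodo, List.countP_cons, List.countP_append, h0]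
        have := List.countP_le_length (p := (·.2)) (l := w.map fun x => (x, true))
        rw [List.length_map] at this
        have := ih.2.2.1
        simp only [if_true]
        omega
      have hlen : (G.nextTodo v vs w).length ≤ n := by
        have := hp.length_eq
        rw [List.length_map, List.length_cons] at this
        omega
      have hT₂'' : T₂ ≤ 54000 * ((n + 1) ^ 4 * 26 ^ k) := by
        have hlb : leafBound k (numLabels ([] : List (Entry (Fin n))))
            ((G.nextTodo v vs w).countP (·.2)) ≤ 3 * 26 ^ k := by
          unfold leafBound numLabels
          simp only [List.map_nil, List.toFinset_nil, Finset.card_empty, pow_zero, mul_one]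
          calc _ ≤ 7 ^ k * 3 ^ (k + 1) :=
                Nat.mul_le_mul_left _ (Nat.pow_le_pow_right (by norm_num) hcount)
            _ = 3 * 21 ^ k := by rw [show 21 = 7 * 3 by norm_num, mul_pow]; ring
            _ ≤ _ := Nat.mul_le_mul_left _ (Nat.pow_le_pow_left (by norm_num) k)
        have hh : (G.nextTodo v vs w).length * (2 * n + 2) + 1 ≤ 4 * (n + 1) ^ 2 := by
          have := Nat.mul_le_mul_right (2 * n + 2) hlen
          nlinarith
        calc T₂ ≤ _ := hT₂'
          _ ≤ 4500 * (n + 1) ^ 2 * (4 * (n + 1) ^ 2) * (3 * 26 ^ k) :=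
            Nat.mul_le_mul (Nat.mul_le_mul_left _ hh) hlb
          _ = _ := by ring
      refine ⟨T + (59000 * ((n + 1) ^ 4 * 26 ^ k)), Fn.of_wp rfl ?_, by omega⟩
      rw [Multigraph.solve, hs]
      simp only [Multigraph.nextTodo, procArg, dList_cons, dItem, Data.ofBool, dList_nil]
        at hT₂ hm1 hm2
      simp only [wp, solveBody, sel, rst, tl, tt, Data.head_cons, Data.tail_cons, dRes,
        List.getD_cons_zero, List.getD_cons_succ, dList_cons] at hT ⊢
      exact ⟨_, _, hT, _, _, hm1, _, _, hd, _, _, ho, _, _, hm2, _, _, hT₂, rfl, by omega⟩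

/-- The conversion of `k` to unary is absorbed by `26 ^ k`. The `2` in the bound is reserved for the
initial call and the reading of its argument. -/
theorem fn_main (G : Multigraph (Fin n)) (k : ℕ) :
    ∃ T, Fn prog 0 (encodeInstance G k) (Data.ofNat (G.numMinFVS k)) T ∧
      T + 2 ≤ 26 ^ k * (61000 * (n + 1) ^ 5) := by
  have h1 := fn_toUn k
  have h2 := fn_verts (List.ofFn fun u : Fin n =>
    Data.ofList (List.ofFn fun v : Fin n => Data.ofNat (G.mult s(u, v)))) 0
  have hvs : dList un (List.range' 0 n) = dList dV (List.finRange n) := by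
    have : List.range' 0 n = (List.finRange n).map Fin.val := by
      rw [← List.range_eq_range']
      simp
    rw [this]
    rw [dList, dList, List.map_map]; rfl
  rw [List.length_ofFn, hvs] at h2
  obtain ⟨T, hT, hT'⟩ := fn_solve (G := G) (k := k) (List.finRange n) (List.nodup_finRange n)
  have hcount := G.countOf_solve (k := k) (List.nodup_finRange n) List.mem_finRange
  -- The absent result is represented by `nil`, whose projection `nil` is also the number zero, so
  -- the case of no small solution needs no separate test.
  have hres : (dRes (G.solve k (List.finRange n))).tail = Data.ofNat (G.numMinFVS k) := by
    rw [← hcount]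
    match G.solve k (List.finRange n) with
    | none => exact ofNat_zero.symm
    | some (w, c) => rfl
  refine ⟨100 * k + 20 + 20 * (n + 1) + T + 60, Fn.of_wp rfl ?_, ?_⟩
  · simp only [wp, mainBody, encodeInstance, sel, rst, tl, Data.head_cons, Data.tail_cons,
      List.getD_cons_zero, List.getD_cons_succ]
    exact ⟨_, _, h1, _, _, h2, _, _, hT, hres, by omega⟩
  · rw [List.length_finRange] at hT'
    have e1 : (n + 1) * (60000 * (n + 1) ^ 4 * 26 ^ k) = 60000 * (26 ^ k * (n + 1) ^ 5) := by ring
    have e2 : 26 ^ k * (61000 * (n + 1) ^ 5) = 61000 * (26 ^ k * (n + 1) ^ 5) := by ring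
    have e3 : k < 26 ^ k := Nat.lt_pow_self (by norm_num)
    have e4 : n + 1 ≤ (n + 1) ^ 5 := Nat.le_self_pow (by norm_num) _
    have e5 : 26 ^ k ≤ 26 ^ k * (n + 1) ^ 5 := Nat.le_mul_of_pos_right _ (by positivity)
    have e6 : (n + 1) ^ 5 ≤ 26 ^ k * (n + 1) ^ 5 := Nat.le_mul_of_pos_left _ (by positivity)
    omega

end MainCost
end CountFVS

/-- There is an algorithm that, given a graph `G` on `n` vertices (with parallel edges allowed)
and a natural number `k`, computes `#minFVS(G, k)` in time `26 ^ k * poly(n)`, hence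
in time `2 ^ O(k) * poly(n)`. -/
theorem mainTheorem3 :
    ∃ (P : CountFVS.Program) (p : Polynomial ℕ),
      ∀ (n : ℕ) (G : CountFVS.Multigraph (Fin n)) (k : ℕ),
        ∃ t : ℕ, t ≤ 26 ^ k * p.eval n ∧
          P.Computes (CountFVS.encodeInstance G k) (CountFVS.Data.ofNat (G.numMinFVS k)) t := by
  refine ⟨CountFVS.prog, Polynomial.C 61000 * (Polynomial.X + 1) ^ 5, fun n G k => ?_⟩
  obtain ⟨T, ⟨b, t, hb, he, ht⟩, hT⟩ := CountFVS.fn_main G k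
  refine ⟨1 + t + 1, ?_, .call hb (.var _ 0) he⟩
  simp only [Polynomial.eval_mul, Polynomial.eval_C, Polynomial.eval_pow, Polynomial.eval_add,
    Polynomial.eval_X, Polynomial.eval_one]
  omega
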